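/- Let $(T,\chi)$ be a $\mathsf{bip}$-elimination forest of a finite simple graph $G$: $T$ is a finite rooted forest and $\chi$ assigns to each node of $T$ a subset (bag) of $V(G)$ such that (i) every internal node has a bag of size exactly $1$, (ii) the bags are pairwise disjoint and cover $V(G)$ (bags of leaves may be empty), (iii) for every edge $uv$ of $G$ with $u\in\chi(t_1)$ and $v\in\chi(t_2)$, one of $t_1,t_2$ is an ancestor of the other (each node being an ancestor of itself), and (iv) for every leaf $t$ the induced subgraph $G[\chi(t)]$ is bipartite. Its depth $d$ is the maximum number of edges on a root-to-leaf path of $T$ ($0$ if $T$ has no nodes). The problem \textsc{Odd Cycle Transversal} asks for a minimum-cardinality set $X\subseteq V(G)$ such that $G-X$ is bipartite. Theorem. There is a single deterministic algorithm that, given a graph $G$ with $n$ vertices and $m$ edges (as a list of its edges) together with a $\mathsf{bip}$-elimination forest $(T,\chi)$ of $G$ of depth $d$ (given by the parent of each node and, for each vertex, the node whose bag contains it), outputs a minimum odd cycle transversal of $G$ and its size in time $\mathcal{O}(3^d\cdot d^2\cdot(n+m))$ and polynomial space. Here the factors $d^2$ and $n+m$ are read as $1$ when they are $0$; the constant in the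 $\mathcal{O}$ is absolute; time is the number of steps on a word RAM whose words have $\mathcal{O}(\log(n+m+|V(T)|+2))$ bits, and the number of words of memory is polynomial in the input size $n+m+|V(T)|+2$. -/

import Mathlib

namespace OddCycleTransversal

/-! ### Rooted forests and elimination forests -/

/-- A rooted forest on the node set `ν`, given by its parent map (`none` at the roots).
Well-foundedness says that climbing from any node ends at a root. -/
structure RootedForest (ν : Type) where
  parent : ν → Option ν
  wf : WellFounded fun s t : ν => parent t = some s

namespace RootedForest

variable {ν : Type} (F : RootedForest ν)

/-- `s` lies on the path from the root of its tree to `t`; every node is an ancestor of itself. -/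
def Ancestor (s t : ν) : Prop := Relation.ReflTransGen (fun a b => F.parent b = some a) s t

def ProperAncestor (s t : ν) : Prop := Relation.TransGen (fun a b => F.parent b = some a) s t

/-- A leaf is a node without children. The other nodes are the internal nodes. -/
def IsLeaf (t : ν) : Prop := ∀ s, F.parent s ≠ some t

/-- The number of edges on the path from `t` to the root of its tree, that is, the number of
proper ancestors of `t`. -/
noncomputable def nodeDepth (t : ν) : ℕ := {s | F.ProperAncestor s t}.ncard

open Classical in
/-- The maximum number of edges on a root-to-leaf path (`0` for the forest without nodes). -/
noncomputable def depth [Fintype ν] : ℕ :=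
  (Finset.univ.filter fun t => F.IsLeaf t).sup F.nodeDepth

end RootedForest

/-- `(F, χ)` is an `H`-elimination forest of `G`. The bags are disjoint and cover the vertex set;
the bag of a leaf may be empty. -/
structure IsEliminationForest (H : ∀ W : Type, SimpleGraph W → Prop) {V ν : Type}
    (G : SimpleGraph V) (F : RootedForest ν) (χ : ν → Set V) : Prop where
  internal : ∀ t, ¬ F.IsLeaf t → (χ t).ncard = 1
  partition : ∀ v, ∃! t, v ∈ χ t
  edge : ∀ u v t₁ t₂, G.Adj u v → u ∈ χ t₁ → v ∈ χ t₂ → F.Ancestor t₁ t₂ ∨ F.Ancestor t₂ t₁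
  base : ∀ t, F.IsLeaf t → H (χ t) (G.induce (χ t))

/-- The class of bipartite (properly 2-colourable) graphs. -/
def Bip (W : Type) (G : SimpleGraph W) : Prop := G.IsBipartite

/-! ### Odd cycle transversals -/

/-- `G - X` is bipartite. -/
def IsOCT {V : Type} (G : SimpleGraph V) (X : Finset V) : Prop :=
  (G.induce ((X : Set V)ᶜ)).IsBipartite

def IsMinimumOCT {V : Type} (G : SimpleGraph V) (X : Finset V) : Prop :=
  IsOCT G X ∧ ∀ Y : Finset V, IsOCT G Y → X.card ≤ Y.card

/-! ### The machine model: a word RAM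

A program is a fixed text that names finitely many word variables and finitely many arrays of
words. A run is relative to a bound `B` on words (every word is `< B`) and a bound `S` on the
length of the arrays (every address is `< S`). A run thus takes place in memory of at most
`k + a * S` words of `⌈log₂ B⌉` bits, with `k` and `a` the numbers of variables and of arrays
that the program names. There is no overflow: a step that would leave these bounds has no successor,
so that a program with such a step has no run. -/

inductive Op
  | add | sub | mul | div | lt | eq

/-- Subtraction is truncated at `0`, division rounds down, comparisons return `1` or `0`. -/
def Op.apply : Op → ℕ → ℕ → ℕ
  | add, x, y => x + y
  | sub, x, y => x - y
  | mul, x, y => x * y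
  | div, x, y => x / y
  | lt, x, y => if x < y then 1 else 0
  | eq, x, y => if x = y then 1 else 0

/-- Expressions: constants, variables, array cells, elementary operations. -/
inductive Expr
  | const (k : ℕ)
  | var (x : ℕ)
  | read (a : ℕ) (i : Expr)
  | bin (o : Op) (e₁ e₂ : Expr)

/-- Programs. `store a i e` writes the value of `e` to cell `i` of array `a`; conditions are true
when they are nonzero. -/
inductive Prog
  | skip
  | assign (x : ℕ) (e : Expr)
  | store (a : ℕ) (i e : Expr)
  | seq (p q : Prog)
  | ite (e : Expr) (p q : Prog)
  | loop (e : Expr) (p : Prog)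

/-- Contents of the variables and of the arrays. -/
structure Memory where
  var : ℕ → ℕ
  arr : ℕ → ℕ → ℕ

def Memory.setVar (σ : Memory) (x v : ℕ) : Memory :=
  { σ with var := Function.update σ.var x v }

def Memory.setArr (σ : Memory) (a i v : ℕ) : Memory :=
  { σ with arr := Function.update σ.arr a (Function.update (σ.arr a) i v) }

def Expr.eval (σ : Memory) : Expr → ℕ
  | const k => k
  | var x => σ.var x
  | read a i => σ.arr a (i.eval σ)
  | bin o e₁ e₂ => o.apply (e₁.eval σ) (e₂.eval σ)

/-- Every word in the evaluation is `< B` and every address is `< S`. -/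
def Expr.Fits (B S : ℕ) (σ : Memory) : Expr → Prop
  | const k => k < B
  | var x => σ.var x < B
  | read a i => i.Fits B S σ ∧ i.eval σ < S ∧ σ.arr a (i.eval σ) < B
  | bin o e₁ e₂ =>
      e₁.Fits B S σ ∧ e₂.Fits B S σ ∧ o.apply (e₁.eval σ) (e₂.eval σ) < B

/-- Each constant, access and elementary operation costs one step. -/
def Expr.cost : Expr → ℕ
  | const _ => 1
  | var _ => 1
  | read _ i => i.cost + 1
  | bin _ e₁ e₂ => e₁.cost + e₂.cost + 1

/-- `Run B S p σ t τ`: with words `< B` and addresses `< S`, the program `p` started in memory `σ`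
halts after `t` steps in memory `τ`. -/
inductive Run (B S : ℕ) : Prog → Memory → ℕ → Memory → Prop
  | skip (σ : Memory) : Run B S .skip σ 1 σ
  | assign (σ : Memory) (x : ℕ) (e : Expr) (he : e.Fits B S σ) :
      Run B S (.assign x e) σ (e.cost + 1) (σ.setVar x (e.eval σ))
  | store (σ : Memory) (a : ℕ) (i e : Expr) (hi : i.Fits B S σ) (hS : i.eval σ < S)
      (he : e.Fits B S σ) :
      Run B S (.store a i e) σ (i.cost + e.cost + 1) (σ.setArr a (i.eval σ) (e.eval σ))
  | seq {p q : Prog} {σ τ υ : Memory} {t u : ℕ} (hp : Run B S p σ t τ) (hq : Run B S q τ u υ) :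
      Run B S (.seq p q) σ (t + u) υ
  | iteTrue {e : Expr} {p q : Prog} {σ τ : Memory} {t : ℕ} (he : e.Fits B S σ)
      (h : e.eval σ ≠ 0) (hp : Run B S p σ t τ) : Run B S (.ite e p q) σ (e.cost + 1 + t) τ
  | iteFalse {e : Expr} {p q : Prog} {σ τ : Memory} {t : ℕ} (he : e.Fits B S σ)
      (h : e.eval σ = 0) (hq : Run B S q σ t τ) : Run B S (.ite e p q) σ (e.cost + 1 + t) τ
  | loopStop {e : Expr} {p : Prog} {σ : Memory} (he : e.Fits B S σ) (h : e.eval σ = 0) :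
      Run B S (.loop e p) σ (e.cost + 1) σ
  | loopStep {e : Expr} {p : Prog} {σ τ υ : Memory} {t u : ℕ} (he : e.Fits B S σ)
      (h : e.eval σ ≠ 0) (hp : Run B S p σ t τ) (hl : Run B S (.loop e p) τ u υ) :
      Run B S (.loop e p) σ (e.cost + 1 + t + u) υ

/-! ### Input and output -/

/-- `e` lists every edge of `G` exactly once, with an arbitrary order of its ends. -/
def IsEdgeList {n m : ℕ} (G : SimpleGraph (Fin n)) (e : Fin m → Fin n × Fin n) : Prop :=
  (Function.Injective fun i => s((e i).1, (e i).2)) ∧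
    (Set.range fun i => s((e i).1, (e i).2)) = G.edgeSet

/-- The array with the cells `f 0, …, f (k - 1)`, followed by zeros. -/
def cells {k : ℕ} (f : Fin k → ℕ) (i : ℕ) : ℕ := if h : i < k then f ⟨i, h⟩ else 0

/-- The memory in which a program starts. Variables `0, 1, 2` hold the numbers `n, m, N` of vertices,
edges and nodes. Arrays `0` and `1` hold the first and second ends of the edges, array `2` holds for
each vertex `v` the node `b v` whose bag contains it, and array `3` holds for each node `0` if it is
a root and `j + 1` if its parent is `j`. Everything else is zero. -/
def inputMemory {n m N : ℕ} (e : Fin m → Fin n × Fin n) (b : Fin n → Fin N)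
    (F : RootedForest (Fin N)) : Memory where
  var x := match x with
    | 0 => n
    | 1 => m
    | 2 => N
    | _ => 0
  arr a := match a with
    | 0 => cells fun i => ((e i).1 : ℕ)
    | 1 => cells fun i => ((e i).2 : ℕ)
    | 2 => cells fun v => (b v : ℕ)
    | 3 => cells fun t => ((F.parent t).elim 0 fun j => (j : ℕ) + 1)
    | _ => fun _ => 0

/-- The output in `τ` is `X`: variable `3` holds `|X|`, and the first `|X|` cells of array `4` list
the elements of `X`. -/
def Outputs {n : ℕ} (τ : Memory) (X : Finset (Fin n)) : Prop :=
  τ.var 3 = X.card ∧ (Finset.range X.card).image (τ.arr 4) = X.map Fin.valEmbedding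

end OddCycleTransversal

open OddCycleTransversal

namespace OddCycleTransversal

/-! ### Total correctness with time bounds -/

/-! Give every vertex colour 1 or 2, or 0 for deletion. Odd cycle transversals are exactly the zero
sets of proper partial colourings (`isOCT_zeros`, `IsOCT.exists_colour`), so the task is to minimise
the number of zeros. Call a vertex internal if other vertices lie below its bag; it is then alone in
its bag. The other bags are leaf bags, and `D` is the largest depth of a vertex.

Leaf bags need few deletions. If a colouring deletes more than `D` vertices of a leaf bag, it is
cheaper to delete all vertices above the bag, at most `D` of them, and to 2-colour the bag afresh
(`Inst.exists_colouring_le`). Hence it suffices to compete with colourings that delete at most `D`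
vertices of each leaf bag.

Once the internal vertices are coloured, the leaf bags are independent minimum vertex cut problems.
Fix a proper 2-colouring `side` of the bags and ask of each vertex whether its colour agrees with
it. An edge inside the bag forces its surviving ends to answer alike, and an edge to a coloured
vertex above forces the answer: agreement ties the vertex to a source, disagreement to a sink.
`Flow.le_dels` and `Flow.dels_le` are the two halves of max-flow min-cut in this setting. A flow is
described by testing it against arbitrary node weights, which puts conservation and value into one
identity: a cut is tested with its indicator, and reversing a half arc shifts the identity by a
difference of weights (`net_flip`). All bags live in one network as separate components, so a single
breadth-first search augments every bag at once. After `D + 1` such phases each bag has either a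
minimum cut or a flow that rules out `D` deletions (`Tr.flowProg`).

The colours of the internal vertices are enumerated by one ternary digit per depth, used by all
internal vertices of that depth simultaneously; there are `3 ^ D` strings. A vertex whose digit
clashes with a state above it is deleted. Such a string is merely wasted: a colouring that follows
its own digits is met without clashes (`IsState.eq_colouring`). Different subtrees reach their
optimum at different strings, so a table with one row per level remembers, for each subtree
separately, the best solution so far. The strings are run through as a ternary counter. When the
digits below depth `l` have been exhausted, row `l + 1` is optimal for the current digit at depth
`l` (`Full.cnt_le`) and competes with row `l` (`Part.step`); when that digit has taken all three
values, row `l` is optimal in turn (`Part.full`). At level `0` no digit is left to depend on, and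
the row is a minimum (`Full.minimum`). Each string costs `O((D + 1) * (n + m + 1))` steps.

Programs are verified by total-correctness triples `Tr` that carry a time bound. Loop-free code is
handled by weakest preconditions, loops by a decreasing potential, and unchanged memory by the
syntactic frame rule `Run.frame`. -/

instance (k : ℕ) : OfNat Expr k := ⟨.const k⟩
instance : Add Expr := ⟨.bin .add⟩
instance : Sub Expr := ⟨.bin .sub⟩
instance : Mul Expr := ⟨.bin .mul⟩
instance : Div Expr := ⟨.bin .div⟩

/-- The expression with value `1` or `0` for `e₁ < e₂`. -/
def Expr.lt (e₁ e₂ : Expr) : Expr := .bin .lt e₁ e₂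

/-- The expression with value `1` or `0` for `e₁ = e₂`. -/
def Expr.eq (e₁ e₂ : Expr) : Expr := .bin .eq e₁ e₂

/-- `1` or `0`, as `x < y` or not. -/
def ltN (x y : ℕ) : ℕ := Op.lt.apply x y

/-- `1` or `0`, as `x = y` or not. -/
def eqN (x y : ℕ) : ℕ := Op.eq.apply x y

@[simp] lemma ltN_eq_zero {x y : ℕ} : ltN x y = 0 ↔ y ≤ x := by
  simp [ltN, Op.apply]

@[simp] lemma eqN_eq_zero {x y : ℕ} : eqN x y = 0 ↔ x ≠ y := by
  simp [eqN, Op.apply]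

lemma ltN_le (x y : ℕ) : ltN x y ≤ 1 := by
  simp only [ltN, Op.apply]
  split_ifs <;> omega

lemma eqN_le (x y : ℕ) : eqN x y ≤ 1 := by
  simp only [eqN, Op.apply]
  split_ifs <;> omega

infixr:60 " ;; " => Prog.seq

namespace Expr

variable (σ : Memory) (B S : ℕ) (e₁ e₂ i : Expr) (k x a : ℕ)

@[simp] lemma eval_ofNat : (no_index (OfNat.ofNat k) : Expr).eval σ = (OfNat.ofNat k : ℕ) := rfl
@[simp] lemma eval_zero : (0 : Expr).eval σ = 0 := rfl
@[simp] lemma eval_one : (1 : Expr).eval σ = 1 := rfl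
@[simp] lemma eval_const : (Expr.const k).eval σ = k := rfl
@[simp] lemma eval_var : (Expr.var x).eval σ = σ.var x := rfl
@[simp] lemma eval_read : (Expr.read a i).eval σ = σ.arr a (i.eval σ) := rfl
@[simp] lemma eval_add : (e₁ + e₂).eval σ = e₁.eval σ + e₂.eval σ := rfl
@[simp] lemma eval_sub : (e₁ - e₂).eval σ = e₁.eval σ - e₂.eval σ := rfl
@[simp] lemma eval_mul : (e₁ * e₂).eval σ = e₁.eval σ * e₂.eval σ := rfl
@[simp] lemma eval_div : (e₁ / e₂).eval σ = e₁.eval σ / e₂.eval σ := rfl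
@[simp] lemma eval_lt : (e₁.lt e₂).eval σ = ltN (e₁.eval σ) (e₂.eval σ) := rfl
@[simp] lemma eval_eq : (e₁.eq e₂).eval σ = eqN (e₁.eval σ) (e₂.eval σ) := rfl

@[simp] lemma fits_ofNat : (no_index (OfNat.ofNat k) : Expr).Fits B S σ ↔ (OfNat.ofNat k : ℕ) < B := Iff.rfl
@[simp] lemma fits_zero : (0 : Expr).Fits B S σ ↔ 0 < B := Iff.rfl
@[simp] lemma fits_one : (1 : Expr).Fits B S σ ↔ 1 < B := Iff.rfl
@[simp] lemma fits_const : (Expr.const k).Fits B S σ ↔ k < B := Iff.rfl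
@[simp] lemma fits_var : (Expr.var x).Fits B S σ ↔ σ.var x < B := Iff.rfl
@[simp] lemma fits_read : (Expr.read a i).Fits B S σ ↔
    i.Fits B S σ ∧ i.eval σ < S ∧ σ.arr a (i.eval σ) < B := Iff.rfl
@[simp] lemma fits_add : (e₁ + e₂).Fits B S σ ↔
    e₁.Fits B S σ ∧ e₂.Fits B S σ ∧ e₁.eval σ + e₂.eval σ < B := Iff.rfl
@[simp] lemma fits_sub : (e₁ - e₂).Fits B S σ ↔
    e₁.Fits B S σ ∧ e₂.Fits B S σ ∧ e₁.eval σ - e₂.eval σ < B := Iff.rfl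
@[simp] lemma fits_mul : (e₁ * e₂).Fits B S σ ↔
    e₁.Fits B S σ ∧ e₂.Fits B S σ ∧ e₁.eval σ * e₂.eval σ < B := Iff.rfl
@[simp] lemma fits_div : (e₁ / e₂).Fits B S σ ↔
    e₁.Fits B S σ ∧ e₂.Fits B S σ ∧ e₁.eval σ / e₂.eval σ < B := Iff.rfl
variable {B} in
@[simp] lemma fits_lt (hB : 1 < B) : (e₁.lt e₂).Fits B S σ ↔ e₁.Fits B S σ ∧ e₂.Fits B S σ :=
  ⟨fun h => ⟨h.1, h.2.1⟩, fun h => ⟨h.1, h.2, (ltN_le _ _).trans_lt hB⟩⟩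

variable {B} in
@[simp] lemma fits_eq (hB : 1 < B) : (e₁.eq e₂).Fits B S σ ↔ e₁.Fits B S σ ∧ e₂.Fits B S σ :=
  ⟨fun h => ⟨h.1, h.2.1⟩, fun h => ⟨h.1, h.2, (eqN_le _ _).trans_lt hB⟩⟩

end Expr

namespace Memory

variable (σ : Memory)

@[simp] lemma var_setVar (x v y : ℕ) :
    (σ.setVar x v).var y = if y = x then v else σ.var y := by
  simp [setVar, Function.update_apply]

@[simp] lemma arr_setVar (x v : ℕ) : (σ.setVar x v).arr = σ.arr := rfl

@[simp] lemma var_setArr (a i v : ℕ) : (σ.setArr a i v).var = σ.var := rfl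

@[simp] lemma arr_setArr (a i v b : ℕ) :
    (σ.setArr a i v).arr b = if b = a then fun j => if j = i then v else σ.arr b j
      else σ.arr b := by
  funext j
  simp only [setArr, Function.update_apply]
  split_ifs with h <;> simp_all [Function.update_apply]

end Memory

namespace Prog

/-- Whether the program names variable `x` as the target of an assignment. -/
def wVar : Prog → ℕ → Bool
  | skip, _ => false
  | assign y _, x => x == y
  | store _ _ _, _ => false
  | seq p q, x => p.wVar x || q.wVar x
  | ite _ p q, x => p.wVar x || q.wVar x
  | loop _ p, x => p.wVar x

/-- Whether the program names array `a` as the target of a store. -/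
def wArr : Prog → ℕ → Bool
  | skip, _ => false
  | assign _ _, _ => false
  | store b _ _, a => a == b
  | seq p q, a => p.wArr a || q.wArr a
  | ite _ p q, a => p.wArr a || q.wArr a
  | loop _ p, a => p.wArr a

/-- The program changes none of the variables `xs` and none of the arrays `as`. -/
def keeps (p : Prog) (xs as : List ℕ) : Bool := xs.all (!p.wVar ·) && as.all (!p.wArr ·)

/-- A bound on the time of a program without loops. -/
def size : Prog → ℕ
  | skip => 1
  | assign _ e => e.cost + 1
  | store _ i e => i.cost + e.cost + 1
  | seq p q => p.size + q.size
  | ite e p q => e.cost + 1 + max p.size q.size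
  | loop _ _ => 0

/-- The weakest precondition of a program without loops. -/
def wp (B : ℕ) : Prog → (Memory → Prop) → Memory → Prop
  | skip, Q, σ => Q σ
  | assign x e, Q, σ => e.Fits B B σ ∧ Q (σ.setVar x (e.eval σ))
  | store a i e, Q, σ =>
      (i.Fits B B σ ∧ i.eval σ < B ∧ e.Fits B B σ) ∧ Q (σ.setArr a (i.eval σ) (e.eval σ))
  | seq p q, Q, σ => p.wp B (q.wp B Q) σ
  | ite e p q, Q, σ => e.Fits B B σ ∧ (e.eval σ ≠ 0 → p.wp B Q σ) ∧ (e.eval σ = 0 → q.wp B Q σ)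
  | loop _ _, _, _ => False

end Prog

/-- `τ` differs from `σ` only in variables and arrays to which `p` writes. -/
structure Frame (p : Prog) (σ τ : Memory) : Prop where
  var : ∀ x, p.wVar x = false → τ.var x = σ.var x
  arr : ∀ a, p.wArr a = false → τ.arr a = σ.arr a

lemma Frame.refl (p : Prog) (σ : Memory) : Frame p σ σ := ⟨fun _ _ => rfl, fun _ _ => rfl⟩

lemma Frame.trans {p : Prog} {σ τ υ : Memory} (h : Frame p σ τ) (h' : Frame p τ υ) :
    Frame p σ υ :=
  ⟨fun x hx => (h'.var x hx).trans (h.var x hx), fun a ha => (h'.arr a ha).trans (h.arr a ha)⟩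

lemma Frame.mono {p q : Prog} {σ τ : Memory} (h : Frame p σ τ)
    (hv : ∀ x, q.wVar x = false → p.wVar x = false)
    (ha : ∀ x, q.wArr x = false → p.wArr x = false) : Frame q σ τ :=
  ⟨fun x hx => h.var x (hv x hx), fun a hh => h.arr a (ha a hh)⟩

lemma Frame.setVar {p : Prog} (σ : Memory) (x v : ℕ) (hx : p.wVar x = true) :
    Frame p σ (σ.setVar x v) := by
  refine ⟨fun y hy => ?_, fun _ _ => rfl⟩
  have : y ≠ x := by rintro rfl; simp [hx] at hy
  simp [this]

/-- Which cells can change is visible in the program text, so postconditions list only what a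
program computes; everything else is recovered by evaluating `wVar` and `wArr`. -/
lemma Run.frame {B S : ℕ} {p : Prog} {σ τ : Memory} {t : ℕ} (h : Run B S p σ t τ) :
    Frame p σ τ := by
  induction h with
  | skip => exact Frame.refl _ _
  | assign σ x e _ =>
    refine ⟨fun y hy => ?_, fun _ _ => rfl⟩
    have : y ≠ x := by simpa [Prog.wVar] using hy
    simp [this]
  | store σ a i e _ _ _ =>
    refine ⟨fun _ _ => rfl, fun b hb => ?_⟩
    have : b ≠ a := by simpa [Prog.wArr] using hb
    funext j
    simp [this]
  | seq _ _ h₁ h₂ =>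
    exact (h₁.mono (by simp +contextual [Prog.wVar]) (by simp +contextual [Prog.wArr])).trans
      (h₂.mono (by simp +contextual [Prog.wVar]) (by simp +contextual [Prog.wArr]))
  | iteTrue _ _ _ h₁ =>
    exact h₁.mono (by simp +contextual [Prog.wVar]) (by simp +contextual [Prog.wArr])
  | iteFalse _ _ _ h₁ =>
    exact h₁.mono (by simp +contextual [Prog.wVar]) (by simp +contextual [Prog.wArr])
  | loopStop => exact Frame.refl _ _
  | loopStep _ _ _ _ h₁ h₂ =>
    exact Frame.trans (p := .loop _ _) ⟨h₁.var, h₁.arr⟩ h₂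

/-- Started in `σ`, with words and addresses `< B`, the program halts within `T` steps in a memory
that satisfies `Q`. -/
def Tr (B : ℕ) (p : Prog) (T : ℕ) (σ : Memory) (Q : Memory → Prop) : Prop :=
  ∃ t τ, Run B B p σ t τ ∧ t ≤ T ∧ Q τ

namespace Tr

variable {B T T₁ T₂ : ℕ} {p q : Prog} {σ : Memory} {Q R : Memory → Prop}

lemma conseq (h : Tr B p T₁ σ R) (hT : T₁ ≤ T) (hQ : ∀ τ, R τ → Frame p σ τ → Q τ) :
    Tr B p T σ Q := by
  obtain ⟨t, τ, hr, ht, h⟩ := h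
  exact ⟨t, τ, hr, ht.trans hT, hQ τ h hr.frame⟩

/-- The second program is analysed with the frame of the first at hand, so the intermediate
assertion need not repeat what is preserved. -/
lemma seq (h : Tr B p T₁ σ R) (hq : ∀ τ, R τ → Frame p σ τ → Tr B q T₂ τ Q)
    (hT : T₁ + T₂ ≤ T := by exact le_rfl) : Tr B (p ;; q) T σ Q := by
  obtain ⟨t, τ, hr, ht, h⟩ := h
  obtain ⟨u, υ, hr', hu, h'⟩ := hq τ h hr.frame
  exact ⟨t + u, υ, .seq hr hr', by omega, h'⟩

lemma ite {e : Expr} (he : e.Fits B B σ) (hp : e.eval σ ≠ 0 → Tr B p T σ Q)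
    (hq : e.eval σ = 0 → Tr B q T σ Q) : Tr B (.ite e p q) (e.cost + 1 + T) σ Q := by
  by_cases h : e.eval σ = 0
  · obtain ⟨t, τ, hr, ht, h'⟩ := hq h
    exact ⟨_, τ, .iteFalse he h hr, by omega, h'⟩
  · obtain ⟨t, τ, hr, ht, h'⟩ := hp h
    exact ⟨_, τ, .iteTrue he h hr, by omega, h'⟩

lemma of_wp (h : p.wp B Q σ) : Tr B p p.size σ Q := by
  induction p generalizing σ Q with
  | skip => exact ⟨1, σ, .skip σ, le_rfl, h⟩
  | assign x e => exact ⟨_, _, .assign σ x e h.1, le_rfl, h.2⟩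
  | store a i e => exact ⟨_, _, .store σ a i e h.1.1 h.1.2.1 h.1.2.2, le_rfl, h.2⟩
  | seq p q ihp ihq => exact (ihp h).seq fun τ hτ _ => ihq hτ
  | ite e p q ihp ihq =>
    exact ite h.1 (fun h0 => (ihp (h.2.1 h0)).conseq (le_max_left _ _) fun _ h _ => h)
      (fun h0 => (ihq (h.2.2 h0)).conseq (le_max_right _ _) fun _ h _ => h)
  | loop e p _ => exact h.elim

/-- A loop whose invariant carries a potential that each round decreases. -/
lemma loop {e : Expr} (I : ℕ → Memory → Prop) {k : ℕ} (h0 : I k σ)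
    (hstep : ∀ k τ, I k τ → Frame (.loop e p) σ τ →
      e.Fits B B τ ∧ (e.eval τ ≠ 0 → Tr B p T τ fun υ => ∃ k' < k, I k' υ)) :
    Tr B (.loop e p) (k * (T + e.cost + 1) + e.cost + 1) σ
      fun τ => (∃ k', I k' τ) ∧ e.eval τ = 0 := by
  suffices H : ∀ k τ, I k τ → Frame (.loop e p) σ τ →
      Tr B (.loop e p) (k * (T + e.cost + 1) + e.cost + 1) τ
        fun τ => (∃ k', I k' τ) ∧ e.eval τ = 0 from H k σ h0 (Frame.refl _ _)
  intro k
  induction k using Nat.strong_induction_on with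
  | _ k ih =>
    intro τ hI hf
    obtain ⟨hfit, hbody⟩ := hstep k τ hI hf
    by_cases he : e.eval τ = 0
    · exact ⟨_, τ, .loopStop hfit he, by omega, ⟨k, hI⟩, he⟩
    · obtain ⟨t, υ, hr, ht, k', hk', hI'⟩ := hbody he
      have hf' : Frame (.loop e p) τ υ := ⟨hr.frame.var, hr.frame.arr⟩
      obtain ⟨u, ω, hr', hu, hQ⟩ := ih k' hk' υ hI' (hf.trans hf')
      refine ⟨_, ω, .loopStep hfit he hr hr', ?_, hQ⟩
      have : (k' + 1) * (T + e.cost + 1) ≤ k * (T + e.cost + 1) := Nat.mul_le_mul_right _ hk'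
      rw [Nat.add_mul] at this
      omega

end Tr

/-- `for x = 0, …, (value of variable L) - 1 do body`. -/
def forP (x L : ℕ) (body : Prog) : Prog :=
  .assign x 0 ;; .loop (.lt (.var x) (.var L)) (body ;; .assign x (.var x + 1))

/-- Each round pays 4 steps for the test and 4 for the increment besides the body; the initial
assignment and the last test account for the 6. -/
lemma Tr.forP {B T x L nn : ℕ} {body : Prog} {σ : Memory} (I : ℕ → Memory → Prop)
    (hL : (forP x L body).wVar L = false) (hx : body.wVar x = false) (hn : σ.var L = nn)
    (hB : nn + 1 < B) (h0 : I 0 (σ.setVar x 0))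
    (hstep : ∀ k τ, k < nn → Frame (OddCycleTransversal.forP x L body) σ τ → τ.var x = k → I k τ →
      Tr B body T τ fun υ => I (k + 1) (υ.setVar x (k + 1))) :
    Tr B (OddCycleTransversal.forP x L body) (nn * (T + 8) + 6) σ (I nn) := by
  have hxL : L ≠ x := by
    simp only [OddCycleTransversal.forP, Prog.wVar, Bool.or_eq_false_iff] at hL
    simpa using hL.1
  have h1 : Tr B (.assign x 0) 2 σ fun τ => τ = σ.setVar x 0 :=
    Tr.of_wp (p := .assign x 0) ⟨by simp; omega, rfl⟩
  refine h1.seq (T₂ := nn * (T + 4 + 3 + 1) + 3 + 1) (fun τ hτ hf => ?_) (by ring_nf; omega)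
  subst hτ
  set σ₀ := σ.setVar x 0
  have hw : (OddCycleTransversal.forP x L body).wVar x = true := by
    simp [OddCycleTransversal.forP, Prog.wVar]
  have hf0 : Frame (OddCycleTransversal.forP x L body) σ σ₀ := Frame.setVar _ _ _ hw
  have := Tr.loop (B := B) (p := body ;; .assign x (.var x + 1)) (σ := σ₀) (T := T + 4)
    (e := .lt (.var x) (.var L))
    (fun k τ => ∃ j, j + k = nn ∧ τ.var x = j ∧ I j τ) (k := nn)
    ⟨0, by simp, by simp [σ₀], h0⟩ ?_
  · refine this.conseq (by simp [Expr.lt, Expr.cost]) ?_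
    rintro τ ⟨⟨k, j, hj, hxj, hI⟩, he⟩ hf
    have hLv : τ.var L = nn := by
      rw [(hf.mono (by simp +contextual [OddCycleTransversal.forP, Prog.wVar]) (by
        simp +contextual [OddCycleTransversal.forP, Prog.wArr]) :
        Frame (OddCycleTransversal.forP x L body) σ₀ τ).var L hL, hf0.var L hL, hn]
    simp [hLv, hxj] at he
    have : j = nn := by omega
    exact this ▸ hI
  · rintro k τ ⟨j, hj, hxj, hI⟩ hf
    have hf' : Frame (OddCycleTransversal.forP x L body) σ τ :=
      hf0.trans (hf.mono (by simp +contextual [OddCycleTransversal.forP, Prog.wVar]) (by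
        simp +contextual [OddCycleTransversal.forP, Prog.wArr]))
    have hLv : τ.var L = nn := by rw [hf'.var L hL, hn]
    refine ⟨by simp [hLv, hxj, show 1 < B by omega]; omega, fun he => ?_⟩
    have hjn : j < nn := by simpa [hLv, hxj] using he
    refine (hstep j τ hjn hf' hxj hI).seq (T₂ := 4) (fun υ hυ hfυ => ?_)
    have hxυ : υ.var x = j := by rw [hfυ.var x hx, hxj]
    refine Tr.of_wp (p := .assign x (.var x + 1)) ?_
    simp only [Prog.wp]
    exact ⟨by simp [hxυ]; omega, k - 1, by omega, j + 1, by omega, by simp [hxυ], by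
      simpa [hxυ] using hυ⟩

end OddCycleTransversal

namespace OddCycleTransversal

/-! ### Breadth-first search

The digraph has the nodes `0, …, 4n - 1` and the arcs `0, …, H - 1`; arc `h` goes from `hs h` to
`hd h` and may be used when `en h ≠ 0`. -/

notation "vN" => (0 : ℕ)
notation "vM" => (1 : ℕ)
notation "vSeed" => (20 : ℕ)
notation "vHead" => (21 : ℕ)
notation "vTail" => (22 : ℕ)
notation "vPtr" => (23 : ℕ)
notation "vArc" => (24 : ℕ)
notation "vNode" => (25 : ℕ)
notation "aSrc" => (12 : ℕ)
notation "aDst" => (13 : ℕ)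
notation "aFst" => (14 : ℕ)
notation "aNxt" => (15 : ℕ)
notation "aEn" => (16 : ℕ)
notation "aVis" => (17 : ℕ)
notation "aPar" => (18 : ℕ)
notation "aQ" => (19 : ℕ)

/-- `p - 1` is the largest number `h < b` with `hs h = x`; `p = 0` if there is none. -/
structure IsPrev (hs : ℕ → ℕ) (x b p : ℕ) : Prop where
  le : p ≤ b
  src : p ≠ 0 → hs (p - 1) = x
  max : ∀ h, p ≤ h → h < b → hs h ≠ x

/-- `fst` and `nxt` are linked lists, by decreasing number, of the arcs that leave each node. -/
structure Links (X H : ℕ) (hs fst nxt : ℕ → ℕ) : Prop where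
  fst : ∀ x < X, IsPrev hs x H (fst x)
  nxt : ∀ h < H, IsPrev hs (hs h) h (nxt h)

/-- Visit the current arc. -/
def bfsArc : Prog :=
  .assign vArc (.var vPtr - 1) ;;
  .assign vPtr (.read aNxt (.var vArc)) ;;
  .assign vNode (.read aDst (.var vArc)) ;;
  .ite (.read aEn (.var vArc))
    (.ite (.read aVis (.var vNode)) .skip
      (.store aVis (.var vNode) 1 ;;
       .store aPar (.var vNode) (.var vArc + 1) ;;
       .store aQ (.var vTail) (.var vNode) ;;
       .assign vTail (.var vTail + 1)))
    .skip

/-- Take the next node from the queue. -/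
def bfsPop : Prog :=
  .assign vPtr (.read aFst (.read aQ (.var vHead))) ;;
  .assign vHead (.var vHead + 1)

/-- Start at the node `4 v + o` unless it or `4 v + o'` has been visited. -/
def bfsSeed (o o' : ℕ) : Prog :=
  .assign vNode (4 * .var vSeed + .const o) ;;
  .assign vSeed (.var vSeed + 1) ;;
  .ite (.read aVis (.var vNode) + .read aVis (4 * (.var vSeed - 1) + .const o'))
    .skip
    (.store aVis (.var vNode) 1 ;;
     .store aPar (.var vNode) 0 ;;
     .store aQ (.var vTail) (.var vNode) ;;
     .assign vTail (.var vTail + 1))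

/-- Breadth-first search from the seeds `4 v + o`, one after the other. -/
def bfs (o o' : ℕ) : Prog :=
  (.assign vSeed 0 ;; .assign vHead 0 ;; .assign vTail 0 ;; .assign vPtr 0) ;;
  .loop ((.var vN - .var vSeed) + (.var vTail - .var vHead) + .var vPtr)
    (.ite (.var vPtr) bfsArc
      (.ite (Expr.lt (.var vHead) (.var vTail)) bfsPop (bfsSeed o o')))

/-- The first `qt` cells of `q` list the visited nodes, each with the arc by which it was found. -/
structure BfsTree (n H o : ℕ) (hs hd en vis par q : ℕ → ℕ) (qt : ℕ) : Prop where
  lt : ∀ j < qt, q j < 4 * n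
  inj : ∀ i < qt, ∀ j < qt, q i = q j → i = j
  mem : ∀ x < 4 * n, vis x = 1 ↔ ∃ j < qt, q j = x
  le : ∀ x < 4 * n, vis x ≤ 1
  par : ∀ j < qt, (par (q j) = 0 ∧ ∃ v < n, q j = 4 * v + o) ∨
    ∃ h < H, par (q j) = h + 1 ∧ en h ≠ 0 ∧ hd h = q j ∧ ∃ i < j, hs h = q i

lemma BfsTree.card_le {n H o qt : ℕ} {hs hd en vis par q : ℕ → ℕ}
    (h : BfsTree n H o hs hd en vis par q qt) : qt ≤ 4 * n := by
  have := Finset.card_le_card_of_injOn (s := Finset.range qt) (t := Finset.range (4 * n)) q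
    (fun j hj => by simpa using h.lt j (by simpa using hj))
    (fun i hi j hj hij => h.inj i (by simpa using hi) j (by simpa using hj) hij)
  simpa using this

/-- A visited node can be added at the end of the queue. -/
lemma BfsTree.push {n H o qt : ℕ} {hs hd en vis par q : ℕ → ℕ}
    (h : BfsTree n H o hs hd en vis par q qt) {y k : ℕ} (hy : y < 4 * n) (hv : vis y = 0)
    (hk : (k = 0 ∧ ∃ v < n, y = 4 * v + o) ∨
      ∃ h < H, k = h + 1 ∧ en h ≠ 0 ∧ hd h = y ∧ ∃ i < qt, hs h = q i) :
    BfsTree n H o hs hd en (fun x => if x = y then 1 else vis x)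
      (fun x => if x = y then k else par x) (fun j => if j = qt then y else q j) (qt + 1) := by
  have hne : ∀ j < qt, q j ≠ y := fun j hj e => by
    have := (h.mem y hy).2 ⟨j, hj, e⟩
    omega
  constructor
  · intro j hj
    split_ifs with e
    · exact hy
    · exact h.lt j (by omega)
  · intro i hi j hj
    split_ifs with e₁ e₂ e₂
    · intro _; omega
    · intro e; exact absurd e.symm (hne j (by omega))
    · intro e; exact absurd e (hne i (by omega))
    · exact h.inj i (by omega) j (by omega)
  · intro x hx
    split_ifs with e
    · simp only [true_iff]
      exact ⟨qt, by omega, by simp [e]⟩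
    · rw [h.mem x hx]
      constructor
      · rintro ⟨j, hj, rfl⟩
        exact ⟨j, by omega, by simp [hj.ne]⟩
      · rintro ⟨j, hj, e'⟩
        have : j ≠ qt := by rintro rfl; simp at e'; exact e e'.symm
        exact ⟨j, by omega, by simpa [this] using e'⟩
  · intro x hx
    split_ifs
    · exact le_rfl
    · exact h.le x hx
  · intro j hj
    by_cases e : j = qt
    · subst e
      simp only [if_true]
      refine hk.imp id ?_
      rintro ⟨a, ha, h1, h2, h3, i, hi, h4⟩
      exact ⟨a, ha, h1, h2, h3, i, hi, by simp [hi.ne, h4]⟩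
    · have hj' : j < qt := by omega
      simp only [e, if_false, hne j hj']
      refine (h.par j hj').imp id ?_
      rintro ⟨a, ha, h1, h2, h3, i, hi, h4⟩
      exact ⟨a, ha, h1, h2, h3, i, hi, by simp [(hi.trans hj').ne, h4]⟩

/-- `J` is kept when a search proceeds: by an arc from a visited node, or by a new seed when no
arc leaves the set of visited nodes. -/
structure BfsStable (n H o o' : ℕ) (hs hd en : ℕ → ℕ) (J : (ℕ → ℕ) → Prop) : Prop where
  arc : ∀ vis, J vis → ∀ h < H, en h ≠ 0 → vis (hs h) = 1 → vis (hd h) = 0 →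
    J fun x => if x = hd h then 1 else vis x
  seed : ∀ vis, J vis → (∀ x < 4 * n, vis x ≤ 1) →
    (∀ h < H, en h ≠ 0 → vis (hs h) = 1 → vis (hd h) = 1) → ∀ v < n,
    vis (4 * v + o) = 0 → vis (4 * v + o') = 0 → J fun x => if x = 4 * v + o then 1 else vis x

/-- The arcs that the search has examined. -/
noncomputable def bfsSeen (H : ℕ) (hs q : ℕ → ℕ) (qh p : ℕ) : Finset ℕ :=
  open Classical in
  (Finset.range H).filter fun h => ∃ j < qh, hs h = q j ∧ (j + 1 < qh ∨ p ≤ h)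

structure BfsInv (n H o o' : ℕ) (hs hd en : ℕ → ℕ) (J : (ℕ → ℕ) → Prop) (τ : Memory) : Prop where
  tree : BfsTree n H o hs hd en (τ.arr aVis) (τ.arr aPar) (τ.arr aQ) (τ.var vTail)
  seed_le : τ.var vSeed ≤ n
  head_le : τ.var vHead ≤ τ.var vTail
  closed : ∀ h < H, en h ≠ 0 → ∀ j < τ.var vHead, hs h = τ.arr aQ j →
    (j + 1 < τ.var vHead ∨ τ.var vPtr ≤ h) → τ.arr aVis (hd h) = 1
  ptr_le : τ.var vPtr ≤ H
  ptr : τ.var vPtr ≠ 0 →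
    0 < τ.var vHead ∧ hs (τ.var vPtr - 1) = τ.arr aQ (τ.var vHead - 1)
  seeds : ∀ v < τ.var vSeed, τ.arr aVis (4 * v + o) = 1 ∨ τ.arr aVis (4 * v + o') = 1
  inv : J (τ.arr aVis)

/-- Every round of the loop consumes a seed, a queue position or an unexamined arc, so there are at
most `5 * n + H` rounds of constant cost. `J` is a property of the visited set that the caller wants
to carry through the search. -/
lemma Tr.bfs {B n H o o' : ℕ} {hs hd en fst nxt : ℕ → ℕ} {J : (ℕ → ℕ) → Prop} {σ : Memory}
    (hB : 16 * n + H + 16 < B) (ho : o < 4) (ho' : o' < 4)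
    (hJ : BfsStable n H o o' hs hd en J) (hlinks : Links (4 * n) H hs fst nxt)
    (hhs : ∀ h < H, hs h < 4 * n) (hhd : ∀ h < H, hd h < 4 * n) (hen : ∀ h < H, en h ≤ 1)
    (hn : σ.var vN = n) (hd' : σ.arr aDst = hd) (hf' : σ.arr aFst = fst)
    (hn' : σ.arr aNxt = nxt) (he' : σ.arr aEn = en) (hvis : ∀ x < 4 * n, σ.arr aVis x = 0)
    (hJ0 : J (σ.arr aVis)) :
    Tr B (bfs o o') (70 * (5 * n + H + 1)) σ fun τ =>
      BfsTree n H o hs hd en (τ.arr aVis) (τ.arr aPar) (τ.arr aQ) (τ.var vTail) ∧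
      (∀ h < H, en h ≠ 0 → τ.arr aVis (hs h) = 1 → τ.arr aVis (hd h) = 1) ∧
      (∀ v < n, τ.arr aVis (4 * v + o) = 1 ∨ τ.arr aVis (4 * v + o') = 1) ∧
      J (τ.arr aVis) := by
  have h1 : Tr B (.assign vSeed 0 ;; .assign vHead 0 ;; .assign vTail 0 ;; .assign vPtr 0) 8 σ
      fun τ => BfsInv n H o o' hs hd en J τ ∧ τ.var vHead = 0 ∧ τ.var vSeed = 0 := by
    refine Tr.of_wp ?_
    simp only [Prog.wp]
    refine ⟨by simp; omega, by simp; omega, by simp; omega, by simp; omega, ⟨⟨?_, ?_, ?_, ?_, ?_⟩,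
      ?_, ?_, ?_, ?_, ?_, ?_, ?_⟩, ?_⟩ <;> simp_all
  refine h1.seq (T₂ := (n + 4 * n + H) * (58 + 9 + 1) + 9 + 1) (fun τ₀ hτ₀ hf₀ => ?_) (by omega)
  obtain ⟨hI₀, hh₀, hs₀⟩ := hτ₀
  have hw : ∀ τ, Frame (.loop ((.var vN - .var vSeed) + (.var vTail - .var vHead) + .var vPtr)
    (.ite (.var vPtr) bfsArc
      (.ite (Expr.lt (.var vHead) (.var vTail)) bfsPop (bfsSeed o o')))) τ₀ τ →
      τ.var vN = n ∧ τ.arr aDst = hd ∧ τ.arr aFst = fst ∧ τ.arr aNxt = nxt ∧ τ.arr aEn = en := by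
    intro τ hf
    refine ⟨?_, ?_, ?_, ?_, ?_⟩
    · rw [hf.var _ rfl, hf₀.var _ rfl, hn]
    · rw [hf.arr _ rfl, hf₀.arr _ rfl, hd']
    · rw [hf.arr _ rfl, hf₀.arr _ rfl, hf']
    · rw [hf.arr _ rfl, hf₀.arr _ rfl, hn']
    · rw [hf.arr _ rfl, hf₀.arr _ rfl, he']
  -- The potential adds up the remaining seeds, the nodes still to be dequeued and the arcs not yet
  -- examined. An arc counts as examined if its source has been dequeued and either is not the
  -- current node or has a list pointer that has already passed the arc.
  refine (Tr.loop (T := 58) (fun k τ => BfsInv n H o o' hs hd en J τ ∧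
    k = (n - τ.var vSeed) + (4 * n - τ.var vHead) +
      (H - (bfsSeen H hs (τ.arr aQ) (τ.var vHead) (τ.var vPtr)).card)) (k := _)
      ⟨hI₀, rfl⟩ ?_).conseq ?_ ?_
  · rintro k τ ⟨hI, hk⟩ hf
    obtain ⟨en', ed', ef', enx', ee'⟩ := hw τ hf
    have hqt := hI.tree.card_le
    have hqh := hI.head_le
    have hsv := hI.seed_le
    have hpt := hI.ptr_le
    refine ⟨by simp [en']; omega, fun hne => ?_⟩
    have hsub : ∀ q' qh p, (bfsSeen H hs q' qh p).card ≤ H := fun q' qh p =>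
      (Finset.card_le_card (Finset.filter_subset _ _)).trans (Finset.card_range H).le
    refine (Tr.ite (T := 56) (by simp; omega) (fun hp => ?_) fun hp => ?_)
    · -- examine an arc
      simp only [Expr.eval_var] at hp
      obtain ⟨h0, hsrc⟩ := hI.ptr hp
      obtain ⟨a, ha⟩ : ∃ a, τ.var vPtr = a + 1 := ⟨τ.var vPtr - 1, by omega⟩
      have haH : a < H := by omega
      rw [ha, Nat.add_sub_cancel] at hsrc
      have hnx := hlinks.nxt a haH
      have hy := hhd a haH
      have hvy := hI.tree.le _ hy
      have hea := hen a haH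
      have hxv : τ.arr aVis (hs a) = 1 := by
        rw [hI.tree.mem _ (hhs a haH)]
        exact ⟨_, by omega, hsrc.symm⟩
      -- the examined arcs after this step
      have hseen : ∀ q' : ℕ → ℕ, (∀ j < τ.var vTail, q' j = τ.arr aQ j) →
          (bfsSeen H hs (τ.arr aQ) (τ.var vHead) (τ.var vPtr)).card <
            (bfsSeen H hs q' (τ.var vHead) (nxt a)).card := by
        -- `q'` is allowed to differ from the queue beyond its end, since the step may append a
        -- node.
        intro q' hq'
        refine Finset.card_lt_card ⟨fun h hh => ?_, fun hss => ?_⟩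
        · simp only [bfsSeen, Finset.mem_filter, Finset.mem_range] at hh ⊢
          obtain ⟨h1, j, hj, h2, h3⟩ := hh
          have := hnx.le
          exact ⟨h1, j, hj, by rw [h2, hq' j (by omega)], by omega⟩
        · have hin : a ∈ bfsSeen H hs q' (τ.var vHead) (nxt a) := by
            simp only [bfsSeen, Finset.mem_filter, Finset.mem_range]
            exact ⟨haH, τ.var vHead - 1, by omega, by rw [hsrc, hq' _ (by omega)], .inr hnx.le⟩
          have := hss hin
          simp only [bfsSeen, Finset.mem_filter, Finset.mem_range] at this
          obtain ⟨-, j, hj, h2, h3⟩ := this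
          have := hI.tree.inj j (by omega) (τ.var vHead - 1) (by omega) (h2.symm.trans hsrc)
          omega
      -- Advancing the list pointer from `a + 1` to `nxt a` makes `a` the only newly examined arc,
      -- because the linked list skips only arcs with other sources.
      have hcl : ∀ h < H, en h ≠ 0 → ∀ j < τ.var vHead, hs h = τ.arr aQ j →
          (j + 1 < τ.var vHead ∨ nxt a ≤ h) → τ.arr aVis (hd h) = 1 ∨ h = a := by
        intro h hh hen j hj hsj hor
        by_cases hc : j + 1 < τ.var vHead ∨ τ.var vPtr ≤ h
        · exact .inl (hI.closed h hh hen j hj hsj hc)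
        · right
          by_contra hne
          refine hnx.max h (by omega) (by omega) ?_
          have : j = τ.var vHead - 1 := by omega
          rw [hsj, this, hsrc]
      have hptr : nxt a ≠ 0 → hs (nxt a - 1) = τ.arr aQ (τ.var vHead - 1) := fun h => by
        rw [hnx.src h, hsrc]
      have hnl := hnx.le
      have hqlast : τ.var vHead - 1 ≠ τ.var vTail := by omega
      refine (Tr.of_wp (p := bfsArc) ?_).conseq (by decide) (fun _ h _ => h)
      have hno : en a = 0 ∨ τ.arr aVis (hd a) ≠ 0 →
          n - τ.var vSeed + (4 * n - τ.var vHead) +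
            (H - (bfsSeen H hs (τ.arr aQ) (τ.var vHead) (nxt a)).card) < k ∧
          BfsInv n H o o' hs hd en J
            (((τ.setVar vArc a).setVar vPtr (nxt a)).setVar vNode (hd a)) := by
        intro hno
        have hva : en a ≠ 0 → τ.arr aVis (hd a) = 1 := fun h => by omega
        refine ⟨?_, ⟨?_, ?_, ?_, ?_, ?_, ?_, ?_, ?_⟩⟩
        · have := hseen _ (fun j _ => rfl)
          have h3 := hsub (τ.arr aQ) (τ.var vHead) (nxt a)
          omega
        · simpa using hI.tree
        · simpa using hsv
        · simp; omega
        · simp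
          intro h hh hen j hj hsj hor
          rcases hcl h hh hen j hj hsj hor with h | rfl
          · exact h
          · exact hva hen
        · simp; omega
        · simp
          exact fun h => ⟨h0, hptr h⟩
        · simpa using hI.seeds
        · simpa using hI.inv
      simp only [bfsArc, Prog.wp]
      simp [ha, enx', ed', ee']
      refine ⟨by omega, by omega, by omega, by omega, ?_, fun h => hno (.inl h)⟩
      intro he0
      refine ⟨by omega, fun h => hno (.inr h), ?_⟩
      · intro hy0
        refine ⟨by omega, by omega, by omega, by omega, ?_, ⟨?_, ?_, ?_, ?_, ?_, ?_, ?_, ?_⟩⟩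
        · have := hseen (fun j => if j = τ.var vTail then hd a else τ.arr aQ j)
            (fun j hj => by simp [hj.ne])
          have h3 := hsub (fun j => if j = τ.var vTail then hd a else τ.arr aQ j) (τ.var vHead)
            (nxt a)
          simp
          omega
        · simp
          exact hI.tree.push hy hy0 (.inr ⟨a, haH, rfl, he0, rfl, τ.var vHead - 1, by omega, hsrc⟩)
        · simpa using hsv
        · simp; omega
        · simp
          intro h hh hen j hj hsj hor
          have hjt : j ≠ τ.var vTail := by omega
          simp only [hjt, if_false] at hsj
          rcases hcl h hh hen j hj hsj hor with h | rfl
          · simp [h]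
          · simp
        · simp; omega
        · simp
          exact fun h => ⟨h0, by simp [hqlast, hptr h]⟩
        · simp
          intro v hv
          rcases hI.seeds v hv with h | h <;> simp [h]
        · simpa using hJ.arc _ hI.inv a haH he0 hxv hy0
    · simp only [Expr.eval_var] at hp
      have hfit : (Expr.lt (.var vHead) (.var vTail)).Fits B B τ := by
        simp [show 1 < B by omega]
        omega
      refine (Tr.ite (T := 52) hfit (fun hlt => ?_) fun hlt => ?_)
      · -- take the next node
        have hlt' : τ.var vHead < τ.var vTail := by
          by_contra h
          simp [h] at hlt
        have hx := hI.tree.lt _ hlt'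
        have hfx := hlinks.fst _ hx
        have hfl := hfx.le
        refine (Tr.of_wp (p := bfsPop) ?_).conseq (by decide) (fun _ h _ => h)
        simp only [bfsPop, Prog.wp]
        simp [ef']
        refine ⟨by omega, by omega, ?_, ⟨?_, ?_, ?_, ?_, ?_, ?_, ?_, ?_⟩⟩
        · have h4 : bfsSeen H hs (τ.arr aQ) (τ.var vHead) (τ.var vPtr) ⊆
              bfsSeen H hs (τ.arr aQ) (τ.var vHead + 1) (fst (τ.arr aQ (τ.var vHead))) := by
            intro h hh
            simp only [bfsSeen, Finset.mem_filter, Finset.mem_range] at hh ⊢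
            obtain ⟨h1, j, hj, h2, h3⟩ := hh
            exact ⟨h1, j, by omega, h2, .inl (by omega)⟩
          have h5 := Finset.card_le_card h4
          simp
          omega
        · simpa using hI.tree
        · simpa using hsv
        · simp; omega
        · simp
          intro h hh hen j hj hsj hor
          by_cases hjh : j < τ.var vHead
          · exact hI.closed h hh hen j hjh hsj (by omega)
          · have : j = τ.var vHead := by omega
            subst this
            -- The list of the new node starts at its last arc, so no arc that leaves it has been
            -- passed.
            exact absurd hsj (hfx.max h (by omega) hh)
        · simp; omega
        · simp
          exact hfx.src
        · simpa using hI.seeds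
        · simpa using hI.inv
      · -- a new seed
        have hlt' : τ.var vHead = τ.var vTail := by
          have : τ.var vTail ≤ τ.var vHead := by simpa using hlt
          omega
        have hsv' : τ.var vSeed < n := by
          by_contra hc
          apply hne
          simp [en', hp, hlt']
          omega
        -- The queue is empty and no arc is pending, so the visited set is closed under enabled
        -- arcs: the situation in which `BfsStable.seed` applies.
        have hclosed : ∀ h < H, en h ≠ 0 → τ.arr aVis (hs h) = 1 → τ.arr aVis (hd h) = 1 := by
          intro h hh hen hv
          obtain ⟨j, hj, hq⟩ := (hI.tree.mem _ (hhs h hh)).1 hv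
          exact hI.closed h hh hen j (by omega) hq.symm (by omega)
        have hva := hI.tree.le (4 * τ.var vSeed + o) (by omega)
        have hvb := hI.tree.le (4 * τ.var vSeed + o') (by omega)
        have hseenq : ∀ q' : ℕ → ℕ, (∀ j < τ.var vTail, q' j = τ.arr aQ j) →
            bfsSeen H hs q' (τ.var vHead) (τ.var vPtr) =
              bfsSeen H hs (τ.arr aQ) (τ.var vHead) (τ.var vPtr) := by
          intro q' hq'
          refine Finset.filter_congr fun h _ => ?_
          constructor <;> rintro ⟨j, hj, h1, h2⟩ <;> refine ⟨j, hj, ?_, h2⟩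
          · rw [h1, hq' j (by omega)]
          · rw [h1, hq' j (by omega)]
        refine (Tr.of_wp (p := bfsSeed o o') ?_).conseq (show _ ≤ 52 from of_decide_eq_true rfl) (fun _ h _ => h)
        have hno : (τ.arr aVis (4 * τ.var vSeed + o) = 0 →
              τ.arr aVis (4 * τ.var vSeed + o') ≠ 0) →
            n - (τ.var vSeed + 1) + (4 * n - τ.var vHead) +
              (H - (bfsSeen H hs (τ.arr aQ) (τ.var vHead) (τ.var vPtr)).card) < k ∧
            BfsInv n H o o' hs hd en J ((τ.setVar vNode (4 * τ.var vSeed + o)).setVar vSeed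
              (τ.var vSeed + 1)) := by
          intro hno
          refine ⟨?_, ⟨?_, ?_, ?_, ?_, ?_, ?_, ?_, ?_⟩⟩
          · omega
          · simpa using hI.tree
          · simp; omega
          · simp; omega
          · simpa using hI.closed
          · simp; omega
          · simpa using hI.ptr
          · simp
            intro v hv
            by_cases hc : v < τ.var vSeed
            · exact hI.seeds v hc
            · have : v = τ.var vSeed := by omega
              subst this
              by_cases h0 : τ.arr aVis (4 * τ.var vSeed + o) = 0
              · have := hno h0
                omega
              · omega
          · simpa using hI.inv
        simp only [bfsSeed, Prog.wp]
        simp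
        refine ⟨by omega, by omega, by omega, hno, ?_⟩
        · intro ha0 hb0
          refine ⟨by omega, by omega, by omega, by omega, ?_, ⟨?_, ?_, ?_, ?_, ?_, ?_, ?_, ?_⟩⟩
          · rw [hseenq _ (fun j hj => by simp [hj.ne])]
            omega
          · simp
            exact hI.tree.push (by omega) ha0 (.inl ⟨rfl, _, hsv', rfl⟩)
          · simp; omega
          · simp; omega
          · simp
            intro h hh hen j hj hsj hor
            have hjt : j ≠ τ.var vTail := by omega
            simp only [hjt, if_false] at hsj
            have := hI.closed h hh hen j hj hsj (by omega)
            simp [this]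
          · simp; omega
          · simp
            exact fun h => absurd hp h
          · simp
            intro v hv
            by_cases hc : v < τ.var vSeed
            · rcases hI.seeds v hc with h | h <;> simp [h]
            · have : v = τ.var vSeed := by omega
              simp [this]
          · simpa using hJ.seed _ hI.inv hI.tree.le hclosed _ hsv' ha0 hb0
  · simp only [hs₀, hh₀, Nat.sub_zero, Expr.cost]
    have : (n + 4 * n + (H - (bfsSeen H hs (τ₀.arr aQ) 0 (τ₀.var vPtr)).card)) ≤ n + 4 * n + H := by
      omega
    refine Nat.succ_le_succ (Nat.add_le_add (Nat.mul_le_mul this ?_) ?_) <;> decide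
  · rintro τ ⟨⟨k, hI, -⟩, he⟩ hf
    obtain ⟨en', -⟩ := hw τ hf
    have h1 := hI.head_le
    have h2 := hI.seed_le
    simp [en'] at he
    refine ⟨hI.tree, ?_, fun v hv => hI.seeds v (by omega), hI.inv⟩
    intro h hh hen hv
    obtain ⟨j, hj, hq⟩ := (hI.tree.mem _ (hhs h hh)).1 hv
    exact hI.closed h hh hen j (by omega) hq.symm (by omega)

end OddCycleTransversal

namespace OddCycleTransversal

open Finset

/-! ### The instance on the vertices -/

/-- A graph with vertices `0, …, n - 1` and edges `0, …, m - 1`, each vertex `v` at a depth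
`dep v ≤ D`. Edge `i` joins `up i` to `lo i`, the former being no deeper. The cell `i * n + v` of
`ancA` holds the ancestor of `v` at depth `i ≤ dep v`; at depth `dep v` it is a representative of
the bag of `v`. The vertices of internal nodes have `rl v = dep v + 1`, the others
`rl v = dep v`. -/
structure Inst where
  n : ℕ
  m : ℕ
  D : ℕ
  up : ℕ → ℕ
  lo : ℕ → ℕ
  dep : ℕ → ℕ
  rl : ℕ → ℕ
  ancA : ℕ → ℕ

namespace Inst

variable (I : Inst)

def anc (v i : ℕ) : ℕ := I.ancA (i * I.n + v)

def rep (v : ℕ) : ℕ := I.anc v (I.dep v)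

/-- The ends of edge `i` lie in the same bag. -/
def Same (i : ℕ) : Prop := I.dep (I.up i) = I.dep (I.lo i)

instance (i : ℕ) : Decidable (I.Same i) := inferInstanceAs (Decidable (_ = _))

structure Valid : Prop where
  up_lt : ∀ i < I.m, I.up i < I.n
  lo_lt : ∀ i < I.m, I.lo i < I.n
  ne : ∀ i < I.m, I.up i ≠ I.lo i
  dep_le : ∀ i < I.m, I.dep (I.up i) ≤ I.dep (I.lo i)
  rl_le : ∀ v < I.n, I.rl v ≤ I.D
  rl_or : ∀ v < I.n, I.rl v = I.dep v ∨ I.rl v = I.dep v + 1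
  anc_lt : ∀ v < I.n, ∀ i ≤ I.dep v, I.anc v i < I.n
  dep_anc : ∀ v < I.n, ∀ i ≤ I.dep v, I.dep (I.anc v i) = i
  anc_anc : ∀ v < I.n, ∀ i ≤ I.dep v, ∀ j ≤ i, I.anc (I.anc v i) j = I.anc v j
  rep_self : ∀ v < I.n, I.rl v = I.dep v + 1 → I.rep v = v
  rl_anc : ∀ v < I.n, ∀ i < I.dep v, I.rl (I.anc v i) = i + 1
  rl_rep : ∀ v < I.n, I.rl (I.rep v) = I.rl v
  edge : ∀ i < I.m, I.anc (I.lo i) (I.dep (I.up i)) = I.rep (I.up i)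
  bip : ∃ c : ℕ → ℕ, ∀ i < I.m, I.Same i → (c (I.up i) = 0 ↔ c (I.lo i) ≠ 0)

variable {I}

/-- An edge between different bags has a vertex below its upper end, which is therefore internal. So
every constraint from above comes from a vertex with a state of its own. -/
lemma Valid.rl_up (h : I.Valid) {i : ℕ} (hi : i < I.m) (hs : ¬ I.Same i) :
    I.rl (I.up i) = I.dep (I.up i) + 1 := by
  have h1 := h.dep_le i hi
  rw [← h.rl_rep _ (h.up_lt i hi), ← h.edge i hi]
  exact h.rl_anc _ (h.lo_lt i hi) _ (lt_of_le_of_ne h1 hs)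

lemma Valid.anc_up (h : I.Valid) {i : ℕ} (hi : i < I.m) (hs : ¬ I.Same i) :
    I.anc (I.lo i) (I.dep (I.up i)) = I.up i := by
  rw [h.edge i hi, h.rep_self _ (h.up_lt i hi) (h.rl_up hi hs)]

lemma Valid.rep_same (h : I.Valid) {i : ℕ} (hi : i < I.m) (hs : I.Same i) :
    I.rep (I.up i) = I.rep (I.lo i) := by
  rw [← h.edge i hi, hs]; rfl

/-- The bag of an internal vertex is a single vertex, so an edge inside a bag lies in a leaf bag. -/
lemma Valid.rl_same (h : I.Valid) {i : ℕ} (hi : i < I.m) (hs : I.Same i) :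
    I.rl (I.up i) = I.dep (I.up i) ∧ I.rl (I.lo i) = I.dep (I.up i) := by
  have hu := h.up_lt i hi
  have hl := h.lo_lt i hi
  have e : I.rl (I.up i) = I.rl (I.lo i) := by
    rw [← h.rl_rep _ hu, h.rep_same hi hs, h.rl_rep _ hl]
  have hs' : I.dep (I.up i) = I.dep (I.lo i) := hs
  rcases h.rl_or _ hu with h1 | h1
  · exact ⟨h1, by omega⟩
  · refine absurd ?_ (h.ne i hi)
    rw [← h.rep_self _ hu h1, h.rep_same hi hs, h.rep_self _ hl (by omega)]

lemma Valid.rep_lt (h : I.Valid) {v : ℕ} (hv : v < I.n) : I.rep v < I.n := h.anc_lt v hv _ le_rfl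

lemma Valid.dep_rep (h : I.Valid) {v : ℕ} (hv : v < I.n) : I.dep (I.rep v) = I.dep v :=
  h.dep_anc v hv _ le_rfl

/-! ### The flow network

Node `4 v` is the entry and `4 v + 1` the exit of vertex `v`; `4 r + 2` is the source and `4 r + 3`
the sink for the bag with representative `r`. Half arc `2 a` is arc `a`, half arc `2 a + 1` its
reverse. -/

variable (I)

/-- The number of arcs. -/
def arcs : ℕ := 2 * I.m + I.n

def tl (a : ℕ) : ℕ :=
  if a < 2 * I.m then
    if a % 2 = 0 then
      if I.Same (a / 2) then 4 * I.up (a / 2) + 1 else 4 * I.rep (I.lo (a / 2)) + 2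
    else 4 * I.lo (a / 2) + 1
  else 4 * (a - 2 * I.m)

def hd (a : ℕ) : ℕ :=
  if a < 2 * I.m then
    if a % 2 = 0 then 4 * I.lo (a / 2)
    else if I.Same (a / 2) then 4 * I.up (a / 2) else 4 * I.rep (I.lo (a / 2)) + 3
  else 4 * (a - 2 * I.m) + 1

/-- The vertex that is deleted when arc `a` is cut. -/
def own (a : ℕ) : ℕ :=
  if a < 2 * I.m then
    if a % 2 = 0 then I.lo (a / 2)
    else if I.Same (a / 2) then I.up (a / 2) else I.lo (a / 2)
  else a - 2 * I.m

/-- The bag of a node of the network. -/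
def cmp (x : ℕ) : ℕ := if x % 4 < 2 then I.rep (x / 4) else x / 4

/-- The arcs that are present when the internal vertices have the states `st` and `side` is a proper
2-colouring of the bags. -/
def act (st side : ℕ → ℕ) (a : ℕ) : ℕ :=
  if a < 2 * I.m then
    if I.Same (a / 2) then 1
    -- For a neighbour of state 1 or 2, the sum 2 says that `side + 1` is the only colour left, so
    -- the lower end is tied to the source. In the next line the neighbour itself has colour `side +
    -- 1`, and the lower end is tied to the sink. A deleted neighbour satisfies neither condition.
    else if a % 2 = 0 then if st (I.up (a / 2)) + side (I.lo (a / 2)) = 2 then 1 else 0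
    else if st (I.up (a / 2)) = side (I.lo (a / 2)) + 1 then 1 else 0
  else 1

lemma odd_div (i : ℕ) : (2 * i + 1) / 2 = i := by omega

lemma cmp_in (v : ℕ) : I.cmp (4 * v) = I.rep v := by
  simp [cmp]

lemma cmp_out (v : ℕ) : I.cmp (4 * v + 1) = I.rep v := by
  simp [cmp, show (4 * v + 1) % 4 = 1 by omega, show (4 * v + 1) / 4 = v by omega]

lemma cmp_src (v : ℕ) : I.cmp (4 * v + 2) = v := by
  simp [cmp, show (4 * v + 2) % 4 = 2 by omega, show (4 * v + 2) / 4 = v by omega]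

lemma cmp_snk (v : ℕ) : I.cmp (4 * v + 3) = v := by
  simp [cmp, show (4 * v + 3) % 4 = 3 by omega, show (4 * v + 3) / 4 = v by omega]

variable {I}

lemma arc_cases {P : ℕ → Prop} (h0 : ∀ i < I.m, P (2 * i)) (h1 : ∀ i < I.m, P (2 * i + 1))
    (h2 : ∀ v < I.n, P (2 * I.m + v)) {a : ℕ} (ha : a < I.arcs) : P a := by
  unfold arcs at ha
  by_cases h : a < 2 * I.m
  · rcases Nat.even_or_odd' a with ⟨i, rfl | rfl⟩
    · exact h0 i (by omega)
    · exact h1 i (by omega)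
  · obtain ⟨v, rfl⟩ := Nat.exists_eq_add_of_le (not_lt.1 h)
    exact h2 v (by omega)

section arcs

variable {i v : ℕ} (st side : ℕ → ℕ)

lemma tl_even (hi : i < I.m) :
    I.tl (2 * i) = if I.Same i then 4 * I.up i + 1 else 4 * I.rep (I.lo i) + 2 := by
  simp [tl, hi]

lemma tl_odd (hi : i < I.m) : I.tl (2 * i + 1) = 4 * I.lo i + 1 := by
  simp [tl, odd_div, show 2 * i + 1 < 2 * I.m by omega, show (2 * i + 1) % 2 = 1 by omega]

lemma tl_vertex : I.tl (2 * I.m + v) = 4 * v := by simp [tl]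

lemma hd_even (hi : i < I.m) : I.hd (2 * i) = 4 * I.lo i := by
  simp [hd, hi]

lemma hd_odd (hi : i < I.m) :
    I.hd (2 * i + 1) = if I.Same i then 4 * I.up i else 4 * I.rep (I.lo i) + 3 := by
  simp [hd, odd_div, show 2 * i + 1 < 2 * I.m by omega, show (2 * i + 1) % 2 = 1 by omega]

lemma hd_vertex : I.hd (2 * I.m + v) = 4 * v + 1 := by simp [hd]

lemma own_even (hi : i < I.m) : I.own (2 * i) = I.lo i := by
  simp [own, hi]

lemma own_odd (hi : i < I.m) :
    I.own (2 * i + 1) = if I.Same i then I.up i else I.lo i := by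
  simp [own, odd_div, show 2 * i + 1 < 2 * I.m by omega, show (2 * i + 1) % 2 = 1 by omega]

lemma own_vertex : I.own (2 * I.m + v) = v := by simp [own]

lemma act_even (hi : i < I.m) : I.act st side (2 * i) =
    if I.Same i then 1 else if st (I.up i) + side (I.lo i) = 2 then 1 else 0 := by
  simp [act, hi]

lemma act_odd (hi : i < I.m) : I.act st side (2 * i + 1) =
    if I.Same i then 1 else if st (I.up i) = side (I.lo i) + 1 then 1 else 0 := by
  simp [act, odd_div, show 2 * i + 1 < 2 * I.m by omega, show (2 * i + 1) % 2 = 1 by omega]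

lemma act_vertex : I.act st side (2 * I.m + v) = 1 := by simp [act]

lemma act_le (a : ℕ) : I.act st side a ≤ 1 := by
  unfold act
  split_ifs <;> omega

end arcs

lemma Valid.tl_lt (h : I.Valid) {a : ℕ} (ha : a < I.arcs) : I.tl a < 4 * I.n := by
  refine arc_cases (P := fun a => I.tl a < 4 * I.n) (fun i hi => ?_) (fun i hi => ?_)
    (fun v hv => ?_) ha
  · have := h.up_lt i hi
    have := h.rep_lt (h.lo_lt i hi)
    rw [tl_even hi]
    split_ifs <;> omega
  · have := h.lo_lt i hi
    rw [tl_odd hi]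
    omega
  · rw [tl_vertex]
    omega

lemma Valid.hd_lt (h : I.Valid) {a : ℕ} (ha : a < I.arcs) : I.hd a < 4 * I.n := by
  refine arc_cases (P := fun a => I.hd a < 4 * I.n) (fun i hi => ?_) (fun i hi => ?_)
    (fun v hv => ?_) ha
  · have := h.lo_lt i hi
    rw [hd_even hi]
    omega
  · have := h.up_lt i hi
    have := h.rep_lt (h.lo_lt i hi)
    rw [hd_odd hi]
    split_ifs <;> omega
  · rw [hd_vertex]
    omega

lemma Valid.own_lt (h : I.Valid) {a : ℕ} (ha : a < I.arcs) : I.own a < I.n := by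
  refine arc_cases (P := fun a => I.own a < I.n) (fun i hi => ?_) (fun i hi => ?_)
    (fun v hv => ?_) ha
  · rw [own_even hi]
    exact h.lo_lt i hi
  · have := h.up_lt i hi
    have := h.lo_lt i hi
    rw [own_odd hi]
    split_ifs <;> omega
  · rwa [own_vertex]

/-- No arc joins two bags, which is why one search and one array of bits serve all bags at once. -/
lemma Valid.cmp_eq (h : I.Valid) {a : ℕ} (ha : a < I.arcs) : I.cmp (I.tl a) = I.cmp (I.hd a) := by
  refine arc_cases (P := fun a => I.cmp (I.tl a) = I.cmp (I.hd a)) (fun i hi => ?_)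
    (fun i hi => ?_) (fun v hv => ?_) ha
  · rw [tl_even hi, hd_even hi, cmp_in]
    split_ifs with hs
    · rw [cmp_out, h.rep_same hi hs]
    · rw [cmp_src]
  · rw [tl_odd hi, hd_odd hi, cmp_out]
    split_ifs with hs
    · rw [cmp_in, h.rep_same hi hs]
    · rw [cmp_snk]
  · rw [tl_vertex, hd_vertex, cmp_in, cmp_out]

lemma Valid.cmp_lt (h : I.Valid) {x : ℕ} (hx : x < 4 * I.n) : I.cmp x < I.n := by
  unfold cmp
  split_ifs
  · exact h.rep_lt (by omega)
  · omega

lemma Valid.own_cmp (h : I.Valid) {a : ℕ} (ha : a < I.arcs) : I.rep (I.own a) = I.cmp (I.tl a) := by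
  refine arc_cases (P := fun a => I.rep (I.own a) = I.cmp (I.tl a)) (fun i hi => ?_)
    (fun i hi => ?_) (fun v hv => ?_) ha
  · rw [h.cmp_eq (by unfold arcs; omega), own_even hi, hd_even hi, cmp_in]
  · rw [own_odd hi, tl_odd hi, cmp_out]
    split_ifs with hs
    · rw [h.rep_same hi hs]
    · rfl
  · rw [own_vertex, tl_vertex, cmp_in]

/-! ### Flows and cuts -/

variable (I)

/-- `en` orients the arcs that are present: the reversed ones carry a flow. -/
def Bits (st side en : ℕ → ℕ) : Prop := ∀ a < I.arcs, en (2 * a) + en (2 * a + 1) = I.act st side a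

/-- The net flow out of a set of nodes, in terms of arbitrary weights `w`. -/
def net (en : ℕ → ℕ) (w : ℕ → ℤ) : ℤ :=
  ∑ a ∈ range I.arcs, (en (2 * a + 1) : ℤ) * (w (I.tl a) - w (I.hd a))

/-- The reversed arcs form a flow of value `k r` from the source to the sink of each bag `r`. -/
def Flow (en k : ℕ → ℕ) : Prop :=
  ∀ w : ℕ → ℤ, I.net en w = ∑ r ∈ range I.n, (k r : ℤ) * (w (4 * r + 2) - w (4 * r + 3))

/-- No half arc in use leaves the set of visited nodes. -/
def Closed (en vis : ℕ → ℕ) : Prop := ∀ a < I.arcs,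
  (en (2 * a) ≠ 0 → vis (I.tl a) = 1 → vis (I.hd a) = 1) ∧
  (en (2 * a + 1) ≠ 0 → vis (I.hd a) = 1 → vis (I.tl a) = 1)

variable {I} {st side en k vis : ℕ → ℕ}

/-- Weights supported on the component of one bag isolate its flow value. -/
lemma Flow.value (hf : I.Flow en k) {r : ℕ} (hr : r < I.n) {w : ℕ → ℤ}
    (hw : ∀ x, I.cmp x ≠ r → w x = 0) :
    I.net en w = (k r : ℤ) * (w (4 * r + 2) - w (4 * r + 3)) := by
  rw [hf w]
  refine sum_eq_single_of_mem r (mem_range.2 hr) fun r' _ hne => ?_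
  rw [hw, hw]
  · simp
  · rwa [cmp_snk]
  · rwa [cmp_src]

/-- A cut bounds the flow. -/
lemma Flow.le_card (hb : I.Bits st side en) (hf : I.Flow en k) {r : ℕ} (hr : r < I.n)
    {w : ℕ → ℤ} (hw : ∀ x, I.cmp x ≠ r → w x = 0) (h1 : w (4 * r + 2) = 1)
    (h0 : w (4 * r + 3) = 0) (S : Finset ℕ) (hS : S ⊆ range I.arcs)
    (ha : ∀ a < I.arcs, I.act st side a = 1 →
      w (I.tl a) - w (I.hd a) ≤ if a ∈ S then 1 else 0) :
    k r ≤ S.card := by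
  have hv := hf.value hr hw
  rw [h1, h0] at hv
  have : I.net en w ≤ ∑ a ∈ range I.arcs, if a ∈ S then (1 : ℤ) else 0 := by
    refine sum_le_sum fun a ha' => ?_
    have haM := mem_range.1 ha'
    have hbit := hb a haM
    have hle := act_le (I := I) st side a
    -- An arc without flow contributes nothing and the right-hand side is nonnegative; an arc with
    -- flow is present, and its contribution is bounded by `ha`.
    rcases Nat.eq_zero_or_pos (en (2 * a + 1)) with h | h
    · rw [h]
      split_ifs <;> simp
    · have h1 : en (2 * a + 1) = 1 := by omega
      rw [h1]
      simpa using ha a haM (by omega)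
  rw [sum_ite_mem, inter_eq_right.2 hS] at this
  simp at this
  omega

/-- The arcs that lead out of the set of visited nodes within bag `r`. -/
def cut (I : Inst) (st side vis : ℕ → ℕ) (r : ℕ) : Finset ℕ :=
  (range I.arcs).filter fun a => I.cmp (I.tl a) = r ∧ I.act st side a = 1 ∧
    vis (I.tl a) = 1 ∧ vis (I.hd a) ≠ 1

/-- In a closed set of visited nodes, a present arc that leads out must carry flow, as its forward
half would otherwise extend the search. An arc that leads in carries none, as its reverse half
would. Testing the flow with the indicator of the visited nodes of the bag therefore counts the cut.
-/
lemma Flow.card_cut_le (hI : I.Valid) (hb : I.Bits st side en) (hf : I.Flow en k) {r : ℕ}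
    (hr : r < I.n) (hc : I.Closed en vis) (h1 : vis (4 * r + 2) = 1) (h0 : vis (4 * r + 3) ≠ 1) :
    (I.cut st side vis r).card ≤ k r := by
  set w : ℕ → ℤ := fun x => if I.cmp x = r ∧ vis x = 1 then 1 else 0 with hw
  have hv := hf.value hr (w := w) (fun x hx => by simp [hw, hx])
  have e1 : w (4 * r + 2) = 1 := by simp [hw, cmp_src, h1]
  have e0 : w (4 * r + 3) = 0 := by simp [hw, h0]
  rw [e1, e0] at hv
  have : ∑ a ∈ range I.arcs, (if a ∈ I.cut st side vis r then (1 : ℤ) else 0) ≤ I.net en w := by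
    refine sum_le_sum fun a ha' => ?_
    have haM := mem_range.1 ha'
    have hbit := hb a haM
    have hcl := hc a haM
    have hcmp := hI.cmp_eq haM
    have hle := act_le (I := I) st side a
    simp only [cut, mem_filter, mem_range, haM, true_and, hw, ← hcmp]
    by_cases hr' : I.cmp (I.tl a) = r
    · by_cases ht : vis (I.tl a) = 1 <;> by_cases hh : vis (I.hd a) = 1
      · simp [ht, hh]
      · by_cases ha1 : I.act st side a = 1
        · have h3 : en (2 * a) = 0 := by
            by_contra hne
            exact hh (hcl.1 hne ht)
          have : en (2 * a + 1) = 1 := by omega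
          simp [this, ha1, hr', ht, hh]
        · simp [hr', ht, hh, ha1]
      · have : en (2 * a + 1) = 0 := by
          by_contra hne
          exact ht (hcl.2 hne hh)
        simp [this, ht]
      · simp [ht, hh]
    · simp [hr']
  rw [sum_ite_mem, inter_eq_right.2 (show I.cut st side vis r ⊆ _ from filter_subset _ _)] at this
  simp at this
  omega

/-! ### From flows to partial colourings

A colouring gives each vertex a colour `1` or `2`, or `0` when the vertex is deleted. -/

/-- Two adjacent vertices of the colours `x` and `y` are not in conflict. -/
def Okc (x y : ℕ) : Prop := x = 0 ∨ x ≠ y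

lemma Okc.symm {x y : ℕ} (h : Okc x y) : Okc y x := by
  unfold Okc at *
  omega

variable (I)

/-- The colouring `σ` of bag `r` extends the states `st` of the vertices above it. -/
structure Feas (st : ℕ → ℕ) (r : ℕ) (σ : ℕ → ℕ) : Prop where
  le : ∀ v < I.n, σ v ≤ 2
  same : ∀ i < I.m, I.rep (I.lo i) = r → I.Same i → Okc (σ (I.up i)) (σ (I.lo i))
  above : ∀ i < I.m, I.rep (I.lo i) = r → ¬ I.Same i → Okc (st (I.up i)) (σ (I.lo i))

/-- The number of vertices that `σ` deletes from bag `r`. -/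
def dels (r : ℕ) (σ : ℕ → ℕ) : ℕ := ((range I.n).filter fun v => I.rep v = r ∧ σ v = 0).card

/-- `side` is a proper 2-colouring of the bags. -/
structure Sides (side : ℕ → ℕ) : Prop where
  le : ∀ v < I.n, side v ≤ 1
  ne : ∀ i < I.m, I.Same i → side (I.up i) ≠ side (I.lo i)

variable {I}

/-- A feasible colouring defines a cut crossed only by the arcs from entry to exit of its deleted
vertices. Edges inside the bag cannot cross it because their surviving ends agree or disagree with
`side` together, and the arcs at the source and the sink are respected by feasibility. -/
lemma Flow.le_dels (hI : I.Valid) (hs : I.Sides side) (hb : I.Bits st side en) (hf : I.Flow en k)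
    {r : ℕ} (hr : r < I.n) {σ : ℕ → ℕ} (hσ : I.Feas st r σ) : k r ≤ I.dels r σ := by
  -- the cut: entries of deleted vertices, and the vertices whose colour is `side + 1`
  set w : ℕ → ℤ := fun x =>
    if x = 4 * r + 2 ∨ I.rep (x / 4) = r ∧ (x % 4 = 0 ∧ (σ (x / 4) = 0 ∨ σ (x / 4) = side (x / 4) + 1) ∨
      x % 4 = 1 ∧ σ (x / 4) = side (x / 4) + 1) then 1 else 0 with hw
  have win : ∀ v, w (4 * v) = if I.rep v = r ∧ (σ v = 0 ∨ σ v = side v + 1) then 1 else 0 := by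
    intro v
    simp [hw, show ¬ 4 * v = 4 * r + 2 by omega]
  have wout : ∀ v, w (4 * v + 1) = if I.rep v = r ∧ σ v = side v + 1 then 1 else 0 := by
    intro v
    simp [hw, show ¬ 4 * v = 4 * r + 1 by omega, show (4 * v + 1) / 4 = v by omega,
      show (4 * v + 1) % 4 = 1 by omega]
  have wsrc : ∀ v, w (4 * v + 2) = if v = r then 1 else 0 := by
    intro v
    simp [hw, show (4 * v + 2) % 4 = 2 by omega]
  have wsnk : ∀ v, w (4 * v + 3) = 0 := by
    intro v
    simp [hw, show (4 * v + 3) % 4 = 3 by omega]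
    omega
  set S := ((range I.n).filter fun v => I.rep v = r ∧ σ v = 0).map
    (addLeftEmbedding (2 * I.m)) with hS
  have hmem : ∀ v < I.n, 2 * I.m + v ∈ S ↔ I.rep v = r ∧ σ v = 0 := by
    intro v hv
    simp [hS, hv]
  have := hf.le_card hb hr (w := w) ?_ (by simp [wsrc]) (wsnk r) S ?_ ?_
  · simpa [hS, dels] using this
  · intro x hx
    -- The four kinds of nodes are separated by the residue modulo 4.
    have h4 : x = 4 * (x / 4) + x % 4 := by omega
    have h5 : x % 4 < 4 := by omega
    set q := x / 4
    interval_cases h : x % 4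
    · rw [add_zero] at h4
      rw [h4, cmp_in] at hx
      rw [h4, win]
      simp [hx]
    · rw [h4, cmp_out] at hx
      rw [h4, wout]
      simp [hx]
    · rw [h4, cmp_src] at hx
      rw [h4, wsrc]
      simp [hx]
    · rw [h4, wsnk]
  · intro a ha
    simp only [hS, mem_map, mem_filter, mem_range] at ha
    obtain ⟨v, hv, rfl⟩ := ha
    simp [arcs, hv.1]
  · intro a ha
    refine arc_cases (P := fun a => I.act st side a = 1 →
      w (I.tl a) - w (I.hd a) ≤ if a ∈ S then 1 else 0) (fun i hi hact => ?_)
      (fun i hi hact => ?_) (fun v hv _ => ?_) ha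
    · have h0 : (0 : ℤ) ≤ if 2 * i ∈ S then 1 else 0 := by split_ifs <;> simp
      refine le_trans ?_ h0
      have hu := hσ.le _ (hI.up_lt i hi)
      have hl := hσ.le _ (hI.lo_lt i hi)
      have hsu := hs.le _ (hI.up_lt i hi)
      have hsl := hs.le _ (hI.lo_lt i hi)
      rw [act_even _ _ hi] at hact
      rw [tl_even hi, hd_even hi, win]
      by_cases hsame : I.Same i
      · rw [if_pos hsame, wout]
        split_ifs with h1 h2
        · simp
        · refine absurd ?_ h2
          rw [hI.rep_same hi hsame] at h1
          refine ⟨h1.1, ?_⟩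
          have := hσ.same i hi h1.1 hsame
          have := hs.ne i hi hsame
          unfold Okc at *
          omega
        · simp
        · simp
      · rw [if_neg hsame, wsrc]
        rw [if_neg hsame] at hact
        split_ifs with h1 h2
        · simp
        · refine absurd ?_ h2
          refine ⟨h1, ?_⟩
          have := hσ.above i hi h1 hsame
          split_ifs at hact
          unfold Okc at *
          omega
        · simp
        · simp
    · have h0 : (0 : ℤ) ≤ if 2 * i + 1 ∈ S then 1 else 0 := by split_ifs <;> simp
      refine le_trans ?_ h0
      have hu := hσ.le _ (hI.up_lt i hi)
      have hl := hσ.le _ (hI.lo_lt i hi)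
      have hsu := hs.le _ (hI.up_lt i hi)
      have hsl := hs.le _ (hI.lo_lt i hi)
      rw [act_odd _ _ hi] at hact
      rw [tl_odd hi, hd_odd hi, wout]
      by_cases hsame : I.Same i
      · rw [if_pos hsame, win]
        split_ifs with h1 h2
        · simp
        · refine absurd ?_ h2
          refine ⟨(hI.rep_same hi hsame).trans h1.1, ?_⟩
          have := hσ.same i hi h1.1 hsame
          have := hs.ne i hi hsame
          unfold Okc at *
          omega
        · simp
        · simp
      · rw [if_neg hsame, wsnk]
        rw [if_neg hsame] at hact
        split_ifs with h1
        · have := hσ.above i hi h1.1 hsame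
          split_ifs at hact
          unfold Okc at *
          omega
        · simp
    · rw [tl_vertex, hd_vertex, win, wout]
      simp only [hmem v hv]
      split_ifs <;> simp_all

variable (I)

/-- Vertex `v` is deleted: its bag cannot be separated cheaply, or it is charged with a cut arc. -/
def Del (st side vis : ℕ → ℕ) (v : ℕ) : Prop :=
  vis (4 * I.rep v + 3) = 1 ∨ ∃ a < I.arcs, I.own a = v ∧ I.act st side a = 1 ∧
    vis (I.tl a) = 1 ∧ vis (I.hd a) ≠ 1

open Classical in
/-- The colouring of the bags that a set of visited nodes describes. -/
noncomputable def cutColour (st side vis : ℕ → ℕ) (v : ℕ) : ℕ :=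
  if I.Del st side vis v then 0 else if vis (4 * v + 1) = 1 then side v + 1 else 2 - side v

variable {I}

lemma cutColour_le (hs : I.Sides side) {v : ℕ} (hv : v < I.n) : I.cutColour st side vis v ≤ 2 := by
  have := hs.le v hv
  unfold cutColour
  split_ifs <;> omega

/-- If neither end is deleted, no arc charged to them is cut. Being visited then passes from the
exit of either end through the entry to the exit of the other, so both exits are visited or neither
is, and the two colours differ because `side` does. -/
lemma cutColour_same (hI : I.Valid) (hs : I.Sides side) {i : ℕ} (hi : i < I.m)
    (h : I.Same i) :
    Okc (I.cutColour st side vis (I.up i)) (I.cutColour st side vis (I.lo i)) := by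
  by_cases hu : I.Del st side vis (I.up i)
  · left; simp [cutColour, hu]
  by_cases hl : I.Del st side vis (I.lo i)
  · apply Okc.symm; left; simp [cutColour, hl]
  have key : ∀ a < I.arcs, ∀ x, I.own a = x → ¬ I.Del st side vis x → I.act st side a = 1 →
      vis (I.tl a) = 1 → vis (I.hd a) = 1 := by
    intro a ha x hx hd h1 h2
    by_contra h3
    exact hd (.inr ⟨a, ha, hx, h1, h2, h3⟩)
  have hul := hI.up_lt i hi
  have hll := hI.lo_lt i hi
  have k1 := key (2 * i) (by unfold arcs; omega) _ (own_even hi) hl (by simp [act_even _ _ hi, h])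
  have k2 := key (2 * i + 1) (by unfold arcs; omega) _ (own_odd hi) (by simpa [h] using hu)
    (by simp [act_odd _ _ hi, h])
  have k3 := key (2 * I.m + I.up i) (by unfold arcs; omega) _ own_vertex hu (act_vertex _ _)
  have k4 := key (2 * I.m + I.lo i) (by unfold arcs; omega) _ own_vertex hl (act_vertex _ _)
  rw [tl_even hi, hd_even hi, if_pos h] at k1
  rw [tl_odd hi, hd_odd hi, if_pos h] at k2
  rw [tl_vertex, hd_vertex] at k3 k4
  have hne := hs.ne i hi h
  have h1 := hs.le _ hul
  have h2 := hs.le _ hll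
  right
  simp only [cutColour, hu, hl, if_false]
  split_ifs with e1 e2 e2
  · omega
  · exact absurd (k4 (k1 e1)) e2
  · exact absurd (k3 (k2 e2)) e1
  · omega

/-- An undeleted vertex tied to the source is reached through its entry up to its exit and gets
colour `side + 1`. One tied to the sink has an unvisited exit, since otherwise the sink would be
visited and the whole bag deleted. In both cases the colour avoids that of the neighbour above. -/
lemma cutColour_above (hI : I.Valid) (hs : I.Sides side)
    (hsrc : ∀ r < I.n, vis (4 * r + 2) = 1) {i : ℕ} (hi : i < I.m)
    (h : ¬ I.Same i) :
    Okc (st (I.up i)) (I.cutColour st side vis (I.lo i)) := by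
  by_cases hl : I.Del st side vis (I.lo i)
  · apply Okc.symm; left; simp [cutColour, hl]
  have key : ∀ a < I.arcs, I.own a = I.lo i → I.act st side a = 1 →
      vis (I.tl a) = 1 → vis (I.hd a) = 1 := by
    intro a ha hx h1 h2
    by_contra h3
    exact hl (.inr ⟨a, ha, hx, h1, h2, h3⟩)
  have hll := hI.lo_lt i hi
  have k1 := key (2 * i) (by unfold arcs; omega) (own_even hi)
  have k2 := key (2 * i + 1) (by unfold arcs; omega) (by rw [own_odd hi, if_neg h])
  have k4 := key (2 * I.m + I.lo i) (by unfold arcs; omega) own_vertex (act_vertex _ _)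
  rw [tl_even hi, hd_even hi, act_even _ _ hi, if_neg h, if_neg h] at k1
  rw [tl_odd hi, hd_odd hi, act_odd _ _ hi, if_neg h, if_neg h] at k2
  rw [tl_vertex, hd_vertex] at k4
  have h2 := hs.le _ hll
  have h3 := hsrc _ (hI.rep_lt hll)
  have h4 : vis (4 * I.rep (I.lo i) + 3) ≠ 1 := fun h => hl (.inl h)
  unfold Okc
  by_contra hc
  push Not at hc
  obtain ⟨hc0, hc⟩ := hc
  simp only [cutColour, hl, if_false] at hc
  split_ifs at hc with e
  · exact h4 (k2 (by simp [hc]) e)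
  · exact e (k4 (k1 (by rw [if_pos]; omega) h3))

/-- Visited sources suffice here; closedness of the visited set matters only for the number of
deletions. -/
lemma cutColour_feas (hI : I.Valid) (hs : I.Sides side)
    (hsrc : ∀ r < I.n, vis (4 * r + 2) = 1) (r : ℕ) :
    I.Feas st r (I.cutColour st side vis) where
  le _ hv := cutColour_le hs hv
  same _ hi _ h := cutColour_same hI hs hi h
  above _ hi _ h := cutColour_above hI hs hsrc hi h

/-- With the sink unreached, every deleted vertex is the owner of a cut arc, so the deletions number
at most the cut. Arcs of edges may occur in the cut as well, which is why unit capacities on them do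
no harm. -/
lemma Flow.dels_le (hI : I.Valid) (hs : I.Sides side) (hb : I.Bits st side en)
    (hf : I.Flow en k) {r : ℕ} (hr : r < I.n) (hc : I.Closed en vis)
    (h1 : vis (4 * r + 2) = 1) (h0 : vis (4 * r + 3) ≠ 1) :
    I.dels r (I.cutColour st side vis) ≤ k r := by
  refine le_trans ?_ (hf.card_cut_le hI hb hr hc h1 h0)
  refine le_trans (card_le_card ?_) (card_image_le (f := I.own))
  intro v hv
  obtain ⟨hv, hvr, h⟩ := by simpa using hv
  have hd : I.Del st side vis v := by
    by_contra hd
    have := hs.le v hv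
    simp only [cutColour, hd, if_false] at h
    split_ifs at h
    omega
  rcases hd with hd | ⟨a, ha, rfl, h2, h3, h4⟩
  · rw [hvr] at hd
    exact absurd hd h0
  · refine mem_image.2 ⟨a, ?_, rfl⟩
    simp only [cut, mem_filter, mem_range]
    exact ⟨ha, by rw [← hI.own_cmp ha, hvr], h2, h3, h4⟩

/-! ### Augmentation -/

/-- The source of a half arc. -/
def hsrc (I : Inst) (h : ℕ) : ℕ := if h % 2 = 0 then I.tl (h / 2) else I.hd (h / 2)

/-- The target of a half arc. -/
def hdst (I : Inst) (h : ℕ) : ℕ := if h % 2 = 0 then I.hd (h / 2) else I.tl (h / 2)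

/-- The other half of the arc. -/
def twin (h : ℕ) : ℕ := 4 * (h / 2) + 1 - h

lemma twin_even (a : ℕ) : twin (2 * a) = 2 * a + 1 := by
  unfold twin
  omega

lemma twin_odd (a : ℕ) : twin (2 * a + 1) = 2 * a := by
  unfold twin
  omega

/-- Reverse the half arc `h`. -/
def flip (en : ℕ → ℕ) (h : ℕ) : ℕ → ℕ := fun x => if x = twin h then 1 else if x = h then 0 else en x

lemma Bits.flip (hb : I.Bits st side en) {h : ℕ} (hh : h < 2 * I.arcs) (he : en h ≠ 0) :
    I.Bits st side (flip en h) := by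
  intro a ha
  have h1 := hb a ha
  have h2 := act_le (I := I) st side a
  unfold Inst.flip
  rcases Nat.even_or_odd' h with ⟨b, rfl | rfl⟩
  · by_cases hab : a = b
    · subst hab
      simp only [twin_even]
      simp
      omega
    · simp only [twin_even]
      simp [hab, show ¬ 2 * a = 2 * b + 1 by omega, show ¬ 2 * a + 1 = 2 * b by omega, h1]
  · by_cases hab : a = b
    · subst hab
      simp only [twin_odd]
      simp
      omega
    · simp only [twin_odd]
      simp [hab, show ¬ 2 * a = 2 * b + 1 by omega, show ¬ 2 * a + 1 = 2 * b by omega, h1]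

/-- Reversing a half arc sends one more unit from its source to its target, by adding flow on the
arc or by cancelling flow on it. -/
lemma net_flip (hb : I.Bits st side en) {h : ℕ} (hh : h < 2 * I.arcs) (he : en h ≠ 0)
    (w : ℕ → ℤ) : I.net (flip en h) w = I.net en w + w (I.hsrc h) - w (I.hdst h) := by
  have hb1 : h / 2 < I.arcs := by omega
  have h1 := hb _ hb1
  have h2 := act_le (I := I) st side (h / 2)
  unfold net
  rw [← add_sum_erase _ _ (mem_range.2 hb1), ← add_sum_erase _ _ (mem_range.2 hb1)]
  have hrest : ∑ a ∈ (range I.arcs).erase (h / 2), (flip en h (2 * a + 1) : ℤ) *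
      (w (I.tl a) - w (I.hd a)) = ∑ a ∈ (range I.arcs).erase (h / 2), (en (2 * a + 1) : ℤ) *
      (w (I.tl a) - w (I.hd a)) := by
    refine sum_congr rfl fun a ha => ?_
    have hne := (mem_erase.1 ha).1
    simp [flip, twin, show ¬ 2 * a + 1 = 4 * (h / 2) + 1 - h by omega,
      show ¬ 2 * a + 1 = h by omega]
  rw [hrest]
  rcases Nat.even_or_odd' h with ⟨b, rfl | rfl⟩
  · have e : 2 * b / 2 = b := by omega
    rw [e] at h1 h2 ⊢
    have e1 : en (2 * b + 1) = 0 := by omega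
    simp [flip, twin_even, hsrc, hdst, e1]
    ring
  · have e : (2 * b + 1) / 2 = b := by omega
    rw [e] at h1 h2 ⊢
    have e1 : en (2 * b + 1) = 1 := by omega
    simp [flip, twin_odd, hsrc, hdst, e, e1, show (2 * b + 1) % 2 = 1 by omega]
    ring

end Inst

end OddCycleTransversal

namespace OddCycleTransversal

open Finset

/-! ### Memory layout after the preparation -/

notation "vD" => (4 : ℕ)
notation "vHalf" => (5 : ℕ)
notation "vNodes" => (6 : ℕ)
notation "vD1" => (7 : ℕ)
notation "vArcs" => (8 : ℕ)
notation "vI" => (10 : ℕ)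
notation "vJ" => (11 : ℕ)
notation "vPos" => (26 : ℕ)
notation "aDep" => (6 : ℕ)
notation "aAnc" => (7 : ℕ)
notation "aRl" => (9 : ℕ)
notation "aUp" => (10 : ℕ)
notation "aLo" => (11 : ℕ)
notation "aOnp" => (20 : ℕ)
notation "aSide" => (21 : ℕ)
notation "aOwn" => (28 : ℕ)

/-- The words and addresses that the algorithm uses are below `B`. -/
structure Inst.Room (I : Inst) (B : ℕ) : Prop where
  lin : 100 * (I.n + I.m + I.D + 2) < B
  idx : (I.D + 3) * I.n < B

/-- The memory holds the instance, its network and the 2-colouring `side` of the bags. -/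
structure Static (I : Inst) (side : ℕ → ℕ) (σ : Memory) : Prop where
  n : σ.var vN = I.n
  m : σ.var vM = I.m
  D : σ.var vD = I.D
  half : σ.var vHalf = 2 * I.arcs
  nodes : σ.var vNodes = 4 * I.n
  D1 : σ.var vD1 = I.D + 1
  arcs : σ.var vArcs = I.arcs
  dep : σ.arr aDep = I.dep
  anc : σ.arr aAnc = I.ancA
  rl : σ.arr aRl = I.rl
  up : σ.arr aUp = I.up
  lo : σ.arr aLo = I.lo
  side : σ.arr aSide = side
  src : ∀ h < 2 * I.arcs, σ.arr aSrc h = I.hsrc h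
  dst : ∀ h < 2 * I.arcs, σ.arr aDst h = I.hdst h
  links : Links (4 * I.n) (2 * I.arcs) (σ.arr aSrc) (σ.arr aFst) (σ.arr aNxt)
  own : ∀ a < I.arcs, σ.arr aOwn a = I.own a

lemma Static.of_frame {I : Inst} {side : ℕ → ℕ} {σ τ : Memory} {p : Prog} (h : Static I side σ)
    (hf : Frame p σ τ)
    (hp : p.keeps [vN, vM, vD, vHalf, vNodes, vD1, vArcs]
      [aDep, aAnc, aRl, aUp, aLo, aSide, aSrc, aDst, aFst, aNxt, aOwn] = true) :
    Static I side τ := by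
  simp only [Prog.keeps, List.all_cons, List.all_nil, Bool.and_true, Bool.and_eq_true,
    Bool.not_eq_true'] at hp
  obtain ⟨⟨v0, v1, v2, v3, v4, v5, v6⟩, a0, a1, a2, a3, a4, a5, a6, a7, a8, a9, a10⟩ := hp
  constructor <;>
    simp only [hf.var _ v0, hf.var _ v1, hf.var _ v2, hf.var _ v3, hf.var _ v4, hf.var _ v5,
      hf.var _ v6, hf.arr _ a0, hf.arr _ a1, hf.arr _ a2, hf.arr _ a3, hf.arr _ a4, hf.arr _ a5,
      hf.arr _ a6, hf.arr _ a7, hf.arr _ a8, hf.arr _ a9, hf.arr _ a10]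
  exacts [h.n, h.m, h.D, h.half, h.nodes, h.D1, h.arcs, h.dep, h.anc, h.rl, h.up, h.lo, h.side,
    h.src, h.dst, h.links, h.own]

/-! ### The backward sweep that augments along the search tree -/

namespace Inst

variable {I : Inst} {st side en k vis par q onp fr : ℕ → ℕ} {qt j : ℕ}

lemma Valid.hsrc_lt (h : I.Valid) {a : ℕ} (ha : a < 2 * I.arcs) : I.hsrc a < 4 * I.n := by
  unfold hsrc
  split_ifs
  · exact h.tl_lt (by omega)
  · exact h.hd_lt (by omega)

lemma Valid.hdst_lt (h : I.Valid) {a : ℕ} (ha : a < 2 * I.arcs) : I.hdst a < 4 * I.n := by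
  unfold hdst
  split_ifs
  · exact h.hd_lt (by omega)
  · exact h.tl_lt (by omega)

lemma Valid.cmp_half (h : I.Valid) {a : ℕ} (ha : a < 2 * I.arcs) :
    I.cmp (I.hsrc a) = I.cmp (I.hdst a) := by
  have := h.cmp_eq (a := a / 2) (by omega)
  unfold hsrc hdst
  split_ifs
  · exact this
  · exact this.symm

lemma Closed.of_half (h : ∀ a < 2 * I.arcs, en a ≠ 0 → vis (I.hsrc a) = 1 → vis (I.hdst a) = 1) :
    I.Closed en vis := by
  intro a ha
  have h1 := h (2 * a) (by omega)
  have h2 := h (2 * a + 1) (by omega)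
  simp only [hsrc, hdst, Nat.mul_mod_right, if_true, show 2 * a / 2 = a by omega,
    show (2 * a + 1) / 2 = a by omega, show (2 * a + 1) % 2 = 1 by omega, one_ne_zero,
    if_false] at h1 h2
  exact ⟨h1, h2⟩

/-- The augmenting paths have been flipped from the sinks back to the nodes `fr r`, which are those
marked by `onp` among the first `j` nodes of the queue. -/
structure Sweep (I : Inst) (st side k vis par q : ℕ → ℕ) (qt : ℕ) (en onp fr : ℕ → ℕ) (j : ℕ) :
    Prop where
  bits : I.Bits st side en
  net : ∀ w : ℕ → ℤ, I.net en w =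
    ∑ r ∈ range I.n, (k r : ℤ) * (w (4 * r + 2) - w (4 * r + 3)) +
      ∑ r ∈ range I.n, if vis (4 * r + 3) = 1 then w (fr r) - w (4 * r + 3) else 0
  front : ∀ r < I.n, vis (4 * r + 3) = 1 →
    I.cmp (fr r) = r ∧ ∃ i < qt, q i = fr r ∧ (i < j ∨ par (fr r) = 0)
  mark : ∀ i < j, onp (q i) ≠ 0 ↔ vis (4 * I.cmp (q i) + 3) = 1 ∧ fr (I.cmp (q i)) = q i
  intact : ∀ i < j, ∀ h, par (q i) = h + 1 → en h ≠ 0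

/-- An unmarked node is on no augmenting path, and a marked one without a parent arc is a source at
which its path is finished. -/
lemma Sweep.skip (hS : Sweep I st side k vis par q qt en onp fr (j + 1)) (hj : j < qt)
    (h : onp (q j) = 0 ∨ par (q j) = 0) :
    Sweep I st side k vis par q qt en onp fr j where
  bits := hS.bits
  net := hS.net
  front r hr hv := by
    obtain ⟨h1, i, hi, h2, h3⟩ := hS.front r hr hv
    refine ⟨h1, i, hi, h2, ?_⟩
    by_cases hij : i = j
    · subst hij
      rcases h with h | h
      · refine absurd ?_ ((not_iff_not.2 (hS.mark i (by omega))).1 (by simp [h]))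
        rw [h2, h1]
        exact ⟨hv, rfl⟩
      · right
        rwa [← h2]
    · omega
  mark i hi := hS.mark i (by omega)
  intact i hi := hS.intact i (by omega)

/-- The parent of a node comes earlier in the queue, so going through the queue backwards extends
each path by one arc before its new front is met. Each bag has a single front. Parent arcs of
different nodes have different targets, so the arcs still to be flipped remain usable. -/
lemma Sweep.step (hI : I.Valid) (hS : Sweep I st side k vis par q qt en onp fr (j + 1))
    (hj : j < qt) (hq : ∀ i < qt, q i < 4 * I.n)
    (hinj : ∀ i < qt, ∀ j < qt, q i = q j → i = j) (ho : onp (q j) ≠ 0) {h : ℕ}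
    (hh : h < 2 * I.arcs) (hp : par (q j) = h + 1) (hd : I.hdst h = q j)
    (hdst : ∀ i < qt, ∀ h, par (q i) = h + 1 → I.hdst h = q i)
    (hs : ∃ i < j, I.hsrc h = q i) :
    Sweep I st side k vis par q qt (flip en h) (fun x => if x = I.hsrc h then 1 else onp x)
      (fun r => if r = I.cmp (q j) then I.hsrc h else fr r) j := by
  obtain ⟨i₀, hi₀, hs⟩ := hs
  have he := hS.intact j (by omega) h hp
  have hm := (hS.mark j (by omega)).1 ho
  have hcmp : I.cmp (I.hsrc h) = I.cmp (q j) := by rw [hI.cmp_half hh, hd]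
  have hr := hI.cmp_lt (hq j hj)
  constructor
  · exact hS.bits.flip hh he
  · intro w
    -- The change `w (I.hsrc h) - w (q j)` moves the front of one bag from `q j` to the source of
    -- `h`; all other summands stay.
    rw [net_flip hS.bits hh he, hS.net w, hd, add_sub_assoc, add_assoc]
    congr 1
    have hrest : ∑ r ∈ (range I.n).erase (I.cmp (q j)), (if vis (4 * r + 3) = 1 then
        w (if r = I.cmp (q j) then I.hsrc h else fr r) - w (4 * r + 3) else 0) =
        ∑ r ∈ (range I.n).erase (I.cmp (q j)),
          if vis (4 * r + 3) = 1 then w (fr r) - w (4 * r + 3) else 0 :=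
      sum_congr rfl fun r hr => by simp [(mem_erase.1 hr).1]
    rw [← add_sum_erase _ _ (mem_range.2 hr), ← add_sum_erase _ _ (mem_range.2 hr), hrest]
    simp only [hm.1, if_true, hm.2]
    ring
  · intro r hr' hv
    by_cases e : r = I.cmp (q j)
    · subst e
      simp only [if_true]
      exact ⟨hcmp, i₀, by omega, hs.symm, .inl hi₀⟩
    · simp only [e, if_false]
      obtain ⟨h1, i, hi, h2, h3⟩ := hS.front r hr' hv
      refine ⟨h1, i, hi, h2, ?_⟩
      have : i ≠ j := by
        rintro rfl
        exact e (by rw [h2, h1])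
      omega
  · intro i hi
    by_cases e : q i = I.hsrc h
    · simp [e, hcmp, hm.1]
    · simp only [e, if_false]
      rw [hS.mark i (by omega)]
      by_cases e2 : I.cmp (q i) = I.cmp (q j)
      · simp only [e2, if_true, hm.2]
        constructor
        · rintro ⟨-, h2⟩
          have := hinj _ hj i (by omega) h2
          omega
        · rintro ⟨-, h2⟩
          exact absurd h2.symm e
      · simp [e2]
  · intro i hi h' hp'
    have hne : h' ≠ h := by
      rintro rfl
      have := hinj i (by omega) j hj (by rw [← hdst i (by omega) _ hp', hd])
      omega
    -- Only `h` itself loses its bit; its twin may gain one, which is harmless.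
    unfold flip
    split_ifs with e
    · exact one_ne_zero
    · exact hS.intact i (by omega) h' hp'

end Inst

/-! ### One phase of augmentations -/

def phaseReset : Prog := forP vI vNodes (.store aVis (.var vI) 0 ;; .store aOnp (.var vI) 0)

def phaseMark : Prog :=
  forP vI vN (.store aOnp (4 * .var vI + 3) (.read aVis (4 * .var vI + 3)))

def flipBody : Prog :=
  .assign vPos (.var vPos - 1) ;;
  .assign vNode (.read aQ (.var vPos)) ;;
  .ite (.read aOnp (.var vNode))
    (.ite (.read aPar (.var vNode))
      (.assign vArc (.read aPar (.var vNode) - 1) ;;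
       .store aEn (.var vArc) 0 ;;
       .store aEn (4 * (.var vArc / 2) + 1 - .var vArc) 1 ;;
       .store aOnp (.read aSrc (.var vArc)) 1)
      .skip)
    .skip

def phaseFlip : Prog := .assign vPos (.var vTail) ;; .loop (.var vPos) flipBody

/-- Search from the sources of all bags, and augment the flow in those whose sink is reached. -/
def phase : Prog := phaseReset ;; bfs 2 2 ;; phaseMark ;; phaseFlip

section phase

variable {I : Inst} {side st k : ℕ → ℕ} {B : ℕ} {σ : Memory}

lemma Tr.phaseReset (hR : I.Room B) (hσ : Static I side σ) :
    Tr B phaseReset (4 * I.n * 14 + 6) σ fun τ =>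
      ∀ x < 4 * I.n, τ.arr aVis x = 0 ∧ τ.arr aOnp x = 0 := by
  have hB := hR.lin
  refine Tr.forP (T := 6) (fun k τ => ∀ x < k, τ.arr aVis x = 0 ∧ τ.arr aOnp x = 0) rfl rfl
    hσ.nodes (by omega) (by simp) fun k τ hk hf hv hI => ?_
  refine Tr.of_wp ?_
  simp only [Prog.wp]
  simp [hv]
  refine ⟨by omega, fun x hx => ⟨fun h => (hI x (by omega)).1, fun h => (hI x (by omega)).2⟩⟩

lemma Tr.phaseMark (hR : I.Room B) (hσ : Static I side σ) (hvis : ∀ x < 4 * I.n, σ.arr aVis x ≤ 1)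
    (h0 : ∀ x < 4 * I.n, σ.arr aOnp x = 0) :
    Tr B phaseMark (I.n * 20 + 6) σ fun τ =>
      ∀ x < 4 * I.n, τ.arr aOnp x = if x % 4 = 3 then σ.arr aVis x else 0 := by
  have hB := hR.lin
  refine (Tr.forP (T := 12) (fun k τ => ∀ x < 4 * I.n, τ.arr aOnp x =
    if x % 4 = 3 ∧ x < 4 * k then σ.arr aVis x else 0) rfl rfl hσ.n (by omega) (by simpa using h0)
    fun k τ hk hf hv hI => ?_).conseq le_rfl ?_
  · refine Tr.of_wp ?_
    have hvv := hvis (4 * k + 3) (by omega)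
    have hvs := hf.arr aVis rfl
    simp only [Prog.wp]
    simp [hv, hvs]
    refine ⟨by omega, fun x hx => ?_⟩
    split_ifs with h1 h2 h2
    · rw [h1]
    · omega
    · rw [hI x hx, if_pos (by omega)]
    · rw [hI x hx, if_neg (by omega)]
  · intro τ h _ x hx
    rw [h x hx]
    simp [hx]

/-- At the start the fronts are the reached sinks, whose correction terms vanish. At the end all
fronts are roots of the search tree, hence the sources of their bags, and each correction term is
exactly one more unit of flow. -/
lemma Tr.phaseFlip (hI : I.Valid) (hR : I.Room B) (hσ : Static I side σ)
    (hb : I.Bits st side (σ.arr aEn)) (hk : I.Flow (σ.arr aEn) k)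
    (ht : BfsTree I.n (2 * I.arcs) 2 (σ.arr aSrc) (σ.arr aDst) (σ.arr aEn) (σ.arr aVis)
      (σ.arr aPar) (σ.arr aQ) (σ.var vTail))
    (h0 : ∀ x < 4 * I.n, σ.arr aOnp x = if x % 4 = 3 then σ.arr aVis x else 0) :
    Tr B phaseFlip (4 * I.n * 50 + 10) σ fun τ => I.Bits st side (τ.arr aEn) ∧
      I.Flow (τ.arr aEn) fun r => k r + if σ.arr aVis (4 * r + 3) = 1 then 1 else 0 := by
  have hB := hR.lin
  have hqt := ht.card_le
  have h1 : Tr B (.assign vPos (.var vTail)) 2 σ fun τ => τ = σ.setVar vPos (σ.var vTail) := by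
    refine Tr.of_wp (p := .assign vPos (.var vTail)) ?_
    simp only [Prog.wp]
    simp
    omega
  refine h1.seq (T₂ := σ.var vTail * (45 + 1 + 1) + 1 + 1) (fun τ₀ hτ₀ hf₀ => ?_) (by omega)
  have hpar : ∀ i < σ.var vTail, ∀ h, σ.arr aPar (σ.arr aQ i) = h + 1 →
      h < 2 * I.arcs ∧ I.hdst h = σ.arr aQ i ∧ ∃ i' < i, I.hsrc h = σ.arr aQ i' := by
    intro i hi h hp
    rcases ht.par i hi with ⟨h1, -⟩ | ⟨h', h1, h2, -, h4, i', h5, h6⟩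
    · omega
    · obtain rfl : h = h' := by omega
      rw [hσ.dst h h1] at h4
      rw [hσ.src h h1] at h6
      exact ⟨h1, h4, i', h5, h6⟩
  refine (Tr.loop (T := 45) (e := .var vPos) (p := flipBody) (fun j τ => τ.var vPos = j ∧ j ≤ σ.var vTail ∧
    (∀ x < 4 * I.n, τ.arr aOnp x ≤ 1) ∧
    ∃ fr, Inst.Sweep I st side k (σ.arr aVis) (σ.arr aPar) (σ.arr aQ) (σ.var vTail) (τ.arr aEn)
      (τ.arr aOnp) fr j) (k := σ.var vTail) ⟨by simp [hτ₀], le_rfl, ?_, fun r => 4 * r + 3,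
        ?_, ?_, ?_, ?_, ?_⟩ ?_).conseq le_rfl ?_
  · intro x hx
    subst hτ₀
    have := ht.le x hx
    simp only [Memory.arr_setVar]
    rw [h0 x hx]
    split_ifs <;> omega
  · subst hτ₀
    exact hb
  · intro w
    subst hτ₀
    simp [hk w]
  · intro r hr hv
    refine ⟨I.cmp_snk r, ?_⟩
    obtain ⟨i, hi, e⟩ := (ht.mem _ (by omega)).1 hv
    exact ⟨i, hi, e, .inl hi⟩
  · intro i hi
    have hlt := ht.lt i hi
    have hv := (ht.mem _ hlt).2 ⟨i, hi, rfl⟩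
    subst hτ₀
    simp only [Memory.arr_setVar]
    rw [h0 _ hlt, hv]
    constructor
    · intro h
      have h3 : σ.arr aQ i % 4 = 3 := by
        by_contra hc
        simp [hc] at h
      have e : σ.arr aQ i = 4 * (σ.arr aQ i / 4) + 3 := by omega
      rw [e, I.cmp_snk, ← e]
      exact ⟨hv, rfl⟩
    · rintro ⟨-, e⟩
      rw [if_pos (by omega)]
      exact one_ne_zero
  · intro i hi h hp
    subst hτ₀
    simp only [Memory.arr_setVar]
    rcases ht.par i hi with ⟨h1, -⟩ | ⟨h', h1, h2, h3, -⟩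
    · omega
    · obtain rfl : h = h' := by omega
      exact h3
  · rintro j τ ⟨hv, hj, hon, fr, hS⟩ hf
    refine ⟨by simp; omega, fun hne => ?_⟩
    have hne' : τ.var vPos ≠ 0 := hne
    obtain ⟨i, rfl⟩ : ∃ i, j = i + 1 := ⟨j - 1, by omega⟩
    have hi : i < σ.var vTail := by omega
    have e1 : τ.arr aQ = σ.arr aQ := by rw [hf.arr _ rfl, hf₀.arr _ rfl]
    have e2 : τ.arr aPar = σ.arr aPar := by rw [hf.arr _ rfl, hf₀.arr _ rfl]
    have e3 : τ.arr aSrc = σ.arr aSrc := by rw [hf.arr _ rfl, hf₀.arr _ rfl]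
    have hlt := ht.lt i hi
    have ho := hon _ hlt
    have hskip := hS.skip hi
    have hpl : σ.arr aPar (σ.arr aQ i) ≤ 2 * I.arcs := by
      rcases ht.par i hi with ⟨h1, -⟩ | ⟨h', h1, h2, -⟩ <;> omega
    have harcs : I.arcs = 2 * I.m + I.n := rfl
    refine (Tr.of_wp (p := flipBody) ?_).conseq (by decide) (fun _ h _ => h)
    simp only [flipBody, Prog.wp]
    simp [hv, e1, e2, e3]
    refine ⟨by omega, by omega, by omega, fun h1 => ⟨by omega, fun h2 => ?_, fun h2 => ?_⟩,
      fun h1 => ?_⟩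
    · obtain ⟨h, hh⟩ : ∃ h, σ.arr aPar (σ.arr aQ i) = h + 1 := ⟨_ - 1, (Nat.sub_add_cancel
        (Nat.pos_of_ne_zero h2)).symm⟩
      obtain ⟨h3, h4, h5⟩ := hpar i hi h hh
      have h6 := hI.hsrc_lt h3
      simp only [hh, Nat.add_sub_cancel, hσ.src h h3]
      refine ⟨by omega, by omega, by omega, by omega, by omega, ?_, _,
        hS.step hI hi ht.lt ht.inj h1 h3 hh h4 (fun i hi h hp => (hpar i hi h hp).2.1) h5⟩
      intro x hx
      split_ifs
      · exact le_rfl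
      · exact hon x hx
    · exact ⟨by omega, hon, _, hskip (.inr h2)⟩
    · exact ⟨by omega, hon, _, hskip (.inl h1)⟩
  · rintro τ ⟨⟨j, hv, -, -, fr, hS⟩, he⟩ -
    have hj : j = 0 := by
      have : τ.var vPos = 0 := he
      omega
    subst hj
    refine ⟨hS.bits, fun w => ?_⟩
    rw [hS.net w, ← sum_add_distrib]
    refine sum_congr rfl fun r hr => ?_
    by_cases hv : σ.arr aVis (4 * r + 3) = 1
    · obtain ⟨h1, i, hi, h2, h3⟩ := hS.front r (mem_range.1 hr) hv
      have h3 : σ.arr aPar (fr r) = 0 := by omega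
      -- A root has the form `4 * v + 2`, and lying in bag `r` forces `v = r`.
      have : fr r = 4 * r + 2 := by
        rcases ht.par i hi with ⟨-, v, -, h4⟩ | ⟨h', -, h4, -⟩
        · rw [← h2, h4, I.cmp_src] at h1
          rw [← h2, h4, h1]
        · rw [h2] at h4
          omega
      simp [hv, this]
      ring
    · simp [hv]

lemma bfsStable_true (n H o o' : ℕ) (hs hd en : ℕ → ℕ) :
    BfsStable n H o o' hs hd en fun _ => True :=
  ⟨fun _ _ _ _ _ _ _ => trivial, fun _ _ _ _ _ _ _ _ => trivial⟩

lemma Static.src_lt (hσ : Static I side σ) (hI : I.Valid) :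
    ∀ h < 2 * I.arcs, σ.arr aSrc h < 4 * I.n := fun h hh => by
  rw [hσ.src h hh]
  exact hI.hsrc_lt hh

lemma Static.dst_lt (hσ : Static I side σ) (hI : I.Valid) :
    ∀ h < 2 * I.arcs, σ.arr aDst h < 4 * I.n := fun h hh => by
  rw [hσ.dst h hh]
  exact hI.hdst_lt hh

lemma Inst.Bits.le_one {en : ℕ → ℕ} (hb : I.Bits st side en) : ∀ h < 2 * I.arcs, en h ≤ 1 := by
  intro h hh
  have h1 := hb (h / 2) (by omega)
  have h2 := Inst.act_le (I := I) st side (h / 2)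
  rcases Nat.even_or_odd' h with ⟨b, rfl | rfl⟩
  · rw [show 2 * b / 2 = b by omega] at h1 h2
    omega
  · rw [show (2 * b + 1) / 2 = b by omega] at h1 h2
    omega

/-- The visited set is closed for the bits before the flips: for bags whose sink is not reached it
certifies that the flow with which the phase began is maximum, and that flow is left as it is. -/
lemma Tr.phase (hI : I.Valid) (hR : I.Room B) (hσ : Static I side σ)
    (hb : I.Bits st side (σ.arr aEn)) (hk : I.Flow (σ.arr aEn) k) :
    Tr B phase (1000 * (I.n + I.m + 1)) σ fun τ => I.Bits st side (τ.arr aEn) ∧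
      I.Flow (τ.arr aEn) (fun r => k r + if τ.arr aVis (4 * r + 3) = 1 then 1 else 0) ∧
      I.Closed (σ.arr aEn) (τ.arr aVis) ∧ (∀ r < I.n, τ.arr aVis (4 * r + 2) = 1) ∧
      ∀ x < 4 * I.n, τ.arr aVis x ≤ 1 := by
  have hB := hR.lin
  have harcs : I.arcs = 2 * I.m + I.n := rfl
  refine (Tr.phaseReset hR hσ).seq (T₂ := 70 * (5 * I.n + 2 * I.arcs + 1) +
    (I.n * 20 + 6 + (4 * I.n * 50 + 10))) (fun τ₁ h₁ hf₁ => ?_) (by omega)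
  have hσ₁ := hσ.of_frame hf₁ rfl
  have he₁ : τ₁.arr aEn = σ.arr aEn := hf₁.arr _ rfl
  refine (Tr.bfs (n := I.n) (H := 2 * I.arcs) (J := fun _ => True) (by omega) (by omega) (by omega)
    (bfsStable_true _ _ _ _ _ _ _) hσ₁.links (hσ₁.src_lt hI) (hσ₁.dst_lt hI) (he₁ ▸ hb.le_one)
    hσ₁.n rfl rfl rfl he₁ (fun x hx => (h₁ x hx).1) trivial).seq
    (fun τ₂ h₂ hf₂ => ?_)
  obtain ⟨ht, hcl, hseed, -⟩ := h₂
  have hσ₂ := hσ₁.of_frame hf₂ rfl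
  have he₂ : τ₂.arr aEn = σ.arr aEn := by rw [hf₂.arr _ rfl, he₁]
  have ho₂ : τ₂.arr aOnp = τ₁.arr aOnp := hf₂.arr _ rfl
  refine (Tr.phaseMark hR hσ₂ ht.le (by rw [ho₂]; exact fun x hx => (h₁ x hx).2)).seq
    (fun τ₃ h₃ hf₃ => ?_)
  have hσ₃ := hσ₂.of_frame hf₃ rfl
  have he₃ : τ₃.arr aEn = σ.arr aEn := by rw [hf₃.arr _ rfl, he₂]
  have hv₃ : τ₃.arr aVis = τ₂.arr aVis := hf₃.arr _ rfl
  refine (Tr.phaseFlip (st := st) (k := k) hI hR hσ₃ (by rw [he₃]; exact hb) (by rw [he₃]; exact hk) ?_ ?_).conseq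
    le_rfl ?_
  · rw [he₃, hv₃, hf₃.arr aSrc rfl, hf₃.arr aDst rfl, hf₃.arr aPar rfl, hf₃.arr aQ rfl,
      hf₃.var vTail rfl, hf₂.arr aSrc rfl, hf₂.arr aDst rfl]
    exact ht
  · rw [hv₃]
    exact h₃
  · rintro τ ⟨h4, h5⟩ hf
    have hv : τ.arr aVis = τ₂.arr aVis := by rw [hf.arr _ rfl, hv₃]
    rw [hv₃] at h5
    rw [hv]
    refine ⟨h4, h5, Inst.Closed.of_half fun a ha h6 h7 => ?_, fun r hr => by simpa using hseed r hr,
      ht.le⟩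
    rw [← hσ₁.dst a ha]
    refine hcl a ha h6 ?_
    rw [hσ₁.src a ha]
    exact h7

end phase

end OddCycleTransversal

namespace OddCycleTransversal

open Finset

notation "aDig" => (22 : ℕ)
notation "aSt" => (23 : ℕ)
notation "aDel" => (24 : ℕ)
notation "aSol" => (25 : ℕ)

lemma eqN_eq (x y : ℕ) : eqN x y = if x = y then 1 else 0 := rfl

/-- Replacing the postcondition by a variable keeps simplification of the precondition from
unfolding it. -/
lemma Tr.wp_intro {B : ℕ} {p : Prog} {σ : Memory} {Q : Memory → Prop}
    (h : ∀ R : Memory → Prop, (∀ υ, Q υ → R υ) → p.wp B R σ) : Tr B p p.size σ Q :=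
  Tr.of_wp (h Q fun _ h => h)

/-! ### States of the internal vertices and what one round must deliver -/

namespace Inst

variable (I : Inst)

/-- The states of the internal vertices: the digit at the depth of the vertex, or deleted if that
colour is in conflict with the state of a vertex above. -/
def IsState (dig st : ℕ → ℕ) : Prop := ∀ v < I.n,
  ((∃ i < I.m, I.lo i = v ∧ ¬ I.Same i ∧ st (I.up i) = dig (I.dep v)) → st v = 0) ∧
  (¬ (∃ i < I.m, I.lo i = v ∧ ¬ I.Same i ∧ st (I.up i) = dig (I.dep v)) → st v = dig (I.dep v))

/-- What the phases have found out about the bags after `p` rounds. -/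
structure Good (st side : ℕ → ℕ) (p : ℕ) (vis : ℕ → ℕ) : Prop where
  src : ∀ r < I.n, vis (4 * r + 2) = 1
  le : ∀ x < 4 * I.n, vis x ≤ 1
  big : ∀ r < I.n, vis (4 * r + 3) = 1 → ∀ σ, I.Feas st r σ → p ≤ I.dels r σ
  opt : ∀ r < I.n, vis (4 * r + 3) ≠ 1 → ∀ σ, I.Feas st r σ →
    I.dels r (I.cutColour st side vis) ≤ I.dels r σ

/-- `raw` extends the states `st` to the bags of leaves, with few deletions. -/
structure Raw (st raw : ℕ → ℕ) : Prop where
  le : ∀ v < I.n, raw v ≤ 2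
  inner : ∀ v < I.n, I.dep v < I.rl v → raw v = st v
  same : ∀ i < I.m, I.Same i → Okc (raw (I.up i)) (raw (I.lo i))
  above : ∀ i < I.m, I.rl (I.lo i) = I.dep (I.lo i) → ¬ I.Same i →
    Okc (st (I.up i)) (raw (I.lo i))
  opt : ∀ r < I.n, I.rl r = I.dep r → I.rep r = r → ∀ σ, I.Feas st r σ → I.dels r σ ≤ I.D →
    I.dels r raw ≤ I.dels r σ

variable {I} {dig st : ℕ → ℕ}

lemma IsState.or (h : I.IsState dig st) {v : ℕ} (hv : v < I.n) :
    st v = 0 ∨ st v = dig (I.dep v) := by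
  by_cases hc : ∃ i < I.m, I.lo i = v ∧ ¬ I.Same i ∧ st (I.up i) = dig (I.dep v)
  · exact .inl ((h v hv).1 hc)
  · exact .inr ((h v hv).2 hc)

lemma Valid.dep_le_D (h : I.Valid) {v : ℕ} (hv : v < I.n) : I.dep v ≤ I.D := by
  have := h.rl_le v hv
  rcases h.rl_or v hv with h | h <;> omega

lemma Room.idx_lt {B : ℕ} (h : I.Room B) {i v : ℕ} (hi : i ≤ I.D + 2) (hv : v < I.n) :
    i * I.n + v < B := by
  have h1 := h.idx
  have h2 : i * I.n ≤ (I.D + 2) * I.n := Nat.mul_le_mul_right _ hi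
  have h3 : (I.D + 3) * I.n = (I.D + 2) * I.n + I.n := by ring
  omega

lemma idx_inj {n i j v w : ℕ} (hv : v < n) (hw : w < n) : i * n + v = j * n + w ↔ i = j ∧ v = w := by
  constructor
  · intro h
    have h1 : (i * n + v) / n = i := by
      rw [mul_comm, Nat.mul_add_div (by omega), Nat.div_eq_of_lt hv, add_zero]
    have h2 : (j * n + w) / n = j := by
      rw [mul_comm, Nat.mul_add_div (by omega), Nat.div_eq_of_lt hw, add_zero]
    rw [h, h2] at h1
    subst h1
    exact ⟨rfl, by omega⟩
  · rintro ⟨rfl, rfl⟩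
    rfl

end Inst

/-! ### The states of the internal vertices -/

def stateInit : Prog := forP vI vN (.store aSt (.var vI) (.read aDig (.read aDep (.var vI))))

def stateBody : Prog :=
  .ite (.eq (.read aDep (.read aLo (.var vI))) (.var vJ))
    (.ite (.lt (.read aDep (.read aUp (.var vI))) (.var vJ))
      (.ite (.eq (.read aSt (.read aUp (.var vI))) (.read aSt (.read aLo (.var vI))))
        (.store aSt (.read aLo (.var vI)) 0)
        .skip)
      .skip)
    .skip

def stateProg : Prog := stateInit ;; forP vJ vD1 (forP vI vM stateBody)

section programs

variable {I : Inst} {side st dig : ℕ → ℕ} {B : ℕ} {σ : Memory}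

lemma Tr.stateInit (hI : I.Valid) (hR : I.Room B) (hσ : Static I side σ)
    (hd : ∀ i ≤ I.D, σ.arr aDig i ≤ 2) :
    Tr B stateInit (I.n * 14 + 6) σ fun τ => ∀ v < I.n, τ.arr aSt v = σ.arr aDig (I.dep v) := by
  have hB := hR.lin
  refine Tr.forP (T := 6) (fun k τ => ∀ v < k, τ.arr aSt v = σ.arr aDig (I.dep v)) rfl rfl
    hσ.n (by omega) (by simp) fun k τ hk hf hv h => ?_
  have hD := hI.dep_le_D hk
  have h2 := hd _ hD
  refine (Tr.of_wp ?_).conseq (by decide) (fun _ h _ => h)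
  simp only [Prog.wp]
  simp [hv, (hσ.of_frame hf rfl).dep, hf.arr aDig rfl]
  refine ⟨by omega, fun x hx => ?_⟩
  split_ifs with e
  · rw [e]
  · exact h x (by omega)

/-- One pass over the edges per depth. A state depends only on states at smaller depths, which are
final when the pass begins, and vertices not yet treated hold their digit. The body compares with
the current state of the lower end instead of its digit; this makes a difference only if that vertex
has already been deleted, and then either outcome is right. -/
lemma Tr.stateProg (hI : I.Valid) (hR : I.Room B) (hσ : Static I side σ)
    (hd : ∀ i ≤ I.D, σ.arr aDig i ≤ 2) :
    Tr B stateProg (I.n * 14 + (I.D + 1) * (I.m * 40 + 20) + 20) σ fun τ =>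
      I.IsState (σ.arr aDig) (τ.arr aSt) := by
  have hB := hR.lin
  refine (Tr.stateInit hI hR hσ hd).seq (T₂ := (I.D + 1) * (I.m * 38 + 6 + 8) + 6)
    (fun τ₁ h₁ hf₁ => ?_) (by nlinarith)
  have hσ₁ := hσ.of_frame hf₁ rfl
  set dig := σ.arr aDig
  refine (Tr.forP (I := fun l τ => (∀ v < I.n, I.dep v < l →
      ((∃ i < I.m, I.lo i = v ∧ ¬ I.Same i ∧ τ.arr aSt (I.up i) = dig (I.dep v)) → τ.arr aSt v = 0) ∧
      (¬ (∃ i < I.m, I.lo i = v ∧ ¬ I.Same i ∧ τ.arr aSt (I.up i) = dig (I.dep v)) →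
        τ.arr aSt v = dig (I.dep v))) ∧
      (∀ v < I.n, l ≤ I.dep v → τ.arr aSt v = dig (I.dep v)) ∧ ∀ v < I.n, τ.arr aSt v ≤ 2)
    rfl rfl hσ₁.D1 (by omega) ⟨by simp, by simpa using h₁, ?_⟩ ?_).conseq le_rfl ?_
  · intro v hv
    simp [h₁ v hv]
    exact hd _ (hI.dep_le_D hv)
  · rintro l τ₂ hl hf₂ hv₂ ⟨ha, hb, hc⟩
    have hσ₂ := hσ₁.of_frame hf₂ rfl
    -- Conflicts in this pass are measured against `τ₂`, the memory at its start, since the pass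
    -- does not touch the other depths.
    refine (Tr.forP (T := 30) (I := fun k τ => (∀ v < I.n, I.dep v ≠ l → τ.arr aSt v = τ₂.arr aSt v) ∧
      (∀ v < I.n, I.dep v = l →
        ((∃ i < k, I.lo i = v ∧ ¬ I.Same i ∧ τ₂.arr aSt (I.up i) = dig l) → τ.arr aSt v = 0) ∧
        (¬ (∃ i < k, I.lo i = v ∧ ¬ I.Same i ∧ τ₂.arr aSt (I.up i) = dig l) →
        τ.arr aSt v = dig l)) ∧ ∀ v < I.n, τ.arr aSt v ≤ 2)
      rfl rfl hσ₂.m (by omega) ⟨by simp, ?_, by simpa using hc⟩ ?_).conseq le_rfl ?_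
    · intro v hv hvl
      have := hb v hv (by omega)
      simp [this, hvl]
    · rintro k τ₃ hk hf₃ hv₃ ⟨h1, h2, h3⟩
      have hσ₃ := hσ₂.of_frame hf₃ rfl
      have hj : τ₃.var vJ = l := by rw [hf₃.var _ rfl, hv₂]
      have hu := hI.up_lt k hk
      have hw := hI.lo_lt k hk
      have hdu := hI.dep_le_D hu
      have hdw := hI.dep_le_D hw
      have hsu := h3 _ hu
      have hsw := h3 _ hw
      have hcong : ∀ v, (∃ i < k + 1, I.lo i = v ∧ ¬ I.Same i ∧ τ₂.arr aSt (I.up i) = dig l) ↔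
          (∃ i < k, I.lo i = v ∧ ¬ I.Same i ∧ τ₂.arr aSt (I.up i) = dig l) ∨
          (I.lo k = v ∧ ¬ I.Same k ∧ τ₂.arr aSt (I.up k) = dig l) := by
        intro v
        constructor
        · rintro ⟨i, hi, h⟩
          rcases Nat.lt_succ_iff_lt_or_eq.1 hi with h' | rfl
          · exact .inl ⟨i, h', h⟩
          · exact .inr h
        · rintro (⟨i, hi, h⟩ | h)
          · exact ⟨i, by omega, h⟩
          · exact ⟨k, by omega, h⟩
      have hskip : (I.dep (I.lo k) = l → ¬ I.Same k → τ₂.arr aSt (I.up k) = dig l →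
          τ₃.arr aSt (I.lo k) = 0) → ∀ v < I.n, I.dep v = l →
        ((∃ i < k + 1, I.lo i = v ∧ ¬ I.Same i ∧ τ₂.arr aSt (I.up i) = dig l) → τ₃.arr aSt v = 0) ∧
        (¬ (∃ i < k + 1, I.lo i = v ∧ ¬ I.Same i ∧ τ₂.arr aSt (I.up i) = dig l) →
        τ₃.arr aSt v = dig l) := by
        intro hh v hv hvl
        rw [hcong]
        refine ⟨?_, fun h => (h2 v hv hvl).2 (fun h' => h (.inl h'))⟩
        rintro (h | ⟨rfl, h4, h5⟩)
        · exact (h2 v hv hvl).1 h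
        · exact hh hvl h4 h5
      refine (Tr.of_wp (p := stateBody) ?_).conseq (by decide) (fun _ h _ => h)
      simp only [stateBody, Prog.wp]
      simp only [Expr.fits_read, Expr.fits_var, Expr.eval_var, Expr.eval_read, hv₃, hj, hσ₃.up,
        hσ₃.lo, hσ₃.dep, show 1 < B by omega, Expr.fits_eq, Expr.fits_lt, Expr.eval_eq,
        Expr.eval_lt, eqN_eq_zero, ltN_eq_zero, ne_eq, not_not, not_le, Memory.arr_setVar,
        Memory.arr_setArr, if_true, Expr.fits_zero, Expr.eval_zero]
      refine ⟨by omega, fun h4 => ⟨by omega, fun h5 => ⟨by omega, fun h6 => ⟨by omega, ?_, ?_, ?_⟩,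
        fun h6 => ⟨h1, hskip fun _ _ h8 => ?_, h3⟩⟩, fun h5 => ⟨h1, hskip fun h7 h8 => absurd ?_ h8, h3⟩⟩,
        fun h4 => ⟨h1, hskip fun h7 => absurd h7 h4, h3⟩⟩
      · intro v hv hvl
        rw [if_neg (by rintro rfl; exact hvl h4)]
        exact h1 v hv hvl
      · intro v hv hvl
        have hs : ¬ I.Same k := by unfold Inst.Same; omega
        have e : τ₃.arr aSt (I.up k) = τ₂.arr aSt (I.up k) := h1 _ hu (by omega)
        by_cases hvk : v = I.lo k
        · subst hvk
          simp only [if_true]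
          refine ⟨fun _ => trivial, fun hn => ?_⟩
          have h7 := (h2 _ hw hvl).2 (fun ⟨i, hi, h⟩ => hn ⟨i, by omega, h⟩)
          exact absurd ⟨k, by omega, rfl, hs, by rw [← e, h6, h7]⟩ hn
        · simp only [hvk, if_false]
          refine ⟨fun ⟨i, hi, h⟩ => (h2 v hv hvl).1 ⟨i, ?_, h⟩,
            fun h => (h2 v hv hvl).2 fun ⟨i, hi, h'⟩ => h ⟨i, by omega, h'⟩⟩
          rcases Nat.lt_succ_iff_lt_or_eq.1 hi with h' | rfl
          · exact h'
          · exact absurd h.1.symm hvk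
      · intro v hv
        split_ifs
        · omega
        · exact h3 v hv
      · have e : τ₃.arr aSt (I.up k) = τ₂.arr aSt (I.up k) := h1 _ hu (by omega)
        by_contra h9
        refine h6 ?_
        rw [e, h8]
        by_contra hne
        refine h9 ((h2 _ hw h4).1 ?_)
        by_contra hno
        exact hne ((h2 _ hw h4).2 hno).symm
      · have := hI.dep_le k hk
        unfold Inst.Same
        omega
    · rintro τ₃ ⟨h1, h2, h3⟩ hf
      simp only [Memory.arr_setVar]
      refine ⟨fun v hv hvl => ?_, fun v hv hvl => ?_, h3⟩
      -- The upper ends in question have depth below `l`, so the pass has not changed their states.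
      · have e : ∀ i < I.m, I.lo i = v → ¬ I.Same i →
            τ₃.arr aSt (I.up i) = τ₂.arr aSt (I.up i) := by
          rintro i hi rfl hs
          refine h1 _ (hI.up_lt i hi) ?_
          have := hI.dep_le i hi
          unfold Inst.Same at hs
          omega
        have e' : (∃ i < I.m, I.lo i = v ∧ ¬ I.Same i ∧ τ₃.arr aSt (I.up i) = dig (I.dep v)) ↔
            (∃ i < I.m, I.lo i = v ∧ ¬ I.Same i ∧ τ₂.arr aSt (I.up i) = dig (I.dep v)) := by
          constructor
          · rintro ⟨i, hi, h4, h5, h6⟩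
            exact ⟨i, hi, h4, h5, by rw [← h6, e i hi h4 h5]⟩
          · rintro ⟨i, hi, h4, h5, h6⟩
            exact ⟨i, hi, h4, h5, by rw [← h6, e i hi h4 h5]⟩
        rw [e']
        by_cases h : I.dep v = l
        · rw [h]
          exact h2 v hv h
        · rw [h1 v hv h]
          exact ha v hv (by omega)
      · rw [h1 v hv (by omega)]
        exact hb v hv (by omega)
  · rintro τ ⟨h1, -, -⟩ - v hv
    exact h1 v hv (by have := hI.dep_le_D hv; omega)

/-! ### The minimum cuts of the bags -/

def enableProg : Prog :=
  forP vI vM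
    (.store aEn (4 * .var vI + 1) 0 ;;
     .store aEn (4 * .var vI + 3) 0 ;;
     .ite (.eq (.read aDep (.read aUp (.var vI))) (.read aDep (.read aLo (.var vI))))
      (.store aEn (4 * .var vI) 1 ;; .store aEn (4 * .var vI + 2) 1)
      (.store aEn (4 * .var vI)
        (.eq (.read aSt (.read aUp (.var vI)) + .read aSide (.read aLo (.var vI))) 2) ;;
       .store aEn (4 * .var vI + 2)
        (.eq (.read aSt (.read aUp (.var vI))) (.read aSide (.read aLo (.var vI)) + 1)))) ;;
  forP vI vN
    (.store aEn (4 * .var vM + 2 * .var vI) 1 ;;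
     .store aEn (4 * .var vM + 2 * .var vI + 1) 0)

/-- Edge `i` owns the half arcs `4 * i` to `4 * i + 3`, and vertex `v` owns the two from `4 * I.m +
2 * v` on. All reversed halves are off, so the initial flow is zero. -/
lemma Tr.enableProg (hI : I.Valid) (hR : I.Room B) (hσ : Static I side σ) (hs : I.Sides side)
    (hst : ∀ v < I.n, σ.arr aSt v ≤ 2) :
    Tr B enableProg (100 * (I.n + I.m + 1)) σ fun τ => I.Bits (σ.arr aSt) side (τ.arr aEn) ∧
      I.Flow (τ.arr aEn) fun _ => 0 := by
  have hB := hR.lin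
  set st := σ.arr aSt
  refine (Tr.forP (T := 60) (I := fun k τ => ∀ i < k, τ.arr aEn (4 * i) = I.act st side (2 * i) ∧
    τ.arr aEn (4 * i + 1) = 0 ∧ τ.arr aEn (4 * i + 2) = I.act st side (2 * i + 1) ∧
    τ.arr aEn (4 * i + 3) = 0) rfl rfl hσ.m (by omega) (by simp) ?_).seq (T₂ := I.n * (20 + 8) + 6)
    ?_ (by omega)
  · rintro k τ hk hf hv h
    have hσ' := hσ.of_frame hf rfl
    have hu := hI.up_lt k hk
    have hw := hI.lo_lt k hk
    have hdu := hI.dep_le_D hu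
    have hdw := hI.dep_le_D hw
    have hsu := hst _ hu
    have hsw := hs.le _ hw
    have hst' : τ.arr aSt = st := hf.arr _ rfl
    have l1 := eqN_le (st (I.up k) + side (I.lo k)) 2
    have l2 := eqN_le (st (I.up k)) (side (I.lo k) + 1)
    refine (Tr.wp_intro fun R hR => ?_).conseq (by decide) (fun _ h _ => h)
    simp only [Prog.wp]
    simp [hv, hσ'.up, hσ'.lo, hσ'.dep, hσ'.side, hst', show 1 < B by omega]
    refine ⟨by omega, by omega, by omega, fun h4 => ⟨by omega, by omega, hR _ fun i hi => ?_⟩,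
      fun h4 => ⟨by omega, by omega, hR _ fun i hi => ?_⟩⟩
    · by_cases hik : i = k
      · subst hik
        rw [Inst.act_even _ _ hk, Inst.act_odd _ _ hk, if_pos (show I.Same i from h4),
          if_pos (show I.Same i from h4)]
        simp
      · have := h i (by omega)
        simp [hik, this, show 4 * i ≠ 4 * k + 2 by omega, show 4 * i ≠ 4 * k + 3 by omega,
          show 4 * i ≠ 4 * k + 1 by omega, show 4 * i + 1 ≠ 4 * k + 2 by omega,
          show 4 * i + 1 ≠ 4 * k by omega, show 4 * i + 2 ≠ 4 * k + 3 by omega,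
          show 4 * i + 2 ≠ 4 * k + 1 by omega, show 4 * i + 2 ≠ 4 * k by omega,
          show 4 * i + 1 ≠ 4 * k + 3 by omega]
        omega
    · by_cases hik : i = k
      · subst hik
        rw [Inst.act_even _ _ hk, Inst.act_odd _ _ hk, if_neg (show ¬ I.Same i from h4),
          if_neg (show ¬ I.Same i from h4)]
        simp [eqN_eq]
      · have := h i (by omega)
        simp [hik, this, show 4 * i ≠ 4 * k + 2 by omega, show 4 * i ≠ 4 * k + 3 by omega,
          show 4 * i ≠ 4 * k + 1 by omega, show 4 * i + 1 ≠ 4 * k + 2 by omega,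
          show 4 * i + 1 ≠ 4 * k by omega, show 4 * i + 2 ≠ 4 * k + 3 by omega,
          show 4 * i + 2 ≠ 4 * k + 1 by omega, show 4 * i + 2 ≠ 4 * k by omega,
          show 4 * i + 1 ≠ 4 * k + 3 by omega]
        omega
  · intro τ₁ h₁ hf₁
    have hσ₁ := hσ.of_frame hf₁ rfl
    refine (Tr.forP (T := 20) (I := fun k τ => (∀ a < 4 * I.m, τ.arr aEn a = τ₁.arr aEn a) ∧
      ∀ v < k, τ.arr aEn (4 * I.m + 2 * v) = 1 ∧ τ.arr aEn (4 * I.m + 2 * v + 1) = 0) rfl rfl hσ₁.n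
      (by omega) (by simp) ?_).conseq le_rfl ?_
    · rintro k τ hk hf hv ⟨h0, h⟩
      have hσ' := hσ₁.of_frame hf rfl
      refine (Tr.of_wp ?_).conseq (by decide) (fun _ h _ => h)
      simp only [Prog.wp]
      simp [hv, hσ'.m]
      refine ⟨by omega, by omega, fun a ha => ?_, fun v hv => ?_⟩
      · rw [if_neg (by omega), if_neg (by omega)]
        exact h0 a ha
      · by_cases hvk : v = k
        · simp [hvk]
        · have := h v (by omega)
          simp [hvk, this, show 4 * I.m + 2 * v + 1 ≠ 4 * I.m + 2 * k by omega,
            show 4 * I.m + 2 * v ≠ 4 * I.m + 2 * k + 1 by omega]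
    · rintro τ ⟨h2, h3⟩ -
      have key : ∀ a < I.arcs, τ.arr aEn (2 * a) = I.act st side a ∧ τ.arr aEn (2 * a + 1) = 0 := by
        intro a ha
        refine Inst.arc_cases (P := fun a => τ.arr aEn (2 * a) = I.act st side a ∧
          τ.arr aEn (2 * a + 1) = 0) (fun i hi => ?_) (fun i hi => ?_) (fun v hv => ?_) ha
        · have := h₁ i hi
          rw [show 2 * (2 * i) = 4 * i by ring, h2 _ (by omega), h2 _ (by omega)]
          exact ⟨this.1, this.2.1⟩
        · have := h₁ i hi
          rw [show 2 * (2 * i + 1) = 4 * i + 2 by ring, h2 _ (by omega), h2 _ (by omega)]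
          exact ⟨this.2.2.1, this.2.2.2⟩
        · have := h3 v hv
          rw [show 2 * (2 * I.m + v) = 4 * I.m + 2 * v by ring, Inst.act_vertex]
          exact this
      refine ⟨fun a ha => ?_, fun w => ?_⟩
      · rw [(key a ha).1, (key a ha).2, add_zero]
      · simp only [Inst.net, Nat.cast_zero, zero_mul, sum_const_zero]
        refine sum_eq_zero fun a ha => ?_
        rw [(key a (mem_range.1 ha)).2]
        simp

def flowProg : Prog := forP vJ vD1 phase

/-- After `p` phases each bag either has flow exactly `p` or possesses a feasible colouring with no
more deletions than its flow. The second case is permanent: by weak duality its flow cannot grow any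
more. Thus a sink that is still reached in the last phase certifies that the bag needs at least `D +
1` deletions. -/
lemma Tr.flowProg (hI : I.Valid) (hR : I.Room B) (hσ : Static I side σ) (hs : I.Sides side)
    (hb : I.Bits st side (σ.arr aEn)) (hk : I.Flow (σ.arr aEn) fun _ => 0) :
    Tr B flowProg ((I.D + 1) * (1000 * (I.n + I.m + 1) + 8) + 6) σ fun τ =>
      I.Bits st side (τ.arr aEn) ∧ I.Good st side (I.D + 1) (τ.arr aVis) := by
  have hB := hR.lin
  refine (Tr.forP (I := fun p τ => I.Bits st side (τ.arr aEn) ∧ (∃ k, I.Flow (τ.arr aEn) k ∧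
    ∀ r < I.n, k r = p ∨ ∃ σ', I.Feas st r σ' ∧ I.dels r σ' ≤ k r) ∧
    (0 < p → I.Good st side p (τ.arr aVis))) rfl rfl hσ.D1 (by omega)
    ⟨hb, ⟨_, hk, fun _ _ => .inl rfl⟩, by simp⟩ ?_).conseq le_rfl ?_
  · rintro p τ hp hf hv ⟨hb, ⟨k, hk, hst⟩, -⟩
    have hσ' := hσ.of_frame hf rfl
    refine (Tr.phase hI hR hσ' hb hk).conseq le_rfl ?_
    rintro υ ⟨hb', hk', hcl, hsrc, hle⟩ -
    simp only [Memory.arr_setVar]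
    have hopt : ∀ r < I.n, υ.arr aVis (4 * r + 3) ≠ 1 →
        I.dels r (I.cutColour st side (υ.arr aVis)) ≤ k r := fun r hr hv =>
      hk.dels_le hI hs hb hr hcl (hsrc r hr) hv
    -- A bag whose flow was already matched by a colouring cannot have been augmented, because the
    -- new flow would exceed the deletions of that colouring.
    have hbig : ∀ r < I.n, υ.arr aVis (4 * r + 3) = 1 → k r = p := by
      intro r hr hv
      rcases hst r hr with h | ⟨σ', h1, h2⟩
      · exact h
      · have := hk'.le_dels hI hs hb' hr h1
        simp only [hv, if_true] at this
        omega
    refine ⟨hb', ⟨_, hk', fun r hr => ?_⟩, fun _ => ⟨hsrc, hle, fun r hr hv σ' hσ' => ?_,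
      fun r hr hv σ' hσ' => ?_⟩⟩
    · by_cases hv : υ.arr aVis (4 * r + 3) = 1
      · left
        simp [hv, hbig r hr hv]
      · right
        refine ⟨_, Inst.cutColour_feas hI hs hsrc r, ?_⟩
        simpa [hv] using hopt r hr hv
    · have := hk'.le_dels hI hs hb' hr hσ'
      simp only [hv, if_true, hbig r hr hv] at this
      exact this
    · exact (hopt r hr hv).trans (hk.le_dels hI hs hb hr hσ')
  · rintro τ ⟨h1, -, h2⟩ -
    exact ⟨h1, h2 (by omega)⟩

/-! ### Turning the visited sets into deletions and colours -/

def delInit : Prog := forP vI vN (.store aDel (.var vI)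
  (.read aVis (4 * .read aAnc (.read aDep (.var vI) * .var vN + .var vI) + 3)))

def delArcs : Prog := forP vI vArcs
  (.ite (.read aVis (.read aSrc (2 * .var vI)))
    (.ite (.read aVis (.read aDst (2 * .var vI))) .skip
      (.ite (.read aEn (2 * .var vI) + .read aEn (2 * .var vI + 1))
        (.store aDel (.read aOwn (.var vI)) 1) .skip))
    .skip)

lemma Tr.delProg (hI : I.Valid) (hR : I.Room B) (hσ : Static I side σ)
    (hb : I.Bits st side (σ.arr aEn)) {p : ℕ} (hg : I.Good st side p (σ.arr aVis)) :
    Tr B (delInit ;; delArcs) (100 * (I.n + I.m + 1)) σ fun τ =>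
      ∀ v < I.n, (τ.arr aDel v = 0 ↔ ¬ I.Del st side (σ.arr aVis) v) ∧ τ.arr aDel v ≤ 1 := by
  have hB := hR.lin
  have harcs : I.arcs = 2 * I.m + I.n := rfl
  set vis := σ.arr aVis
  refine (Tr.forP (T := 20) (I := fun k τ => ∀ v < k, τ.arr aDel v = vis (4 * I.rep v + 3)) rfl rfl
    hσ.n (by omega) (by simp) ?_).seq (T₂ := I.arcs * (30 + 8) + 6) ?_ (by omega)
  · intro k τ hk hf hv h
    have hσ' := hσ.of_frame hf rfl
    have hdk := hI.dep_le_D hk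
    have hidx := hR.idx_lt (i := I.dep k) (by omega) hk
    have hrep := hI.rep_lt hk
    have hvr := hg.le (4 * I.rep k + 3) (by omega)
    have ha : τ.arr aAnc (I.dep k * I.n + k) = I.rep k := by rw [hσ'.anc]; rfl
    have hvis : τ.arr aVis = vis := hf.arr _ rfl
    refine (Tr.of_wp ?_).conseq (by decide) (fun _ h _ => h)
    simp only [Prog.wp]
    simp [hv, hσ'.dep, hσ'.n, ha, hvis]
    refine ⟨by omega, fun v hv => ?_⟩
    split_ifs with e
    · rw [e]
    · exact h v (by omega)
  · intro τ₁ h₁ hf₁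
    have hσ₁ := hσ.of_frame hf₁ rfl
    refine (Tr.forP (T := 30) (I := fun k τ => ∀ v < I.n, (τ.arr aDel v = 0 ↔
      ¬ (vis (4 * I.rep v + 3) = 1 ∨ ∃ a < k, I.own a = v ∧ I.act st side a = 1 ∧
      vis (I.tl a) = 1 ∧ vis (I.hd a) ≠ 1)) ∧ τ.arr aDel v ≤ 1) rfl rfl hσ₁.arcs (by omega)
      ?_ ?_).conseq le_rfl (fun _ h _ => h)
    · intro v hv
      have := hg.le (4 * I.rep v + 3) (by have := hI.rep_lt hv; omega)
      simp [h₁ v hv]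
      omega
    · intro k τ hk hf hv h
      have hσ' := hσ₁.of_frame hf rfl
      have e1 : τ.arr aVis = vis := by rw [hf.arr _ rfl, hf₁.arr _ rfl]
      have e2 : τ.arr aEn = σ.arr aEn := by rw [hf.arr _ rfl, hf₁.arr _ rfl]
      have e3 : τ.arr aSrc (2 * k) = I.tl k := by
        rw [hσ'.src _ (by omega)]
        simp [Inst.hsrc]
      have e4 : τ.arr aDst (2 * k) = I.hd k := by
        rw [hσ'.dst _ (by omega)]
        simp [Inst.hdst]
      have e5 := hσ'.own k hk
      have l1 := hI.tl_lt hk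
      have l2 := hI.hd_lt hk
      have l3 := hI.own_lt hk
      have l4 := hg.le _ l1
      have l5 := hg.le _ l2
      -- The program tests the sum of both halves of the arc; by `Bits` this says whether the arc is
      -- present, regardless of the flow that it carries.
      have l6 := hb k hk
      have l7 := Inst.act_le (I := I) st side k
      have hskip : ¬ (I.act st side k = 1 ∧ vis (I.tl k) = 1 ∧ vis (I.hd k) ≠ 1) →
          ∀ v < I.n, (τ.arr aDel v = 0 ↔
      ¬ (vis (4 * I.rep v + 3) = 1 ∨ ∃ a < k + 1, I.own a = v ∧ I.act st side a = 1 ∧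
      vis (I.tl a) = 1 ∧ vis (I.hd a) ≠ 1)) ∧ τ.arr aDel v ≤ 1 := by
        intro hn v hv
        have e : (∃ a < k + 1, I.own a = v ∧ I.act st side a = 1 ∧
          vis (I.tl a) = 1 ∧ vis (I.hd a) ≠ 1) ↔ ∃ a < k, I.own a = v ∧ I.act st side a = 1 ∧
          vis (I.tl a) = 1 ∧ vis (I.hd a) ≠ 1 := by
          constructor
          · rintro ⟨a, ha, h1, h2⟩
            rcases Nat.lt_succ_iff_lt_or_eq.1 ha with h' | rfl
            · exact ⟨a, h', h1, h2⟩
            · exact absurd h2 hn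
          · rintro ⟨a, ha, h⟩
            exact ⟨a, by omega, h⟩
        rw [e]
        exact h v hv
      refine (Tr.of_wp ?_).conseq (by decide) (fun _ h _ => h)
      simp only [Prog.wp]
      simp only [Expr.fits_read, Expr.fits_mul, Expr.fits_ofNat, Expr.fits_var, Expr.eval_mul,
        Expr.eval_ofNat, Expr.eval_var, Expr.eval_read, hv, e1, e2, e3, e4, e5, Expr.fits_add,
        Expr.eval_add, Expr.fits_one, Expr.eval_one, Memory.arr_setVar, Memory.arr_setArr,
        if_true]
      refine ⟨by omega, fun h1 => ⟨by omega, fun h2 => hskip (by omega), fun h2 => ⟨by omega,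
        fun h3 => ⟨by omega, fun v hv => ?_⟩, fun h3 => hskip (by omega)⟩⟩, fun h1 => hskip (by omega)⟩
      by_cases hvo : v = I.own k
      · subst hvo
        simp only [if_true, one_ne_zero, false_iff, not_not, le_refl, and_true]
        exact .inr ⟨k, by omega, rfl, by omega, by omega, by omega⟩
      · simp only [hvo, if_false]
        have e : (∃ a < k + 1, I.own a = v ∧ I.act st side a = 1 ∧
          vis (I.tl a) = 1 ∧ vis (I.hd a) ≠ 1) ↔ ∃ a < k, I.own a = v ∧ I.act st side a = 1 ∧
          vis (I.tl a) = 1 ∧ vis (I.hd a) ≠ 1 := by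
          constructor
          · rintro ⟨a, ha, q1, q2⟩
            rcases Nat.lt_succ_iff_lt_or_eq.1 ha with h' | h'
            · exact ⟨a, h', q1, q2⟩
            · subst h'
              exact absurd q1.symm hvo
          · rintro ⟨a, ha, h⟩
            exact ⟨a, by omega, h⟩
        rw [e]
        exact h v hv

/-- Write the states and colours to the level of the table that belongs to the vertex. -/
def rawProg : Prog := forP vI vN
  (.ite (.lt (.read aDep (.var vI)) (.read aRl (.var vI)))
    (.store aSol (.read aRl (.var vI) * .var vN + .var vI) (.read aSt (.var vI)))
    (.ite (.read aDel (.var vI))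
      (.store aSol (.read aRl (.var vI) * .var vN + .var vI) 0)
      (.ite (.read aVis (4 * .var vI + 1))
        (.store aSol (.read aRl (.var vI) * .var vN + .var vI) (.read aSide (.var vI) + 1))
        (.store aSol (.read aRl (.var vI) * .var vN + .var vI) (2 - .read aSide (.var vI))))))

open Classical in
-- Each vertex is written to the row of its own level only, so the solutions remembered in the rows
-- of smaller levels survive the round.
lemma Tr.rawProg (hI : I.Valid) (hR : I.Room B) (hσ : Static I side σ) (hs : I.Sides side)
    {p : ℕ} (hg : I.Good st side p (σ.arr aVis)) (hst : σ.arr aSt = st) (hst2 : ∀ v < I.n, st v ≤ 2)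
    (hdel : ∀ v < I.n, (σ.arr aDel v = 0 ↔ ¬ I.Del st side (σ.arr aVis) v) ∧ σ.arr aDel v ≤ 1) :
    Tr B rawProg (I.n * 60 + 6) σ fun τ => ∀ v < I.n, ∀ i, τ.arr aSol (i * I.n + v) =
      if i = I.rl v then
        if I.dep v < I.rl v then st v else I.cutColour st side (σ.arr aVis) v
      else σ.arr aSol (i * I.n + v) := by
  have hB := hR.lin
  set vis := σ.arr aVis
  refine (Tr.forP (T := 52) (I := fun k τ => ∀ v < I.n, ∀ i, τ.arr aSol (i * I.n + v) =
      if i = I.rl v ∧ v < k then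
        if I.dep v < I.rl v then st v else I.cutColour st side (σ.arr aVis) v
      else σ.arr aSol (i * I.n + v)) rfl rfl hσ.n (by omega) (by simp) ?_).conseq (by omega) ?_
  · intro k τ hk hf hv h
    have hσ' := hσ.of_frame hf rfl
    have hdk := hI.dep_le_D hk
    have hrk := hI.rl_le k hk
    have hidx := hR.idx_lt (i := I.rl k) (by omega) hk
    have e1 : τ.arr aVis = vis := hf.arr _ rfl
    have e2 : τ.arr aDel = σ.arr aDel := hf.arr _ rfl
    have e3 : τ.arr aSt = st := by rw [hf.arr _ rfl, hst]
    have l1 := hg.le (4 * k + 1) (by omega)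
    have l2 := hs.le k hk
    have l3 := hst2 k hk
    obtain ⟨l4, l5⟩ := hdel k hk
    have key : ∀ c, c = (if I.dep k < I.rl k then st k else I.cutColour st side vis k) →
        ∀ v < I.n, ∀ i, (if i * I.n + v = I.rl k * I.n + k then c else τ.arr aSol (i * I.n + v)) =
      if i = I.rl v ∧ v < k + 1 then
        if I.dep v < I.rl v then st v else I.cutColour st side vis v
      else σ.arr aSol (i * I.n + v) := by
      rintro c rfl v hvn i
      simp only [Inst.idx_inj hvn hk]
      by_cases hvk : v = k
      · subst hvk
        by_cases hi : i = I.rl v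
        · simp [hi]
        · have := h v hvn i
          simp only [hi, false_and, if_false] at this ⊢
          exact this
      · have := h v hvn i
        have e : v < k + 1 ↔ v < k := by omega
        simp only [hvk, and_false, if_false, e]
        exact this
    refine (Tr.of_wp ?_).conseq (by decide) (fun _ h _ => h)
    simp only [Prog.wp]
    simp only [Expr.fits_read, Expr.fits_mul, Expr.fits_ofNat, Expr.fits_var, Expr.eval_mul,
      Expr.eval_ofNat, Expr.eval_var, Expr.eval_read, hv, e1, e2, e3, hσ'.dep, hσ'.rl, hσ'.n,
      hσ'.side, Expr.fits_add, true_and, show 1 < B by omega, Expr.fits_lt, Expr.eval_lt, ltN_eq_zero,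
      Expr.eval_sub, Expr.fits_sub, Expr.fits_zero, Expr.eval_zero, ne_eq, not_le,
      Expr.eval_add, Expr.fits_one, Expr.eval_one, Memory.arr_setVar, Memory.arr_setArr,
      if_true]
    refine ⟨by omega, fun h1 => ⟨by omega, key _ (by rw [if_pos h1])⟩, fun h1 => ⟨by omega,
      fun h2 => ⟨⟨by omega, hidx, show 0 < B by omega⟩, key _ ?_⟩, fun h2 => ⟨by omega, fun h3 => ⟨by omega, key _ ?_⟩,
      fun h3 => ⟨by omega, key _ ?_⟩⟩⟩⟩
    · have : I.Del st side vis k := by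
        by_contra hc
        exact h2 (l4.2 hc)
      simp [Inst.cutColour, this, not_lt.2 h1]
    · have : ¬ I.Del st side vis k := l4.1 h2
      simp [Inst.cutColour, this, not_lt.2 h1, show vis (4 * k + 1) = 1 by omega]
    · have : ¬ I.Del st side vis k := l4.1 h2
      simp [Inst.cutColour, this, not_lt.2 h1, show vis (4 * k + 1) ≠ 1 by omega]
  · intro τ h _ v hv i
    rw [h v hv i]
    simp only [hv, and_true]
    rfl

open Classical in
-- Optimality is required only against colourings with at most `D` deletions in the bag. If the sink
-- was reached in the last phase there are none; otherwise the cut colouring is a true minimum. On a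
-- leaf bag the mixed colouring coincides with the cut colouring.
lemma Inst.Good.raw (hI : I.Valid) (hs : I.Sides side) {vis : ℕ → ℕ}
    (hst : ∀ v < I.n, st v ≤ 2) (hg : I.Good st side (I.D + 1) vis) :
    I.Raw st fun v => if I.dep v < I.rl v then st v else I.cutColour st side vis v where
  le v hv := by
    split_ifs
    · exact hst v hv
    · exact cutColour_le hs hv
  inner v _ h := if_pos h
  same i hi h := by
    obtain ⟨h1, h2⟩ := hI.rl_same hi h
    have h3 : I.dep (I.up i) = I.dep (I.lo i) := h
    rw [if_neg (by omega), if_neg (by omega)]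
    exact cutColour_same hI hs hi h
  above i hi h1 h := by
    rw [if_neg (by omega)]
    exact cutColour_above hI hs hg.src hi h
  opt r hr hl hrr σ' hf hd := by
    have e : I.dels r (fun v => if I.dep v < I.rl v then st v else I.cutColour st side vis v) =
        I.dels r (I.cutColour st side vis) := by
      unfold dels
      congr 1
      refine filter_congr fun v hv => and_congr_right fun h => ?_
      have hv' := mem_range.1 hv
      have h1 := hI.rl_rep v hv'
      have h2 := hI.dep_rep hv'
      rw [h] at h1 h2
      simp only [show ¬ I.dep v < I.rl v by omega, if_false]
    rw [e]
    by_cases hv : vis (4 * r + 3) = 1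
    · have := hg.big r hr hv σ' hf
      omega
    · exact hg.opt r hr hv σ' hf

def evalProg : Prog := stateProg ;; enableProg ;; flowProg ;; (delInit ;; delArcs) ;; rawProg

/-- For given digits, compute the states and optimal colourings of the bags below them. -/
lemma Tr.evalProg (hI : I.Valid) (hR : I.Room B) (hσ : Static I side σ) (hs : I.Sides side)
    (hd : ∀ i ≤ I.D, σ.arr aDig i ≤ 2) :
    Tr B evalProg (2000 * ((I.D + 1) * (I.n + I.m + 1))) σ fun τ => ∃ st raw,
      I.IsState (σ.arr aDig) st ∧ I.Raw st raw ∧ ∀ v < I.n, ∀ i, τ.arr aSol (i * I.n + v) =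
        if i = I.rl v then raw v else σ.arr aSol (i * I.n + v) := by
  refine (Tr.stateProg hI hR hσ hd).seq (T₂ := 100 * (I.n + I.m + 1) +
    ((I.D + 1) * (1000 * (I.n + I.m + 1) + 8) + 6 + (100 * (I.n + I.m + 1) + (I.n * 60 + 6))))
    (fun τ₁ h₁ hf₁ => ?_) (by nlinarith)
  have hσ₁ := hσ.of_frame hf₁ rfl
  have hst : ∀ v < I.n, τ₁.arr aSt v ≤ 2 := by
    intro v hv
    have := hd _ (hI.dep_le_D hv)
    rcases h₁.or hv with h | h <;> omega
  refine (Tr.enableProg hI hR hσ₁ hs hst).seq (fun τ₂ h₂ hf₂ => ?_)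
  have hσ₂ := hσ₁.of_frame hf₂ rfl
  refine (Tr.flowProg hI hR hσ₂ hs h₂.1 h₂.2).seq (fun τ₃ h₃ hf₃ => ?_)
  have hσ₃ := hσ₂.of_frame hf₃ rfl
  refine (Tr.delProg hI hR hσ₃ h₃.1 h₃.2).seq (fun τ₄ h₄ hf₄ => ?_)
  have hσ₄ := hσ₃.of_frame hf₄ rfl
  have hv₄ : τ₄.arr aVis = τ₃.arr aVis := hf₄.arr _ rfl
  refine (Tr.rawProg hI hR hσ₄ hs (st := τ₁.arr aSt) (p := I.D + 1) (by rw [hv₄]; exact h₃.2)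
    ?_ hst (by rw [hv₄]; exact h₄)).conseq le_rfl ?_
  · rw [hf₄.arr _ rfl, hf₃.arr _ rfl, hf₂.arr _ rfl]
  · intro τ h hf
    refine ⟨τ₁.arr aSt, _, h₁, h₃.2.raw hI hs hst, fun v hv i => ?_⟩
    rw [h v hv i, hv₄, hf₄.arr aSol rfl, hf₃.arr aSol rfl, hf₂.arr aSol rfl, hf₁.arr aSol rfl]

end programs

end OddCycleTransversal

namespace OddCycleTransversal

open Finset

/-! ### Dynamic programming over the digits -/

namespace Inst

variable (I : Inst)

/-- `σ` is proper outside of the deleted vertices and deletes at most `D` vertices of each leaf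
bag. -/
structure Colouring (σ : ℕ → ℕ) : Prop where
  le : ∀ v < I.n, σ v ≤ 2
  ok : ∀ e < I.m, Okc (σ (I.up e)) (σ (I.lo e))
  cap : ∀ r < I.n, I.rl r = I.dep r → I.rep r = r → I.dels r σ ≤ I.D

/-- The number of deleted vertices in the bags below the one of `a`, which has depth `i`. -/
def cnt (i a : ℕ) (s : ℕ → ℕ) : ℕ :=
  #{v ∈ range I.n | i ≤ I.dep v ∧ I.anc v i = a ∧ s v = 0}

/-- `s` is proper on the vertices at level `t` or more, and fits to the states `st` of the vertices
at smaller levels. -/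
structure Sound (t : ℕ) (st s : ℕ → ℕ) : Prop where
  le : ∀ v < I.n, t ≤ I.rl v → s v ≤ 2
  ok : ∀ e < I.m, t ≤ I.rl (I.lo e) →
    Okc (if t ≤ I.rl (I.up e) then s (I.up e) else st (I.up e)) (s (I.lo e))

/-- Below each internal vertex of depth `i`, `s` is optimal among the colourings that follow the
digits above the vertex and give it a colour `< lim`. -/
structure Part (i lim : ℕ) (dig st s : ℕ → ℕ) : Prop where
  sound : 0 < lim → I.Sound (i + 1) st s
  opt : ∀ a < I.n, I.dep a = i → I.rl a = i + 1 → ∀ σ, I.Colouring σ →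
    (∀ j < i, σ (I.anc a j) = dig j) → σ a < lim → I.cnt i a s ≤ I.cnt i a σ

/-- Below each bag of depth `i`, `s` is optimal among the colourings that follow the digits above
the bag. -/
structure Full (i : ℕ) (dig st s : ℕ → ℕ) : Prop where
  sound : I.Sound i st s
  inner : ∀ v < I.n, I.rl v = i → I.dep v < i → s v = st v
  opt : ∀ g < I.n, I.dep g = i → I.rep g = g → ∀ σ, I.Colouring σ →
    (∀ j < i, σ (I.anc g j) = dig j) → I.cnt i g s ≤ I.cnt i g σ

variable {I} {dig dig' st st' raw s s' old cand σ : ℕ → ℕ} {i a lim : ℕ}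

lemma IsState.okc (h : I.IsState dig st) {e : ℕ} (hI : I.Valid) (he : e < I.m)
    (hs : ¬ I.Same e) : Okc (st (I.up e)) (st (I.lo e)) := by
  by_cases hc : ∃ i < I.m, I.lo i = I.lo e ∧ ¬ I.Same i ∧ st (I.up i) = dig (I.dep (I.lo e))
  · rw [(h _ (hI.lo_lt e he)).1 hc]
    unfold Okc
    omega
  · rw [(h _ (hI.lo_lt e he)).2 hc]
    exact .inr fun h' => hc ⟨e, he, rfl, hs, h'⟩

/-- States are determined from the top downwards, so changing digits at depth `i` and deeper leaves
the states above intact. This lets table rows survive the change of the digit string. -/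
lemma IsState.eq_of_agree (hI : I.Valid) (h : I.IsState dig st) (h' : I.IsState dig' st')
    (hd : ∀ j < i, dig j = dig' j) : ∀ v < I.n, I.dep v < i → st v = st' v := by
  have H : ∀ k, ∀ v < I.n, I.dep v = k → k < i → st v = st' v := by
    intro k
    induction k using Nat.strong_induction_on with
    | _ k ih =>
      intro v hv hk hki
      have e : (∃ i < I.m, I.lo i = v ∧ ¬ I.Same i ∧ st (I.up i) = dig (I.dep v)) ↔
          ∃ i < I.m, I.lo i = v ∧ ¬ I.Same i ∧ st' (I.up i) = dig' (I.dep v) := by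
        refine exists_congr fun e => and_congr_right fun he => and_congr_right fun hl =>
          and_congr_right fun hs => ?_
        have h1 := hI.dep_le e he
        have h2 : I.dep (I.up e) ≠ I.dep (I.lo e) := hs
        rw [hl] at h1 h2
        rw [ih (I.dep (I.up e)) (by omega) _ (hI.up_lt e he) rfl (by omega), hd _ (by omega)]
      by_cases hc : ∃ i < I.m, I.lo i = v ∧ ¬ I.Same i ∧ st (I.up i) = dig (I.dep v)
      · rw [(h v hv).1 hc, (h' v hv).1 (e.1 hc)]
      · rw [(h v hv).2 hc, (h' v hv).2 (fun hc' => hc (e.2 hc')), hd _ (by omega)]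
  exact fun v hv hvi => H _ v hv rfl hvi

/-- A colouring that follows the digits has the states. -/
lemma IsState.eq_colouring (hI : I.Valid) (h : I.IsState dig st) (hσ : I.Colouring σ)
    {g : ℕ} (hg : g < I.n) (hi : i ≤ I.dep g + 1) (hd : ∀ j < i, σ (I.anc g j) = dig j) :
    ∀ j < i, st (I.anc g j) = σ (I.anc g j) := by
  intro j
  induction j using Nat.strong_induction_on with
  | _ j ih =>
    intro hj
    have hv := hI.anc_lt g hg j (by omega)
    have hdv := hI.dep_anc g hg j (by omega)
    have hdj := hd j hj
    by_cases hc : ∃ i < I.m, I.lo i = I.anc g j ∧ ¬ I.Same i ∧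
        st (I.up i) = dig (I.dep (I.anc g j))
    · rw [(h _ hv).1 hc]
      obtain ⟨e, he, hl, hs, hst⟩ := hc
      have h1 := hI.dep_le e he
      have h2 : I.dep (I.up e) ≠ I.dep (I.lo e) := hs
      have h3 := hI.anc_up he hs
      rw [hl] at h1 h2 h3
      rw [hI.anc_anc g hg j (by omega) _ (by omega)] at h3
      have h4 := ih (I.dep (I.up e)) (by omega) (by omega)
      rw [h3] at h4
      -- A clash at this vertex would be a clash of `σ` with itself along the edge `e`, unless `σ`
      -- deletes the vertex; in both cases the state agrees with `σ`.
      have h5 := hσ.ok e he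
      rw [hl] at h5
      rw [hdv] at hst
      unfold Okc at h5
      omega
    · rw [(h _ hv).2 hc, hdv, hdj]

lemma Valid.dep_lt_of_rl (hI : I.Valid) {v : ℕ} (hv : v < I.n) (h : i < I.rl v) :
    i ≤ I.dep v := by
  rcases hI.rl_or v hv with h | h <;> omega

/-- Below an internal vertex all levels are larger than its depth. -/
lemma Valid.lt_rl (hI : I.Valid) (hr : I.rl a = i + 1) {v : ℕ} (hv : v < I.n)
    (hd : i ≤ I.dep v) (h : I.anc v i = a) : i < I.rl v := by
  rcases hd.lt_or_eq with hlt | rfl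
  · rcases hI.rl_or v hv with h | h <;> omega
  · have := hI.rl_rep v hv
    rw [rep, h] at this
    omega

/-- Both ends of an edge lie below the same vertex at depth `i`, so a choice made separately for
each subtree never mixes two candidates across an edge. -/
lemma Valid.anc_same_unit (hI : I.Valid) {e : ℕ} (he : e < I.m) (hu : i ≤ I.dep (I.up e)) :
    I.anc (I.lo e) i = I.anc (I.up e) i := by
  rw [← hI.anc_anc _ (hI.lo_lt e he) _ (hI.dep_le e he) _ hu, hI.edge e he, rep,
    hI.anc_anc _ (hI.up_lt e he) _ le_rfl _ hu]

lemma cnt_congr (h : ∀ v < I.n, i ≤ I.dep v → I.anc v i = a → s v = s' v) :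
    I.cnt i a s = I.cnt i a s' := by
  unfold cnt
  congr 1
  refine filter_congr fun v hv => and_congr_right fun h1 => and_congr_right fun h2 => ?_
  rw [h v (mem_range.1 hv) h1 h2]

lemma cnt_leaf (hI : I.Valid) {g : ℕ} (hd : I.dep g = i) (hr : I.rl g = i) :
    I.cnt i g s = I.dels g s := by
  unfold cnt dels
  congr 1
  refine filter_congr fun v hv => ?_
  rw [← and_assoc]
  refine and_congr_left fun _ => ⟨fun ⟨h1, h2⟩ => ?_, fun h => ?_⟩
  · rcases h1.lt_or_eq with hlt | rfl
    · have := hI.rl_anc v (mem_range.1 hv) i hlt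
      rw [h2] at this
      omega
    · exact h2
  · have := hI.dep_rep (mem_range.1 hv)
    rw [h] at this
    exact ⟨by omega, by rw [← hd, this]; exact h⟩

/-- A limit of 3 means that all colours of the vertices at depth `i` have been tried. What is
missing at level `i` are the leaf bags of depth `i`, where `raw` is optimal, and the internal
vertices of depth `i - 1`, where `raw` is the state. Since the latter carry their state, consistency
with `st` becomes consistency with the row itself. -/
lemma Part.full (hI : I.Valid) (h : I.Part i 3 dig st s) (hst : I.IsState dig st)
    (hraw : I.Raw st raw) (hs : ∀ v < I.n, I.rl v = i → s v = raw v) : I.Full i dig st s where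
  sound := by
    have h0 := h.sound (by omega)
    refine ⟨fun v hv hi => ?_, fun e he hl => ?_⟩
    · rcases hi.lt_or_eq with hlt | rfl
      · exact h0.le v hv hlt
      · rw [hs v hv rfl]
        exact hraw.le v hv
    have hu := hI.up_lt e he
    have hw := hI.lo_lt e he
    have hd := hI.dep_le e he
    have hin : ¬ I.Same e → I.rl (I.up e) = i → s (I.up e) = st (I.up e) := fun hne hr => by
      rw [hs _ hu hr, hraw.inner _ hu (by rw [hI.rl_up he hne]; omega)]
    rcases hl.lt_or_eq with hlt | hl
    · have h1 := h0.ok e he hlt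
      by_cases hr : I.rl (I.up e) = i
      · have hne : ¬ I.Same e := fun h => by
          have := hI.rl_same he h
          omega
        rw [if_neg (by omega)] at h1
        rw [if_pos (by omega), hin hne hr]
        exact h1
      · have e1 : i ≤ I.rl (I.up e) ↔ i + 1 ≤ I.rl (I.up e) := by omega
        simp only [e1]
        exact h1
    · rw [hs _ hw hl.symm]
      by_cases hsame : I.Same e
      · have := hI.rl_same he hsame
        rw [if_pos (by omega), hs _ hu (by omega)]
        exact hraw.same e he hsame
      · have e1 : (if i ≤ I.rl (I.up e) then s (I.up e) else st (I.up e)) = st (I.up e) := by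
          split_ifs with hle
          · refine hin hsame ?_
            have h1 := hI.rl_up he hsame
            have h2 : I.dep (I.up e) ≠ I.dep (I.lo e) := hsame
            rcases hI.rl_or _ hw with h3 | h3 <;> omega
          · rfl
        rw [e1]
        rcases hI.rl_or _ hw with h3 | h3
        · exact hraw.above e he h3 hsame
        · rw [hraw.inner _ hw (by omega)]
          exact hst.okc hI he hsame
  inner v hv hr hd := by
    rw [hs v hv hr]
    exact hraw.inner v hv (by omega)
  opt g hg hd hrep σ hσ hcons := by
    rcases hI.rl_or g hg with hr | hr
    · rw [cnt_leaf hI hd (by omega), cnt_leaf hI hd (by omega)]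
      have e : I.dels g s = I.dels g raw := by
        unfold dels
        congr 1
        refine filter_congr fun v hv => and_congr_right fun h => ?_
        have hv' := mem_range.1 hv
        have := hI.rl_rep v hv'
        rw [h] at this
        rw [hs v hv' (by omega)]
      rw [e]
      -- `σ` is an admissible competitor: it agrees with the states on all vertices above the bag,
      -- and its deletions are within the cap.
      refine hraw.opt g hg hr hrep σ ⟨hσ.le, fun e he _ _ => hσ.ok e he, fun e he hl hne => ?_⟩
        (hσ.cap g hg hr hrep)
      have h1 := hI.anc_up he hne
      have h2 := hI.dep_rep (hI.lo_lt e he)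
      have h3 := hI.dep_le e he
      have h4 : I.dep (I.up e) ≠ I.dep (I.lo e) := hne
      rw [hl] at h2
      have h5 : I.anc g (I.dep (I.up e)) = I.up e := by
        rw [← hl, rep, hI.anc_anc _ (hI.lo_lt e he) _ le_rfl _ h3, h1]
      have h6 := hst.eq_colouring hI hσ hg (i := i) (by omega) hcons (I.dep (I.up e)) (by omega)
      rw [h5] at h6
      rw [h6]
      exact hσ.ok e he
    · exact h.opt g hg hd (by omega) σ hσ hcons (Nat.lt_succ_of_le (hσ.le g hg))

/-- The vertices below `a` are `a` itself and the subtrees of the bags at the next depth. On `a`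
both colourings agree, because its state is the digit that `σ` follows; on each subtree the row is
optimal. -/
lemma Full.cnt_le (hI : I.Valid) (h : I.Full (i + 1) dig st s) (hst : I.IsState dig st)
    (ha : a < I.n) (hd : I.dep a = i) (hr : I.rl a = i + 1) (hσ : I.Colouring σ)
    (hcons : ∀ j < i, σ (I.anc a j) = dig j) (hai : σ a = dig i) :
    I.cnt i a s ≤ I.cnt i a σ := by
  have hrep := hI.rep_self a ha (by omega)
  have haa : I.anc a i = a := by rw [← hd]; exact hrep
  have hcons' : ∀ j < i + 1, σ (I.anc a j) = dig j := by
    intro j hj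
    rcases Nat.lt_succ_iff_lt_or_eq.1 hj with hj | rfl
    · exact hcons j hj
    · rw [haa, hai]
  have hsa : s a = σ a := by
    have := hst.eq_colouring hI hσ ha (i := i + 1) (by omega) hcons' i (by omega)
    rw [haa] at this
    rw [h.inner a ha hr (by omega), this]
  -- The fibres of `f` are the parts to compare: `{a}`, and one subtree for each bag of depth `i +
  -- 1`.
  set f : ℕ → ℕ := fun v => if I.dep v = i then v else I.anc v (i + 1) with hf
  have hmaps : ∀ s : ℕ → ℕ, ∀ v ∈ (range I.n).filter fun v => i ≤ I.dep v ∧ I.anc v i = a ∧ s v = 0,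
      f v ∈ range I.n := by
    intro s v hv
    simp only [mem_filter, mem_range] at hv ⊢
    simp only [hf]
    split_ifs with h
    · exact hv.1
    · exact hI.anc_lt v hv.1 _ (by omega)
  unfold cnt
  rw [card_eq_sum_card_fiberwise (hmaps s), card_eq_sum_card_fiberwise (hmaps σ)]
  refine sum_le_sum fun g _ => ?_
  rcases Finset.eq_empty_or_nonempty
    {v ∈ (range I.n).filter fun v => i ≤ I.dep v ∧ I.anc v i = a ∧ s v = 0 | f v = g} with h0 | h0
  · rw [h0]
    simp
  obtain ⟨v, hv⟩ := h0
  simp only [mem_filter, mem_range, hf] at hv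
  obtain ⟨⟨hvn, hdv, hva, hsv⟩, hg⟩ := hv
  by_cases hdi : I.dep v = i
  · rw [if_pos hdi] at hg
    -- A vertex of depth `i` represented by `a` shares the bag of the internal vertex `a`, which has
    -- no other vertex.
    have hv_eq : v = a := by
      have h1 := hI.rl_rep v hvn
      have h2 : I.rep v = a := by rw [← hva, ← hdi]; rfl
      rw [h2] at h1
      rw [← h2, hI.rep_self v hvn (by omega)]
    subst hg
    refine card_le_card fun w hw => ?_
    simp only [mem_filter, mem_range, hf] at hw ⊢
    have hwv : w = v := by
      obtain ⟨⟨h1, h2, -, -⟩, h3⟩ := hw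
      split_ifs at h3 with h4
      · exact h3
      · have := hI.dep_anc w h1 (i + 1) (by omega)
        rw [h3] at this
        omega
    subst hwv
    exact ⟨⟨hw.1.1, hw.1.2.1, hw.1.2.2.1, by rw [hv_eq, ← hsa, ← hv_eq]; exact hsv⟩, hw.2⟩
  · rw [if_neg hdi] at hg
    have hgn : g < I.n := hg ▸ hI.anc_lt v hvn _ (by omega)
    have hdg : I.dep g = i + 1 := hg ▸ hI.dep_anc v hvn _ (by omega)
    have hgrep : I.rep g = g := by
      rw [rep, hdg, ← hg, hI.anc_anc v hvn _ (by omega) _ le_rfl]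
    have hga : ∀ j ≤ i, I.anc g j = I.anc a j := by
      intro j hj
      rw [← hg, hI.anc_anc v hvn _ (by omega) _ (by omega), ← hva,
        hI.anc_anc v hvn _ (by omega) _ hj]
    have key : ∀ s : ℕ → ℕ,
        #{v ∈ (range I.n).filter fun v => i ≤ I.dep v ∧ I.anc v i = a ∧ s v = 0 | f v = g} =
          I.cnt (i + 1) g s := by
      intro s
      unfold cnt
      rw [filter_filter]
      congr 1
      refine filter_congr fun w hw => ?_
      have hwn := mem_range.1 hw
      simp only [hf]
      constructor
      · rintro ⟨⟨h1, h2, h3⟩, h4⟩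
        split_ifs at h4 with h5
        · rw [← h4] at hdg
          omega
        · exact ⟨by omega, h4, h3⟩
      · rintro ⟨h1, h2, h3⟩
        refine ⟨⟨by omega, ?_, h3⟩, ?_⟩
        · rw [← hI.anc_anc w hwn _ h1 _ (Nat.le_succ i), h2, hga i le_rfl, haa]
        · rw [if_neg (by omega)]
          exact h2
    rw [key, key]
    refine h.opt g hgn hdg hgrep σ hσ fun j hj => ?_
    rw [hga j (by omega)]
    exact hcons' j hj

/-- Keep the better of two candidates below each internal vertex of depth `i`. -/
lemma Part.step (hI : I.Valid) (h : I.Part i (dig i) dig st old) (hc : I.Full (i + 1) dig st cand)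
    (hst : I.IsState dig st)
    (hs : ∀ v < I.n, i < I.rl v → s v =
      if dig i = 0 ∨ I.cnt i (I.anc v i) cand < I.cnt i (I.anc v i) old then cand v else old v) :
    I.Part i (dig i + 1) dig st s := by
  refine ⟨fun _ => ⟨fun v hv hr => ?_, fun e he hr => ?_⟩, fun a ha hd hr σ hσ hcons hlt => ?_⟩
  · rw [hs v hv hr]
    split_ifs with hcond
    · exact hc.sound.le v hv hr
    · exact (h.sound (by omega)).le v hv hr
  · have hw := hI.lo_lt e he
    have hu := hI.up_lt e he
    rw [hs _ hw hr]
    have h1 := hc.sound.ok e he hr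
    -- The old row is known to be sound only if some digit has been tried. For digit `0` it may be
    -- stale, and the rule then always takes the candidate.
    have h2 := fun hl => (h.sound hl).ok e he hr
    -- If both ends have level above `i` they lie in one subtree and follow the same candidate;
    -- otherwise the upper end is represented by its state, with which both candidates are
    -- consistent.
    by_cases hru : i + 1 ≤ I.rl (I.up e)
    · rw [if_pos hru] at h1 h2 ⊢
      rw [hs _ hu hru, hI.anc_same_unit he (hI.dep_lt_of_rl hu hru)]
      split_ifs with hcond
      · exact h1
      · exact h2 (by omega)
    · rw [if_neg hru] at h1 h2 ⊢
      split_ifs with hcond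
      · exact h1
      · exact h2 (by omega)
  · by_cases hcond : dig i = 0 ∨ I.cnt i a cand < I.cnt i a old
    · have e : I.cnt i a s = I.cnt i a cand := cnt_congr fun v hv h1 h2 => by
        rw [hs v hv (hI.lt_rl hr hv h1 h2), h2, if_pos hcond]
      rw [e]
      rcases Nat.lt_succ_iff_lt_or_eq.1 hlt with h3 | h3
      · have := h.opt a ha hd hr σ hσ hcons h3
        omega
      · exact hc.cnt_le hI hst ha hd hr hσ hcons h3
    · have e : I.cnt i a s = I.cnt i a old := cnt_congr fun v hv h1 h2 => by
        rw [hs v hv (hI.lt_rl hr hv h1 h2), h2, if_neg hcond]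
      rw [e]
      rcases Nat.lt_succ_iff_lt_or_eq.1 hlt with h3 | h3
      · exact h.opt a ha hd hr σ hσ hcons h3
      · have := hc.cnt_le hI hst ha hd hr hσ hcons h3
        omega

/-- Nothing is claimed before the first digit has been tried, so a row needs no clearing when its
digit is reset to `0`. -/
lemma Part.zero : I.Part i 0 dig st s := ⟨by simp, by simp⟩

/-- No vertex has level above `D`, so there is nothing to optimise; this starts the carry. -/
lemma Part.top (hI : I.Valid) : I.Part I.D lim dig st s := by
  refine ⟨fun _ => ⟨fun v hv h => ?_, fun e he h => ?_⟩, fun a ha _ h => ?_⟩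
  · have := hI.rl_le v hv
    omega
  · have := hI.rl_le _ (hI.lo_lt e he)
    omega
  · have := hI.rl_le a ha
    omega

/-- A row for depth `i` refers only to digits and states above depth `i` and to the entries of
vertices with level above `i`. -/
lemma Part.congr (hI : I.Valid) (h : I.Part i lim dig st s) (hd : ∀ j < i, dig j = dig' j)
    (hst : ∀ v < I.n, I.dep v < i → st v = st' v) (hs : ∀ v < I.n, i < I.rl v → s v = s' v) :
    I.Part i lim dig' st' s' := by
  refine ⟨fun hl => ⟨fun v hv hr => ?_, fun e he hr => ?_⟩, fun a ha hda hr σ hσ hcons hlt => ?_⟩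
  · rw [← hs v hv hr]
    exact (h.sound hl).le v hv hr
  · have := (h.sound hl).ok e he hr
    have hu := hI.up_lt e he
    rw [hs _ (hI.lo_lt e he) hr] at this
    split_ifs with hru
    · rwa [if_pos hru, hs _ hu hru] at this
    · rw [if_neg hru] at this
      by_cases hsame : I.Same e
      · have := hI.rl_same he hsame
        omega
      · rwa [hst _ hu (by have := hI.rl_up he hsame; omega)] at this
  · rw [← cnt_congr fun v hv h1 h2 => hs v hv (hI.lt_rl hr hv h1 h2)]
    exact h.opt a ha hda hr σ hσ (fun j hj => by rw [hcons j hj, hd j hj]) hlt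

/-- The total number of deleted vertices of a full solution is least. -/
lemma Full.card_le (hI : I.Valid) (h : I.Full 0 dig st s) (hσ : I.Colouring σ) :
    #{v ∈ range I.n | s v = 0} ≤ #{v ∈ range I.n | σ v = 0} := by
  have hmaps : ∀ s : ℕ → ℕ, ∀ v ∈ (range I.n).filter fun v => s v = 0,
      I.anc v 0 ∈ range I.n := by
    intro s v hv
    simp only [mem_filter, mem_range] at hv ⊢
    exact hI.anc_lt v hv.1 _ (by omega)
  rw [card_eq_sum_card_fiberwise (hmaps s), card_eq_sum_card_fiberwise (hmaps σ)]
  have key : ∀ (s : ℕ → ℕ) g, #{v ∈ (range I.n).filter fun v => s v = 0 | I.anc v 0 = g} =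
      I.cnt 0 g s := by
    intro s g
    unfold cnt
    rw [filter_filter]
    congr 1
    refine filter_congr fun w _ => ?_
    simp [and_comm]
  refine sum_le_sum fun g _ => ?_
  rw [key, key]
  rcases Finset.eq_empty_or_nonempty {v ∈ range I.n | 0 ≤ I.dep v ∧ I.anc v 0 = g ∧ s v = 0}
    with h0 | ⟨v, hv⟩
  · rw [cnt, h0]
    simp
  simp only [mem_filter, mem_range] at hv
  obtain ⟨hvn, -, hg, -⟩ := hv
  have hgn : g < I.n := hg ▸ hI.anc_lt v hvn _ (by omega)
  have hdg : I.dep g = 0 := hg ▸ hI.dep_anc v hvn _ (by omega)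
  refine h.opt g hgn hdg ?_ σ hσ (by simp)
  rw [rep, hdg, ← hg, hI.anc_anc v hvn _ (by omega) _ le_rfl]

lemma Full.okc (h : I.Full 0 dig st s) {e : ℕ} (he : e < I.m) :
    Okc (s (I.up e)) (s (I.lo e)) := by
  simpa using h.sound.ok e he (by omega)

end Inst

end OddCycleTransversal

namespace OddCycleTransversal

open Finset

notation "vCnt" => (3 : ℕ)
notation "vFin" => (40 : ℕ)
notation "vLv" => (41 : ℕ)
notation "aOut" => (4 : ℕ)
notation "aCa" => (26 : ℕ)
notation "aCb" => (27 : ℕ)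

/-! ### Rows of the solution table and the counting of deletions below a vertex -/

namespace Inst

variable (I : Inst)

/-- Row `i` of the table of solutions. -/
def row (σ : Memory) (i : ℕ) : ℕ → ℕ := fun v => σ.arr aSol (i * I.n + v)

/-- The part of the count of deleted vertices that is due to the vertices below `k`. -/
def cntTo (i a : ℕ) (s : ℕ → ℕ) (k : ℕ) : ℕ :=
  #{v ∈ range k | i < I.rl v ∧ I.anc v i = a ∧ s v = 0}

variable {I} {i a k : ℕ} {s : ℕ → ℕ}

lemma cntTo_le : I.cntTo i a s k ≤ k := by
  simpa [cntTo] using card_filter_le (range k) fun v => i < I.rl v ∧ I.anc v i = a ∧ s v = 0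

lemma cntTo_succ : I.cntTo i a s (k + 1) =
    I.cntTo i a s k + if i < I.rl k ∧ I.anc k i = a ∧ s k = 0 then 1 else 0 := by
  unfold cntTo
  rw [range_add_one, filter_insert]
  split_ifs with h
  · rw [card_insert_of_notMem (by simp)]
  · rfl

/-- The program recognises the vertices below an internal vertex of depth `i` by their level
exceeding `i`, which also covers that vertex itself. -/
lemma cntTo_anc (hI : I.Valid) {v : ℕ} (hv : v < I.n) (h : i < I.rl v) :
    I.cntTo i (I.anc v i) s I.n = I.cnt i (I.anc v i) s := by
  have hd := hI.dep_lt_of_rl hv h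
  have hr : I.rl (I.anc v i) = i + 1 := by
    rcases hd.lt_or_eq with hlt | rfl
    · exact hI.rl_anc v hv i hlt
    · have := hI.rl_rep v hv
      unfold rep at this
      rw [this]
      rcases hI.rl_or v hv with h' | h' <;> omega
  unfold cntTo cnt
  congr 1
  refine filter_congr fun w hw => ?_
  have hw' := mem_range.1 hw
  exact ⟨fun h => ⟨hI.dep_lt_of_rl hw' h.1, h.2⟩, fun h => ⟨hI.lt_rl hr hw' h.1 h.2.1, h.2⟩⟩

end Inst

/-! ### Comparing the candidates at one level -/

def countBody : Prog :=
  .ite (.lt (.var vLv) (.read aRl (.var vI)))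
    (.store aCa (.read aAnc (.var vLv * .var vN + .var vI))
        (.read aCa (.read aAnc (.var vLv * .var vN + .var vI)) +
          .eq (.read aSol ((.var vLv + 1) * .var vN + .var vI)) 0) ;;
      .store aCb (.read aAnc (.var vLv * .var vN + .var vI))
        (.read aCb (.read aAnc (.var vLv * .var vN + .var vI)) +
          .eq (.read aSol (.var vLv * .var vN + .var vI)) 0))
    .skip

def chooseBody : Prog :=
  .ite (.lt (.var vLv) (.read aRl (.var vI)))
    (.ite (.eq (.read aDig (.var vLv)) 0 +
        .lt (.read aCa (.read aAnc (.var vLv * .var vN + .var vI)))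
          (.read aCb (.read aAnc (.var vLv * .var vN + .var vI))))
      (.store aSol (.var vLv * .var vN + .var vI)
        (.read aSol ((.var vLv + 1) * .var vN + .var vI)))
      .skip)
    .skip

def levelProg : Prog :=
  forP vI vN (.store aCa (.var vI) 0 ;; .store aCb (.var vI) 0) ;;
  forP vI vN countBody ;;
  forP vI vN chooseBody

variable {I : Inst} {side : ℕ → ℕ} {B : ℕ} {σ : Memory}

/-- The counters are indexed by the ancestor at depth `l`, so one pass counts the deletions in all
subtrees of that depth and a second one makes all the choices. -/
lemma Tr.levelProg (hI : I.Valid) (hR : I.Room B) (hσ : Static I side σ) {l : ℕ} (hl : l < I.D)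
    (hlv : σ.var vLv = l) (hd : σ.arr aDig l ≤ 2) (hs : ∀ v < I.n, ∀ i, I.row σ i v ≤ 2) :
    Tr B levelProg (200 * (I.n + 1)) σ fun τ => ∀ v < I.n, ∀ i, I.row τ i v =
      if i = l ∧ l < I.rl v ∧ (σ.arr aDig l = 0 ∨ I.cnt l (I.anc v l) (I.row σ (l + 1)) <
        I.cnt l (I.anc v l) (I.row σ l)) then I.row σ (l + 1) v else I.row σ i v := by
  have hB := hR.lin
  refine (Tr.forP (T := 10) (fun k τ => ∀ a < k, τ.arr aCa a = 0 ∧ τ.arr aCb a = 0) rfl rfl hσ.n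
    (by omega) (by simp) ?_).seq (T₂ := (I.n * (60 + 8) + 6) + (I.n * (60 + 8) + 6)) ?_ (by omega)
  · intro k τ hk hf hv h
    refine (Tr.wp_intro fun R hQ => ?_).conseq (by decide) (fun _ h _ => h)
    simp only [Prog.wp]
    simp [hv]
    refine ⟨by omega, hQ _ fun a ha => ?_⟩
    by_cases hak : a = k
    · simp [hak]
    · simpa [hak] using h a (by omega)
  intro τ₁ h₁ hf₁
  have hσ₁ := hσ.of_frame hf₁ rfl
  refine (Tr.forP (T := 60) (fun k τ => ∀ a < I.n,
    τ.arr aCa a = I.cntTo l a (I.row σ (l + 1)) k ∧ τ.arr aCb a = I.cntTo l a (I.row σ l) k)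
    rfl rfl hσ₁.n (by omega) ?_ ?_).seq ?_
  · intro a ha
    simp [h₁ a ha, Inst.cntTo]
  · intro k τ hk hf hv h
    have hσ' := hσ₁.of_frame hf rfl
    have hl' : τ.var vLv = l := by rw [hf.var _ rfl, hf₁.var _ rfl, hlv]
    have hsol : τ.arr aSol = σ.arr aSol := by rw [hf.arr _ rfl, hf₁.arr _ rfl]
    have i1 := hR.idx_lt (i := l) (by omega) hk
    have i2 := hR.idx_lt (i := l + 1) (by omega) hk
    have hrl := hI.rl_le k hk
    have s1 : σ.arr aSol (l * I.n + k) ≤ 2 := hs k hk l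
    have s2 : σ.arr aSol ((l + 1) * I.n + k) ≤ 2 := hs k hk (l + 1)
    refine (Tr.wp_intro (p := countBody) fun R hQ => ?_).conseq (by decide) (fun _ h _ => h)
    simp only [countBody, Prog.wp]
    simp only [Expr.fits_lt, show 1 < B by omega, Expr.fits_var, Expr.fits_read, Expr.eval_var,
      Expr.eval_read, Expr.eval_lt, ltN_eq_zero, ne_eq, not_le, hl', hv, hσ'.rl, hσ'.n, hσ'.anc,
      Expr.fits_mul, Expr.eval_mul, Expr.fits_add, Expr.eval_add, Expr.fits_eq, Expr.eval_eq,
      Memory.var_setArr, Memory.arr_setArr, Expr.fits_one, Expr.eval_one, Expr.fits_zero,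
      Expr.eval_zero, hsol, true_and]
    refine ⟨by omega, fun h4 => ?_, fun h4 => hQ _ fun a ha => ?_⟩
    · have hdk := hI.dep_lt_of_rl hk h4
      have ha := hI.anc_lt k hk l hdk
      obtain ⟨c1, c2⟩ := h _ ha
      have c3 := Inst.cntTo_le (I := I) (i := l) (a := I.anc k l) (s := I.row σ (l + 1)) (k := k)
      have c4 := Inst.cntTo_le (I := I) (i := l) (a := I.anc k l) (s := I.row σ l) (k := k)
      have e : I.ancA (l * I.n + k) = I.anc k l := rfl
      have q1 := eqN_le (σ.arr aSol ((l + 1) * I.n + k)) 0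
      have q2 := eqN_le (σ.arr aSol (l * I.n + k)) 0
      simp only [e, c1, c2, show ¬ (27 : ℕ) = 26 by decide, show ¬ (8 : ℕ) = 26 by decide,
        show ¬ (7 : ℕ) = 26 by decide, show ¬ (25 : ℕ) = 26 by decide, if_false, hσ'.anc, hsol]
      refine ⟨by omega, by omega, hQ _ fun a ha => ?_⟩
      simp only [Inst.cntTo_succ, Memory.arr_setVar, Memory.arr_setArr]
      by_cases hak : a = I.anc k l
      · subst hak
        simp [h4, Inst.row, eqN_eq]
      · have := h a ha
        simpa [hak, h4, Ne.symm hak] using this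
    · have := h a ha
      simpa [Inst.cntTo_succ, not_lt.2 h4] using this
  intro τ₂ h₂ hf₂
  have hσ₂ := hσ₁.of_frame hf₂ rfl
  have hsol : τ₂.arr aSol = σ.arr aSol := by rw [hf₂.arr _ rfl, hf₁.arr _ rfl]
  refine (Tr.forP (T := 60) (fun k τ => ∀ v < I.n, ∀ i, I.row τ i v =
      if v < k ∧ i = l ∧ l < I.rl v ∧ (σ.arr aDig l = 0 ∨
        I.cnt l (I.anc v l) (I.row σ (l + 1)) < I.cnt l (I.anc v l) (I.row σ l))
      then I.row σ (l + 1) v else I.row σ i v)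
    rfl rfl hσ₂.n (by omega) ?_ ?_).conseq le_rfl ?_
  · intro v _ i
    simp [Inst.row, hsol]
  · intro k τ hk hf hv h
    have hσ' := hσ₂.of_frame hf rfl
    have hl' : τ.var vLv = l := by rw [hf.var _ rfl, hf₂.var _ rfl, hf₁.var _ rfl, hlv]
    have hdig : τ.arr aDig = σ.arr aDig := by rw [hf.arr _ rfl, hf₂.arr _ rfl, hf₁.arr _ rfl]
    have hca : τ.arr aCa = τ₂.arr aCa := hf.arr _ rfl
    have hcb : τ.arr aCb = τ₂.arr aCb := hf.arr _ rfl
    have i1 := hR.idx_lt (i := l) (by omega) hk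
    have i2 := hR.idx_lt (i := l + 1) (by omega) hk
    have hrl := hI.rl_le k hk
    -- The loop writes only to row `l`, so the candidate in row `l + 1` is still the original one.
    have hrow : τ.arr aSol ((l + 1) * I.n + k) = I.row σ (l + 1) k := by
      have := h k hk (l + 1)
      rwa [if_neg (by omega)] at this
    have s2 := hs k hk (l + 1)
    have hskip : ¬ (l < I.rl k ∧ (σ.arr aDig l = 0 ∨ I.cnt l (I.anc k l) (I.row σ (l + 1)) <
        I.cnt l (I.anc k l) (I.row σ l))) → ∀ v < I.n, ∀ i, I.row τ i v =
      if v < k + 1 ∧ i = l ∧ l < I.rl v ∧ (σ.arr aDig l = 0 ∨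
        I.cnt l (I.anc v l) (I.row σ (l + 1)) < I.cnt l (I.anc v l) (I.row σ l))
      then I.row σ (l + 1) v else I.row σ i v := by
      intro hn v hv i
      rw [h v hv i]
      by_cases hvk : v = k
      · subst hvk
        rw [if_neg (fun h => hn h.2.2), if_neg (fun h => hn h.2.2)]
      · have e : v < k + 1 ↔ v < k := by omega
        simp only [e]
    refine (Tr.wp_intro (p := chooseBody) fun R hQ => ?_).conseq (by decide) (fun _ h _ => h)
    simp only [chooseBody, Prog.wp]
    simp only [Expr.fits_lt, show 1 < B by omega, Expr.fits_var, Expr.fits_read, Expr.eval_var,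
      Expr.eval_read, Expr.eval_lt, ltN_eq_zero, ne_eq, not_le, hl', hv, hσ'.rl, hσ'.n, hσ'.anc,
      Expr.fits_mul, Expr.eval_mul, Expr.fits_add, Expr.eval_add, Expr.fits_eq, Expr.eval_eq,
      Expr.fits_one, Expr.eval_one, Expr.fits_zero, Expr.eval_zero, hrow, hdig, hca, hcb, true_and]
    refine ⟨by omega, fun h4 => ?_, fun h4 => hQ _ (hskip (by omega))⟩
    have hdk := hI.dep_lt_of_rl hk h4
    have ha := hI.anc_lt k hk l hdk
    obtain ⟨c1, c2⟩ := h₂ _ ha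
    have c3 := Inst.cntTo_le (I := I) (i := l) (a := I.anc k l) (s := I.row σ (l + 1)) (k := I.n)
    have c4 := Inst.cntTo_le (I := I) (i := l) (a := I.anc k l) (s := I.row σ l) (k := I.n)
    have e : I.ancA (l * I.n + k) = I.anc k l := rfl
    have q1 := eqN_le (σ.arr aDig l) 0
    rw [e, c1, c2]
    rw [Inst.cntTo_anc hI hk h4, Inst.cntTo_anc hI hk h4] at *
    have q2 := ltN_le (I.cnt l (I.anc k l) (I.row σ (l + 1))) (I.cnt l (I.anc k l) (I.row σ l))
    have e1 : eqN (σ.arr aDig l) 0 = 0 ↔ σ.arr aDig l ≠ 0 := eqN_eq_zero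
    have e2 : ltN (I.cnt l (I.anc k l) (I.row σ (l + 1))) (I.cnt l (I.anc k l) (I.row σ l)) = 0 ↔
      I.cnt l (I.anc k l) (I.row σ l) ≤ I.cnt l (I.anc k l) (I.row σ (l + 1)) := ltN_eq_zero
    refine ⟨by omega, fun h5 => ⟨by omega, hQ _ fun v hv i => ?_⟩,
      fun h5 => hQ _ (hskip (by omega))⟩
    have e3 : I.row ((τ.setArr aSol (l * I.n + k) (I.row σ (l + 1) k)).setVar vI (k + 1)) i v =
        if i = l ∧ v = k then I.row σ (l + 1) k else I.row τ i v := by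
      simp [Inst.row, Inst.idx_inj hv hk]
    rw [e3, h v hv i]
    by_cases hvk : v = k
    · subst hvk
      by_cases hi : i = l
      · have : σ.arr aDig l = 0 ∨ I.cnt l (I.anc v l) (I.row σ (l + 1)) <
          I.cnt l (I.anc v l) (I.row σ l) := by omega
        simp [hi, h4, this]
      · simp [hi]
    · have e : v < k + 1 ↔ v < k := by omega
      simp only [hvk, and_false, if_false, e]
  · intro τ h _ v hv i
    rw [h v hv i]
    simp only [hv, true_and]

end OddCycleTransversal

namespace OddCycleTransversal

open Finset

/-! ### The search through all digits -/

/-- The number with the first `k` digits, most significant first. -/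
def digVal (dig : ℕ → ℕ) : ℕ → ℕ
  | 0 => 0
  | k + 1 => 3 * digVal dig k + dig k

lemma digVal_lt {dig : ℕ → ℕ} {k : ℕ} (h : ∀ i < k, dig i ≤ 2) : digVal dig k < 3 ^ k := by
  induction k with
  | zero => simp [digVal]
  | succ k ih =>
    have h1 := ih fun i hi => h i (by omega)
    have h2 := h k (by omega)
    rw [digVal, pow_succ]
    omega

lemma digVal_congr {dig dig' : ℕ → ℕ} {k : ℕ} (h : ∀ i < k, dig i = dig' i) :
    digVal dig k = digVal dig' k := by
  induction k with
  | zero => rfl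
  | succ k ih => rw [digVal, digVal, ih fun i hi => h i (by omega), h k (by omega)]

/-- Trailing digits `2` turn to `0` and the digit before them is raised: the successor in base 3. -/
lemma digVal_carry {dig dig' : ℕ → ℕ} {l k : ℕ} (hk : l < k) (h : ∀ i < l, dig' i = dig i)
    (hl : dig' l = dig l + 1) (ht : ∀ i, l < i → i < k → dig' i = 0 ∧ dig i = 2) :
    digVal dig' k = digVal dig k + 1 := by
  induction k with
  | zero => omega
  | succ k ih =>
    rw [digVal, digVal]
    rcases Nat.lt_succ_iff_lt_or_eq.1 hk with h1 | rfl
    · have h2 := ih h1 fun i hi hi' => ht i hi (by omega)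
      have h3 := ht k h1 (by omega)
      omega
    · rw [digVal_congr h]
      omega

def carryBody : Prog :=
  .assign vLv (.var vLv - 1) ;; levelProg ;;
  .ite (.eq (.read aDig (.var vLv)) 2) (.store aDig (.var vLv) 0)
    (.store aDig (.var vLv) (.read aDig (.var vLv) + 1) ;; .assign vFin 0)

def carryProg : Prog :=
  (.assign vLv (.var vD) ;; .assign vFin 1) ;; .loop (.var vLv * .var vFin) carryBody

def searchProg : Prog :=
  .assign vFin 0 ;; .loop (.eq (.var vFin) 0) (evalProg ;; carryProg)

def outProg : Prog :=
  .assign vCnt 0 ;;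
  forP vI vN (.ite (.read aSol (.var vI)) .skip
    (.store aOut (.var vCnt) (.var vI) ;; .assign vCnt (.var vCnt + 1)))

/-- The memory between the rounds of the search. -/
structure Searching (I : Inst) (side : ℕ → ℕ) (σ : Memory) : Prop where
  static : Static I side σ
  dig_le : ∀ i ≤ I.D, σ.arr aDig i ≤ 2
  sol_le : ∀ v < I.n, ∀ i, I.row σ i v ≤ 2
  part : ∀ i < I.D, ∀ st, I.IsState (σ.arr aDig) st →
    I.Part i (σ.arr aDig i) (σ.arr aDig) st (I.row σ i)

/-- The table is complete at level `l` and above, for the digits `dig`. -/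
structure CarryUp (I : Inst) (dig st raw : ℕ → ℕ) (l : ℕ) (τ : Memory) : Prop where
  low : ∀ j, j < l ∨ I.D ≤ j → τ.arr aDig j = dig j
  high : ∀ j, l ≤ j → j < I.D → τ.arr aDig j = 0 ∧ dig j = 2
  raw : ∀ v < I.n, I.rl v ≤ l → I.row τ (I.rl v) v = raw v
  full : I.Full l dig st (I.row τ l)
  part : ∀ i < l, I.Part i (dig i) dig st (I.row τ i)

/-- The digit at level `l` has been raised. -/
structure CarryDone (I : Inst) (dig st : ℕ → ℕ) (l : ℕ) (τ : Memory) : Prop where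
  lt : l < I.D
  low : ∀ j, j < l ∨ I.D ≤ j → τ.arr aDig j = dig j
  mid : τ.arr aDig l = dig l + 1
  mid_le : τ.arr aDig l ≤ 2
  high : ∀ j, l < j → j < I.D → τ.arr aDig j = 0 ∧ dig j = 2
  part : ∀ i < l, I.Part i (dig i) dig st (I.row τ i)
  part_l : I.Part l (dig l + 1) dig st (I.row τ l)

variable {I : Inst} {side dig st raw : ℕ → ℕ} {B l : ℕ} {σ : Memory}

/-- Row `l + 1` is complete for the present digit at depth `l`, so merging it into row `l` accounts
for one more value of that digit. If this was the value `2`, row `l` is complete as well and the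
carry goes on; otherwise the digit is raised and the carry stops. -/
lemma Tr.carryBody (hI : I.Valid) (hR : I.Room B) (hσ : Static I side σ) (hlv : σ.var vLv = l + 1)
    (hfin : σ.var vFin = 1) (hl : l < I.D)
    (hs : ∀ v < I.n, ∀ i, I.row σ i v ≤ 2) (hdig : ∀ i ≤ I.D, dig i ≤ 2) (hst : I.IsState dig st)
    (hraw : I.Raw st raw) (h : CarryUp I dig st raw (l + 1) σ) :
    Tr B carryBody (200 * (I.n + 1) + 20) σ fun τ => τ.var vLv = l ∧
      (∀ v < I.n, ∀ i, I.row τ i v ≤ 2) ∧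
      (τ.var vFin = 1 ∧ CarryUp I dig st raw l τ ∨ τ.var vFin = 0 ∧ CarryDone I dig st l τ) := by
  have hB := hR.lin
  have h1 : Tr B (.assign vLv (.var vLv - 1)) 4 σ fun τ => τ = σ.setVar vLv l := by
    refine (Tr.of_wp (p := .assign vLv (.var vLv - 1)) ?_).conseq (T₁ := 4) le_rfl (fun _ h _ => h)
    simp only [Prog.wp]
    simp [hlv]
    omega
  refine h1.seq (T₂ := 200 * (I.n + 1) + 16) (fun τ₁ h₁ hf₁ => ?_) (by omega)
  have hσ₁ := hσ.of_frame hf₁ rfl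
  have hv₁ : τ₁.var vLv = l := by simp [h₁]
  have harr : τ₁.arr = σ.arr := by simp [h₁]
  have hrow : ∀ i v, I.row τ₁ i v = I.row σ i v := by simp [Inst.row, harr]
  have hdl := h.low l (.inl (by omega))
  have hd2 := hdig l (by omega)
  refine (Tr.levelProg hI hR hσ₁ hl hv₁ (by rw [harr, hdl]; exact hd2)
    (by simpa only [hrow] using hs)).seq (T₂ := 16) (fun τ₂ h₂ hf₂ => ?_) (by omega)
  simp only [harr, hdl, show I.row τ₁ = I.row σ from funext fun i => funext fun v => hrow i v] at h₂
  have hv₂ : τ₂.var vLv = l := by rw [hf₂.var _ rfl, hv₁]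
  have hfin₂ : τ₂.var vFin = 1 := by rw [hf₂.var _ rfl, hf₁.var _ rfl, hfin]
  have hdig₂ : τ₂.arr aDig = σ.arr aDig := by rw [hf₂.arr _ rfl, harr]
  have hs₂ : ∀ v < I.n, ∀ i, I.row τ₂ i v ≤ 2 := by
    intro v hv i
    rw [h₂ v hv i]
    split_ifs
    · exact hs v hv _
    · exact hs v hv _
  have hother : ∀ v < I.n, ∀ i, i ≠ l → I.row τ₂ i v = I.row σ i v := by
    intro v hv i hi
    rw [h₂ v hv i, if_neg (by tauto)]
  have hpart : ∀ i < l, I.Part i (dig i) dig st (I.row τ₂ i) := by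
    intro i hi
    exact (h.part i (by omega)).congr hI (fun _ _ => rfl) (fun _ _ _ => rfl)
      fun v hv _ => (hother v hv i (by omega)).symm
  have hpl : I.Part l (dig l + 1) dig st (I.row τ₂ l) := by
    refine (h.part l (by omega)).step hI h.full hst fun v hv hr => ?_
    rw [h₂ v hv l]
    simp only [hr, true_and]
  have hraw₂ : ∀ v < I.n, I.rl v ≤ l → I.row τ₂ (I.rl v) v = raw v := by
    intro v hv hr
    rw [h₂ v hv, if_neg (by omega)]
    exact h.raw v hv (by omega)
  refine (Tr.wp_intro fun R hQ => ?_).conseq (by decide) (fun _ h _ => h)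
  simp only [Prog.wp]
  simp [hv₂, hdig₂, hdl, show 1 < B by omega]
  refine ⟨by omega, fun h4 => ⟨by omega, hQ _ ⟨by simp [hv₂], by simpa [Inst.row] using hs₂,
    .inl ⟨by simp [hfin₂], ?_⟩⟩⟩, fun h4 => ⟨by omega, by omega, hQ _ ⟨by simp [hv₂],
    by simpa [Inst.row] using hs₂, .inr ⟨by simp, ?_⟩⟩⟩⟩
  · have hrw : ∀ i, I.row (τ₂.setArr aDig l 0) i = I.row τ₂ i := fun i => by
      funext v
      simp [Inst.row]
    refine ⟨fun j hj => ?_, fun j hj hjD => ?_, ?_, ?_, ?_⟩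
    · simp [show j ≠ l by omega, hdig₂, h.low j (by omega)]
    · by_cases hjl : j = l
      · simp [hjl, h4]
      · simpa [hjl, hdig₂] using h.high j (by omega) hjD
    · simpa only [hrw] using hraw₂
    · rw [hrw]
      -- The digit was 2, so the limit is now 3 and `Part.full` applies with the raw entries that
      -- this round wrote to row `l`.
      rw [h4] at hpl
      exact hpl.full hI hst hraw fun v hv hr => by
        have := hraw₂ v hv (by omega)
        rwa [hr] at this
    · simpa only [hrw] using hpart
  · have hrw : ∀ i, I.row ((τ₂.setArr aDig l (dig l + 1)).setVar vFin 0) i = I.row τ₂ i :=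
      fun i => by
        funext v
        simp [Inst.row]
    refine ⟨hl, fun j hj => ?_, by simp, by simp; omega, fun j hj hjD => ?_, ?_, ?_⟩
    · simp [show j ≠ l by omega, hdig₂, h.low j (by omega)]
    · simpa [show j ≠ l by omega, hdig₂] using h.high j (by omega) hjD
    · simpa only [hrw] using hpart
    · rw [hrw]
      exact hpl

/-- A carry that passes level `0` means that all strings have been tried, and then row `0` is
complete. Otherwise the digits have advanced by one and the invariant of the search holds for the
new string. -/
lemma Tr.carryProg (hI : I.Valid) (hR : I.Room B) (hσ : Static I side σ)
    (hs : ∀ v < I.n, ∀ i, I.row σ i v ≤ 2) (hdig : ∀ i ≤ I.D, σ.arr aDig i ≤ 2)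
    (hst : I.IsState (σ.arr aDig) st) (hraw : I.Raw st raw)
    (hr : ∀ v < I.n, I.row σ (I.rl v) v = raw v)
    (hp : ∀ i < I.D, I.Part i (σ.arr aDig i) (σ.arr aDig) st (I.row σ i)) :
    Tr B carryProg (I.D * (200 * (I.n + 1) + 24) + 10) σ fun τ =>
      τ.var vFin = 1 ∧ I.Full 0 (σ.arr aDig) st (I.row τ 0) ∨
      τ.var vFin = 0 ∧ Searching I side τ ∧
        digVal (τ.arr aDig) I.D = digVal (σ.arr aDig) I.D + 1 := by
  have hB := hR.lin
  set dig := σ.arr aDig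
  have h1 : Tr B (.assign vLv (.var vD) ;; .assign vFin 1) 4 σ
      fun τ => τ = (σ.setVar vLv I.D).setVar vFin 1 := by
    refine (Tr.of_wp ?_).conseq (by decide) (fun _ h _ => h)
    simp only [Prog.wp]
    simp [hσ.D]
    omega
  refine h1.seq (T₂ := I.D * (200 * (I.n + 1) + 20 + 3 + 1) + 3 + 1) (fun τ₁ h₁ hf₁ => ?_)
    (by rw [show 200 * (I.n + 1) + 20 + 3 + 1 = 200 * (I.n + 1) + 24 by ring]; omega)
  have hσ₁ := hσ.of_frame hf₁ rfl
  have harr : τ₁.arr = σ.arr := by simp [h₁]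
  have hrow : I.row τ₁ = I.row σ := by
    funext i v
    simp [Inst.row, harr]
  have h0 : CarryUp I dig st raw I.D τ₁ := by
    refine ⟨fun j _ => by rw [harr], by omega, fun v hv _ => by rw [hrow]; exact hr v hv, ?_, ?_⟩
    · rw [hrow]
      -- At level `D` the row consists of raw entries only, so it is complete at once.
      exact (Inst.Part.top hI).full hI hst hraw fun v hv h => by rw [← hr v hv, h]
    · rw [hrow]
      exact hp
  -- The potential is the current level, and `0` as soon as a digit has been raised.
  refine (Tr.loop (e := .var vLv * .var vFin) (T := 200 * (I.n + 1) + 20)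
    (fun k τ => ∃ l ≤ I.D, τ.var vLv = l ∧ (∀ v < I.n, ∀ i, I.row τ i v ≤ 2) ∧
      (τ.var vFin = 1 ∧ k = l ∧ CarryUp I dig st raw l τ ∨
        τ.var vFin = 0 ∧ k = 0 ∧ CarryDone I dig st l τ)) (k := I.D)
    ⟨I.D, le_rfl, by simp [h₁], by rw [hrow]; exact hs, .inl ⟨by simp [h₁], rfl, h0⟩⟩ ?_).conseq
    le_rfl ?_
  · rintro k τ ⟨l, hl, hlv, hs', hc⟩ hf
    have hfin : τ.var vFin ≤ 1 := by rcases hc with h | h <;> omega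
    refine ⟨?_, fun he => ?_⟩
    · have : l * τ.var vFin ≤ l * 1 := Nat.mul_le_mul_left _ hfin
      simp [hlv]
      omega
    · rcases hc with ⟨h1, rfl, hc⟩ | ⟨h1, -, -⟩
      · have hk : k ≠ 0 := by
          rintro rfl
          simp [hlv] at he
        obtain ⟨l, rfl⟩ := Nat.exists_eq_succ_of_ne_zero hk
        refine (Tr.carryBody hI hR (hσ₁.of_frame hf rfl) hlv h1 hl hs' hdig hst hraw hc).conseq
          le_rfl ?_
        rintro υ ⟨h2, h3, h4⟩ -
        rcases h4 with ⟨h4, h5⟩ | ⟨h4, h5⟩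
        · exact ⟨l, by omega, l, by omega, h2, h3, .inl ⟨h4, rfl, h5⟩⟩
        · exact ⟨0, by omega, l, by omega, h2, h3, .inr ⟨h4, rfl, h5⟩⟩
      · simp [h1] at he
  · rintro τ ⟨⟨k, l, hl, hlv, hs', hc⟩, he⟩ hf
    rcases hc with ⟨h1, rfl, hc⟩ | ⟨h1, -, hc⟩
    · simp [h1, hlv] at he
      subst he
      exact .inl ⟨h1, hc.full⟩
    · refine .inr ⟨h1, ⟨hσ₁.of_frame hf rfl, fun i hi => ?_, hs', fun i hi st' hst' => ?_⟩,
        digVal_carry hc.lt (fun i hi => hc.low i (.inl hi)) hc.mid hc.high⟩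
      · rcases lt_trichotomy i l with h | rfl | h
        · rw [hc.low i (.inl h)]
          exact hdig i hi
        · exact hc.mid_le
        · rcases hi.lt_or_eq with h' | rfl
          · rw [(hc.high i h h').1]
            omega
          · rw [hc.low _ (.inr le_rfl)]
            exact hdig _ hi
      -- Rows up to `l` depend only on digits and states above depth `l`, which the carry has not
      -- changed; the deeper digits are `0`, so nothing is required of their rows.
      · have hag : ∀ j < l, dig j = τ.arr aDig j := fun j hj => (hc.low j (.inl hj)).symm
        have hst2 := hst.eq_of_agree hI hst' hag
        rcases lt_trichotomy i l with h | rfl | h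
        · rw [hc.low i (.inl h)]
          exact (hc.part i h).congr hI (fun j hj => hag j (by omega))
            (fun v hv hd => hst2 v hv (by omega)) fun _ _ _ => rfl
        · rw [hc.mid]
          exact hc.part_l.congr hI hag hst2 fun _ _ _ => rfl
        · rw [(hc.high i h hi).1]
          exact Inst.Part.zero

/-- The digit string read as a ternary number increases by one per round and stays below `3 ^ D`,
which bounds the rounds by `3 ^ D`. -/
lemma Tr.searchProg (hI : I.Valid) (hR : I.Room B) (hσ : Searching I side σ)
    (hs : I.Sides side) :
    Tr B searchProg (3 ^ I.D * (3000 * ((I.D + 1) * (I.n + I.m + 1))) + 6) σ fun τ =>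
      ∃ dig st, I.Full 0 dig st (I.row τ 0) := by
  have hB := hR.lin
  have h1 : Tr B (.assign vFin 0) 2 σ fun τ => τ = σ.setVar vFin 0 := by
    refine (Tr.of_wp (p := .assign vFin 0) ?_).conseq (by decide) (fun _ h _ => h)
    simp only [Prog.wp]
    simp
    omega
  set T := 2000 * ((I.D + 1) * (I.n + I.m + 1)) + (I.D * (200 * (I.n + 1) + 24) + 10) with hT
  have hT' : T + 3 + 1 ≤ 3000 * ((I.D + 1) * (I.n + I.m + 1)) := by
    have : I.D * I.n + I.D * I.m + I.D + I.n + I.m + 1 = (I.D + 1) * (I.n + I.m + 1) := by ring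
    have h' : T = 2000 * ((I.D + 1) * (I.n + I.m + 1)) + (200 * (I.D * I.n) + 224 * I.D + 10) := by
      rw [hT]
      ring
    omega
  refine h1.seq (T₂ := 3 ^ I.D * (T + 3 + 1) + 3 + 1) (fun τ₁ h₁ hf₁ => ?_)
    (by have := Nat.mul_le_mul_left (3 ^ I.D) hT'; omega)
  subst h₁
  refine (Tr.loop (e := .eq (.var vFin) 0) (T := T)
    (fun k τ => τ.var vFin = 0 ∧ Searching I side τ ∧ k + digVal (τ.arr aDig) I.D = 3 ^ I.D ∨
      τ.var vFin = 1 ∧ k = 0 ∧ ∃ dig st, I.Full 0 dig st (I.row τ 0)) (k := 3 ^ I.D - digVal (σ.arr aDig) I.D)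
    (.inl ⟨by simp, ⟨hσ.static.of_frame hf₁ rfl, hσ.dig_le, hσ.sol_le, hσ.part⟩, ?_⟩) ?_).conseq
    ?_ ?_
  · have := digVal_lt fun i hi => hσ.dig_le i (le_of_lt hi)
    simp only [Memory.arr_setVar]
    omega
  · rintro k τ h hf
    refine ⟨?_, fun he => ?_⟩
    · simp [show 1 < B by omega]
      rcases h with h | h <;> omega
    · rcases h with ⟨h1, h2, h3⟩ | ⟨h1, -, -⟩
      swap
      · simp [h1] at he
      have hlt := digVal_lt fun i hi => h2.dig_le i (le_of_lt hi)
      refine (Tr.evalProg hI hR h2.static hs h2.dig_le).seq ?_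
      rintro υ ⟨st, raw, hst, hraw, hsol⟩ hfυ
      have hdig : υ.arr aDig = τ.arr aDig := hfυ.arr _ rfl
      rw [← hdig] at hst
      have hrow : ∀ v < I.n, ∀ i, I.row υ i v = if i = I.rl v then raw v else I.row τ i v := hsol
      refine (Tr.carryProg hI hR (h2.static.of_frame hfυ rfl) ?_ (by rw [hdig]; exact h2.dig_le)
        hst hraw ?_ ?_).conseq le_rfl ?_
      · intro v hv i
        rw [hrow v hv i]
        split_ifs
        · exact hraw.le v hv
        · exact h2.sol_le v hv i
      · intro v hv
        rw [hrow v hv, if_pos rfl]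
      · intro i hi
        rw [hdig] at hst ⊢
        -- The evaluation changes, for each vertex, only the row of its level, whereas `Part i`
        -- looks at vertices of level above `i`.
        refine (h2.part i hi st hst).congr hI (fun _ _ => rfl) (fun _ _ _ => rfl) fun v hv hr => ?_
        rw [hrow v hv, if_neg (by omega)]
      · rintro ω (⟨h4, h5⟩ | ⟨h4, h5, h6⟩) -
        · exact ⟨0, by omega, .inr ⟨h4, rfl, _, _, h5⟩⟩
        · rw [hdig] at h6
          exact ⟨k - 1, by omega, .inl ⟨h4, h5, by omega⟩⟩
  · have : (3 ^ I.D - digVal (σ.arr aDig) I.D) * (T + 3 + 1) ≤ 3 ^ I.D * (T + 3 + 1) :=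
      Nat.mul_le_mul_right _ (Nat.sub_le _ _)
    exact Nat.add_le_add_right (Nat.add_le_add_right this 3) 1
  · rintro τ ⟨⟨k, h⟩, he⟩ -
    rcases h with ⟨h, -, -⟩ | ⟨-, -, h⟩
    · simp [h] at he
    · exact h

lemma Tr.outProg (hR : I.Room B) (hσ : Static I side σ) (hs : ∀ v < I.n, I.row σ 0 v ≤ 2) :
    Tr B outProg (I.n * 30 + 10) σ fun τ => τ.var vCnt = #{v ∈ range I.n | I.row σ 0 v = 0} ∧
      (range #{v ∈ range I.n | I.row σ 0 v = 0}).image (τ.arr aOut) =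
        {v ∈ range I.n | I.row σ 0 v = 0} := by
  have hB := hR.lin
  have h1 : Tr B (.assign vCnt 0) 2 σ fun τ => τ = σ.setVar vCnt 0 := by
    refine (Tr.of_wp (p := .assign vCnt 0) ?_).conseq (by decide) (fun _ h _ => h)
    simp only [Prog.wp]
    simp
    omega
  refine h1.seq (T₂ := I.n * (20 + 8) + 6) (fun τ₁ h₁ hf₁ => ?_) (by omega)
  subst h₁
  have hσ₁ := hσ.of_frame hf₁ rfl
  refine Tr.forP (fun k τ => τ.var vCnt = #{v ∈ range k | I.row σ 0 v = 0} ∧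
      (range #{v ∈ range k | I.row σ 0 v = 0}).image (τ.arr aOut) =
        {v ∈ range k | I.row σ 0 v = 0}) rfl rfl hσ₁.n (by omega) (by simp) ?_
  rintro k τ hk hf hv ⟨h1, h2⟩
  have hsol : τ.arr aSol k = I.row σ 0 k := by
    rw [hf.arr _ rfl, Inst.row]
    simp
  have hk2 := hs k hk
  have hcard : #{v ∈ range k | I.row σ 0 v = 0} ≤ k := by
    simpa using card_filter_le (range k) fun v => I.row σ 0 v = 0
  refine (Tr.wp_intro fun R hQ => ?_).conseq (by decide) (fun _ h _ => h)
  simp only [Prog.wp]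
  simp [hv, hsol, h1]
  refine ⟨by omega, fun h4 => hQ _ ?_, fun h4 => ⟨by omega, by omega, hQ _ ?_⟩⟩
  · rw [range_add_one, filter_insert, if_neg h4]
    exact ⟨by simpa using h1, by simpa using h2⟩
  · rw [range_add_one, filter_insert, if_pos h4, card_insert_of_notMem (by simp)]
    refine ⟨by simp, ?_⟩
    rw [range_add_one, image_insert]
    congr 1
    · simp
    · conv_rhs => rw [← h2]
      refine image_congr fun x hx => ?_
      have : x < #{v ∈ range k | I.row σ 0 v = 0} := by simpa using hx
      simp [show x ≠ #{v ∈ range k | I.row σ 0 v = 0} by omega]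

end OddCycleTransversal

namespace OddCycleTransversal

open Finset

/-! ### Construction of the network -/

notation "vX" => (42 : ℕ)
notation "vY" => (43 : ℕ)

/-- The memory holds the instance. -/
structure Core (I : Inst) (σ : Memory) : Prop where
  n : σ.var vN = I.n
  m : σ.var vM = I.m
  D : σ.var vD = I.D
  dep : σ.arr aDep = I.dep
  anc : σ.arr aAnc = I.ancA
  rl : σ.arr aRl = I.rl
  up : σ.arr aUp = I.up
  lo : σ.arr aLo = I.lo

lemma Core.of_frame {I : Inst} {σ τ : Memory} {p : Prog} (h : Core I σ) (hf : Frame p σ τ)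
    (hp : p.keeps [vN, vM, vD] [aDep, aAnc, aRl, aUp, aLo] = true) : Core I τ := by
  simp only [Prog.keeps, List.all_cons, List.all_nil, Bool.and_true, Bool.and_eq_true,
    Bool.not_eq_true'] at hp
  obtain ⟨⟨v0, v1, v2⟩, a0, a1, a2, a3, a4⟩ := hp
  constructor <;>
    simp only [hf.var _ v0, hf.var _ v1, hf.var _ v2, hf.arr _ a0, hf.arr _ a1, hf.arr _ a2,
      hf.arr _ a3, hf.arr _ a4]
  exacts [h.n, h.m, h.D, h.dep, h.anc, h.rl, h.up, h.lo]

def constProg : Prog :=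
  .assign vArcs (2 * .var vM + .var vN) ;;
  .assign vHalf (2 * .var vArcs) ;;
  .assign vNodes (4 * .var vN) ;;
  .assign vD1 (.var vD + 1)

def endsBody : Prog :=
  .ite (.eq (.read aDep (.read aUp (.var vI))) (.read aDep (.read aLo (.var vI))))
    (.assign vX (4 * .read aUp (.var vI) + 1) ;;
     .assign vY (4 * .read aUp (.var vI)) ;;
     .store aOwn (2 * .var vI + 1) (.read aUp (.var vI)))
    (.assign vX (4 * .read aAnc (.read aDep (.read aLo (.var vI)) * .var vN +
        .read aLo (.var vI)) + 2) ;;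
     .assign vY (.var vX + 1) ;;
     .store aOwn (2 * .var vI + 1) (.read aLo (.var vI)))

def arcBody : Prog :=
  .store aOwn (2 * .var vI) (.read aLo (.var vI)) ;;
  .store aSrc (4 * .var vI) (.var vX) ;;
  .store aSrc (4 * .var vI + 1) (4 * .read aLo (.var vI)) ;;
  .store aSrc (4 * .var vI + 2) (4 * .read aLo (.var vI) + 1) ;;
  .store aSrc (4 * .var vI + 3) (.var vY) ;;
  .store aDst (4 * .var vI) (4 * .read aLo (.var vI)) ;;
  .store aDst (4 * .var vI + 1) (.var vX) ;;
  .store aDst (4 * .var vI + 2) (.var vY) ;;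
  .store aDst (4 * .var vI + 3) (4 * .read aLo (.var vI) + 1)

def vertexBody : Prog :=
  .store aOwn (2 * .var vM + .var vI) (.var vI) ;;
  .store aSrc (4 * .var vM + 2 * .var vI) (4 * .var vI) ;;
  .store aSrc (4 * .var vM + 2 * .var vI + 1) (4 * .var vI + 1) ;;
  .store aDst (4 * .var vM + 2 * .var vI) (4 * .var vI + 1) ;;
  .store aDst (4 * .var vM + 2 * .var vI + 1) (4 * .var vI)

def linkProg : Prog := forP vI vHalf
  (.store aNxt (.var vI) (.read aFst (.read aSrc (.var vI))) ;;
   .store aFst (.read aSrc (.var vI)) (.var vI + 1))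

def arcsProg : Prog := forP vI vM (endsBody ;; arcBody) ;; forP vI vN vertexBody

variable {I : Inst} {B : ℕ} {σ : Memory}

namespace Inst

lemma hsrc_even (a : ℕ) : I.hsrc (2 * a) = I.tl a := by simp [hsrc]

lemma hsrc_odd (a : ℕ) : I.hsrc (2 * a + 1) = I.hd a := by
  simp [hsrc, show (2 * a + 1) % 2 = 1 by omega, show (2 * a + 1) / 2 = a by omega]

lemma hdst_even (a : ℕ) : I.hdst (2 * a) = I.hd a := by simp [hdst]

lemma hdst_odd (a : ℕ) : I.hdst (2 * a + 1) = I.tl a := by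
  simp [hdst, show (2 * a + 1) % 2 = 1 by omega, show (2 * a + 1) / 2 = a by omega]

end Inst

lemma Tr.endsBody (hI : I.Valid) (hR : I.Room B) (hσ : Core I σ) {i : ℕ} (hi : i < I.m)
    (hv : σ.var vI = i) :
    Tr B endsBody 50 σ fun τ => τ.var vX = I.tl (2 * i) ∧ τ.var vY = I.hd (2 * i + 1) ∧
      τ.arr aOwn (2 * i + 1) = I.own (2 * i + 1) ∧
      ∀ a, a ≠ 2 * i + 1 → τ.arr aOwn a = σ.arr aOwn a := by
  have hB := hR.lin
  have hu := hI.up_lt i hi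
  have hw := hI.lo_lt i hi
  have hdu := hI.dep_le_D hu
  have hdw := hI.dep_le_D hw
  have hidx := hR.idx_lt (i := I.dep (I.lo i)) (by omega) hw
  have hrep := hI.rep_lt hw
  have e : I.ancA (I.dep (I.lo i) * I.n + I.lo i) = I.rep (I.lo i) := rfl
  rw [Inst.tl_even hi, Inst.hd_odd hi, Inst.own_odd hi]
  refine (Tr.wp_intro fun R hQ => ?_).conseq (by decide) (fun _ h _ => h)
  simp only [OddCycleTransversal.endsBody, Prog.wp]
  simp [hv, hσ.dep, hσ.up, hσ.lo, hσ.n, hσ.anc, e, show 1 < B by omega]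
  refine ⟨by omega, fun h => ⟨by omega, by omega, by omega, hQ _ ?_⟩,
    fun h => ⟨by omega, by omega, by omega, hQ _ ?_⟩⟩
  · rw [if_pos (show I.Same i from h), if_pos (show I.Same i from h), if_pos (show I.Same i from h)]
    simp +contextual
  · rw [if_neg (show ¬ I.Same i from h), if_neg (show ¬ I.Same i from h),
      if_neg (show ¬ I.Same i from h)]
    simp +contextual

lemma Tr.arcBody (hI : I.Valid) (hR : I.Room B) (hσ : Core I σ) {i : ℕ} (hi : i < I.m)
    (hv : σ.var vI = i) (hx : σ.var vX = I.tl (2 * i)) (hy : σ.var vY = I.hd (2 * i + 1)) :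
    Tr B arcBody 100 σ fun τ => τ.arr aOwn (2 * i) = I.own (2 * i) ∧
      (∀ a, a ≠ 2 * i → τ.arr aOwn a = σ.arr aOwn a) ∧
      (∀ h, 4 * i ≤ h → h < 4 * (i + 1) → τ.arr aSrc h = I.hsrc h ∧ τ.arr aDst h = I.hdst h) ∧
      ∀ h < 4 * i, τ.arr aSrc h = σ.arr aSrc h ∧ τ.arr aDst h = σ.arr aDst h := by
  have hB := hR.lin
  have hw := hI.lo_lt i hi
  have l1 := hI.tl_lt (a := 2 * i) (by unfold Inst.arcs; omega)
  have l2 := hI.hd_lt (a := 2 * i + 1) (by unfold Inst.arcs; omega)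
  rw [Inst.own_even hi]
  refine (Tr.wp_intro fun R hQ => ?_).conseq (by decide) (fun _ h _ => h)
  simp only [OddCycleTransversal.arcBody, Prog.wp]
  simp [hv, hσ.lo, hx, hy]
  refine ⟨by omega, by omega, by omega, by omega, by omega, by omega, by omega, by omega, by omega,
    hQ _ ⟨by simp, fun a ha => by simp [ha], fun h h1 h2 => ?_, fun h h1 => ?_⟩⟩
  · have e1 : I.hsrc (4 * i) = I.tl (2 * i) := by rw [← Inst.hsrc_even]; congr 1; ring
    have e2 : I.hsrc (4 * i + 1) = 4 * I.lo i := by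
      rw [← Inst.hd_even hi, ← Inst.hsrc_odd]; congr 1; ring
    have e3 : I.hsrc (4 * i + 2) = 4 * I.lo i + 1 := by
      rw [← Inst.tl_odd hi, ← Inst.hsrc_even]; congr 1; ring
    have e4 : I.hsrc (4 * i + 3) = I.hd (2 * i + 1) := by rw [← Inst.hsrc_odd]; congr 1; ring
    have f1 : I.hdst (4 * i) = 4 * I.lo i := by
      rw [← Inst.hd_even hi, ← Inst.hdst_even]; congr 1; ring
    have f2 : I.hdst (4 * i + 1) = I.tl (2 * i) := by rw [← Inst.hdst_odd]; congr 1; ring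
    have f3 : I.hdst (4 * i + 2) = I.hd (2 * i + 1) := by rw [← Inst.hdst_even]; congr 1; ring
    have f4 : I.hdst (4 * i + 3) = 4 * I.lo i + 1 := by
      rw [← Inst.tl_odd hi, ← Inst.hdst_odd]; congr 1; ring
    obtain rfl | rfl | rfl | rfl : h = 4 * i ∨ h = 4 * i + 1 ∨ h = 4 * i + 2 ∨ h = 4 * i + 3 := by
      omega
    · simp [e1, f1]
    · simp [e2, f2]
    · simp [e3, f3]
    · simp [e4, f4]
  · simp [show h ≠ 4 * i by omega, show h ≠ 4 * i + 1 by omega, show h ≠ 4 * i + 2 by omega,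
      show h ≠ 4 * i + 3 by omega]

lemma Tr.arcsProg (hI : I.Valid) (hR : I.Room B) (hσ : Core I σ) :
    Tr B arcsProg (300 * (I.n + I.m + 1)) σ fun τ =>
      (∀ h < 2 * I.arcs, τ.arr aSrc h = I.hsrc h ∧ τ.arr aDst h = I.hdst h) ∧
      ∀ a < I.arcs, τ.arr aOwn a = I.own a := by
  have hB := hR.lin
  have harcs : I.arcs = 2 * I.m + I.n := rfl
  refine (Tr.forP (T := 50 + 100) (fun k τ =>
    (∀ h < 4 * k, τ.arr aSrc h = I.hsrc h ∧ τ.arr aDst h = I.hdst h) ∧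
      ∀ a < 2 * k, τ.arr aOwn a = I.own a) rfl rfl hσ.m (by omega) (by simp) ?_).seq
    (T₂ := I.n * (60 + 8) + 6) ?_ (by omega)
  · rintro k τ hk hf hv ⟨h1, h2⟩
    have hτ := hσ.of_frame hf rfl
    refine (Tr.endsBody hI hR hτ hk hv).seq ?_
    rintro τ₁ ⟨hx, hy, h3, h4⟩ hf₁
    refine (Tr.arcBody hI hR (hτ.of_frame hf₁ rfl) hk (by rw [hf₁.var _ rfl, hv]) hx hy).conseq
      le_rfl ?_
    rintro τ₂ ⟨h5, h6, h7, h8⟩ -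
    simp only [Memory.arr_setVar]
    refine ⟨fun h hh => ?_, fun a ha => ?_⟩
    · by_cases hlt : h < 4 * k
      · rw [(h8 h hlt).1, (h8 h hlt).2, hf₁.arr aSrc rfl, hf₁.arr aDst rfl]
        exact h1 h hlt
      · exact h7 h (by omega) (by omega)
    · by_cases e1 : a = 2 * k
      · rw [e1]
        exact h5
      · rw [h6 a e1]
        by_cases e2 : a = 2 * k + 1
        · rw [e2]
          exact h3
        · rw [h4 a e2]
          exact h2 a (by omega)
  · rintro τ₁ ⟨h1, h2⟩ hf₁
    have hσ₁ := hσ.of_frame hf₁ rfl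
    refine (Tr.forP (T := 60) (fun k τ =>
      (∀ h < 4 * I.m + 2 * k, τ.arr aSrc h = I.hsrc h ∧ τ.arr aDst h = I.hdst h) ∧
      ∀ a < 2 * I.m + k, τ.arr aOwn a = I.own a) rfl rfl hσ₁.n (by omega) ⟨h1, h2⟩ ?_).conseq
      le_rfl ?_
    · rintro k τ hk hf hv ⟨h1, h2⟩
      have hτ := hσ₁.of_frame hf rfl
      refine (Tr.wp_intro fun R hQ => ?_).conseq (by decide) (fun _ h _ => h)
      simp only [vertexBody, Prog.wp]
      simp [hv, hτ.m]
      refine ⟨by omega, by omega, by omega, by omega, by omega, hQ _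
        ⟨fun h hh => ?_, fun a ha => ?_⟩⟩
      · have e : 4 * I.m + 2 * k = 2 * (2 * I.m + k) := by ring
        by_cases h3 : h = 2 * (2 * I.m + k)
        · simp [h3, e, Inst.hsrc_even, Inst.hdst_even, Inst.tl_vertex, Inst.hd_vertex]
        · by_cases h4 : h = 2 * (2 * I.m + k) + 1
          · simp [h4, e, Inst.hsrc_odd, Inst.hdst_odd, Inst.tl_vertex, Inst.hd_vertex]
          · simpa [h3, h4, e] using h1 h (by omega)
      · by_cases h3 : a = 2 * I.m + k
        · simp [h3, Inst.own_vertex]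
        · simpa [h3] using h2 a (by omega)
    · rintro τ ⟨h1, h2⟩ -
      exact ⟨fun h hh => h1 h (by omega), fun a ha => h2 a (by omega)⟩

/-- Scanning the arcs by increasing number and putting each at the head of its list leaves the lists
decreasing. The head before an insertion is the previous arc with the same source. -/
lemma Tr.linkProg {X H : ℕ} {hs : ℕ → ℕ} (hB : X + H + 2 < B) (hH : σ.var vHalf = H)
    (hsrc : ∀ h < H, σ.arr aSrc h = hs h) (hlt : ∀ h < H, hs h < X)
    (hfst : ∀ x < X, σ.arr aFst x = 0) :
    Tr B linkProg (30 * (H + 1)) σ fun τ => Links X H hs (τ.arr aFst) (τ.arr aNxt) := by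
  refine (Tr.forP (T := 20) (fun k τ => (∀ x < X, IsPrev hs x k (τ.arr aFst x)) ∧
    ∀ h < k, IsPrev hs (hs h) h (τ.arr aNxt h)) rfl rfl hH (by omega) ⟨?_, by simp⟩ ?_).conseq
    (by omega) (fun τ h _ => ⟨h.1, h.2⟩)
  · intro x hx
    simp only [Memory.arr_setVar, hfst x hx]
    exact ⟨le_rfl, by simp, by simp⟩
  · rintro k τ hk hf hv ⟨h1, h2⟩
    have e : τ.arr aSrc k = hs k := by rw [hf.arr _ rfl, hsrc k hk]
    have hx := hlt k hk
    have hp := h1 _ hx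
    have hle := hp.le
    refine (Tr.wp_intro fun R hQ => ?_).conseq (by decide) (fun _ h _ => h)
    simp only [Prog.wp]
    simp [hv, e]
    refine ⟨by omega, by omega, hQ _ ⟨fun x hx => ?_, fun h hh => ?_⟩⟩
    · by_cases hxk : x = hs k
      · simp only [Memory.arr_setVar, Memory.arr_setArr, hxk]
        simp only [if_true, show ¬ (14 : ℕ) = 15 by decide, if_false]
        exact ⟨le_rfl, by simp, fun h h3 h4 => by omega⟩
      · have := h1 x hx
        simp only [Memory.arr_setVar, Memory.arr_setArr]
        simp only [if_true, show ¬ (14 : ℕ) = 15 by decide, if_false, hxk]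
        refine ⟨by have := this.le; omega, this.src, fun h h3 h4 => ?_⟩
        rcases Nat.lt_succ_iff_lt_or_eq.1 h4 with h5 | rfl
        · exact this.max h h3 h5
        · exact fun h6 => hxk h6.symm
    · by_cases hhk : h = k
      · subst hhk
        simpa using hp
      · simpa [hhk] using h2 h (by omega)

/-! ### The 2-colouring of the bags -/

def sameProg : Prog := forP vI vM
  (.ite (.eq (.read aDep (.read aUp (.var vI))) (.read aDep (.read aLo (.var vI))))
    (.store aEn (4 * .var vI) 1 ;; .store aEn (4 * .var vI + 1) 1 ;;
     .store aEn (4 * .var vI + 2) 1 ;; .store aEn (4 * .var vI + 3) 1)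
    .skip)

def sideProg : Prog := forP vI vN (.store aSide (.var vI) (.read aVis (4 * .var vI + 1)))

def netProg : Prog :=
  constProg ;; arcsProg ;; linkProg ;; sameProg ;; bfs 0 1 ;; sideProg

/-! ### The search in the bipartite double cover of the bags -/

namespace Inst

/-- The visited nodes of the double cover are compatible with a 2-colouring of the bags. -/
def Compatible (I : Inst) (vis : ℕ → ℕ) : Prop :=
  ∃ c : ℕ → ℕ, (∀ i < I.m, I.Same i → (c (I.up i) = 0 ↔ c (I.lo i) ≠ 0)) ∧
    ∀ v < I.n, (vis (4 * v) = 1 → c v = 0) ∧ (vis (4 * v + 1) = 1 → c v ≠ 0)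

/-- Restricted to edges inside bags, the network is the double cover: every half arc joins the entry
of one end to the exit of the other. -/
lemma half_arc {h : ℕ} (hh : h < 4 * I.m) (hs : I.Same (h / 4)) :
    (I.hsrc h = 4 * I.up (h / 4) + 1 ∧ I.hdst h = 4 * I.lo (h / 4)) ∨
    (I.hsrc h = 4 * I.lo (h / 4) ∧ I.hdst h = 4 * I.up (h / 4) + 1) ∨
    (I.hsrc h = 4 * I.lo (h / 4) + 1 ∧ I.hdst h = 4 * I.up (h / 4)) ∨
    (I.hsrc h = 4 * I.up (h / 4) ∧ I.hdst h = 4 * I.lo (h / 4) + 1) := by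
  obtain ⟨i, h1⟩ : ∃ i, i = h / 4 := ⟨_, rfl⟩
  rw [← h1] at hs ⊢
  have hi : i < I.m := by omega
  obtain rfl | rfl | rfl | rfl : h = 2 * (2 * i) ∨ h = 2 * (2 * i) + 1 ∨ h = 2 * (2 * i + 1) ∨
    h = 2 * (2 * i + 1) + 1 := by omega
  · left
    rw [hsrc_even, hdst_even, tl_even hi, hd_even hi, if_pos hs]
    exact ⟨rfl, rfl⟩
  · right; left
    rw [hsrc_odd, hdst_odd, tl_even hi, hd_even hi, if_pos hs]
    exact ⟨rfl, rfl⟩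
  · right; right; left
    rw [hsrc_even, hdst_even, tl_odd hi, hd_odd hi, if_pos hs]
    exact ⟨rfl, rfl⟩
  · right; right; right
    rw [hsrc_odd, hdst_odd, tl_odd hi, hd_odd hi, if_pos hs]
    exact ⟨rfl, rfl⟩

/-- Enabled arcs change both the layer and the end of an edge, so the colouring that explains the
visited nodes predicts each new one. At a new seed, the visited vertices form a union of components,
and the colouring may be swapped on the remaining vertices to give the seed colour `0`. -/
lemma compatible_stable (hI : I.Valid) {hs hd en : ℕ → ℕ} (hhs : ∀ h < 2 * I.arcs, hs h = I.hsrc h)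
    (hhd : ∀ h < 2 * I.arcs, hd h = I.hdst h)
    (hen : ∀ h < 2 * I.arcs, en h ≠ 0 ↔ h < 4 * I.m ∧ I.Same (h / 4)) :
    BfsStable I.n (2 * I.arcs) 0 1 hs hd en I.Compatible where
  arc vis := by
    rintro ⟨c, h1, h2⟩ h hh he hv hv'
    obtain ⟨h3, h4⟩ := (hen h hh).1 he
    refine ⟨c, h1, fun v hvn => ?_⟩
    have h5 := h1 (h / 4) (by omega) h4
    have hu := hI.up_lt (h / 4) (by omega)
    have hw := hI.lo_lt (h / 4) (by omega)
    have h6 := h2 _ hu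
    have h7 := h2 _ hw
    have h8 := h2 v hvn
    rw [hhs h hh] at hv
    rw [hhd h hh]
    constructor
    · beta_reduce
      split_ifs with e
      · intro _
        rcases half_arc h3 h4 with ⟨a, b⟩ | ⟨a, b⟩ | ⟨a, b⟩ | ⟨a, b⟩ <;> rw [a] at hv <;> rw [b] at e
        · obtain rfl : v = I.lo (h / 4) := by omega
          have := h6.2 hv
          tauto
        · omega
        · obtain rfl : v = I.up (h / 4) := by omega
          have := h7.2 hv
          tauto
        · omega
      · exact h8.1
    · beta_reduce
      split_ifs with e
      · intro _
        rcases half_arc h3 h4 with ⟨a, b⟩ | ⟨a, b⟩ | ⟨a, b⟩ | ⟨a, b⟩ <;> rw [a] at hv <;> rw [b] at e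
        · omega
        · obtain rfl : v = I.up (h / 4) := by omega
          have := h7.1 hv
          tauto
        · omega
        · obtain rfl : v = I.lo (h / 4) := by omega
          have := h6.1 hv
          tauto
      · exact h8.2
  seed vis := by
    rintro ⟨c, h1, h2⟩ hle hcl v hv hv0 hv1
    rw [add_zero] at hv0
    -- Both directions of each edge are enabled, so a closed visited set contains both ends of an
    -- edge or neither.
    have hmem : ∀ i < I.m, I.Same i → ((vis (4 * I.up i) = 1 ∨ vis (4 * I.up i + 1) = 1) ↔
        (vis (4 * I.lo i) = 1 ∨ vis (4 * I.lo i + 1) = 1)) := by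
      intro i hi hsm
      have key : ∀ h, h / 4 = i → vis (I.hsrc h) = 1 → vis (I.hdst h) = 1 := by
        intro h hh hv
        have hlt : h < 2 * I.arcs := by unfold arcs; omega
        have := hcl h hlt ((hen h hlt).2 ⟨by omega, by rw [hh]; exact hsm⟩)
        rw [hhs h hlt, hhd h hlt] at this
        exact this hv
      have k0 := key (2 * (2 * i)) (by omega)
      have k1 := key (2 * (2 * i) + 1) (by omega)
      have k2 := key (2 * (2 * i + 1)) (by omega)
      have k3 := key (2 * (2 * i + 1) + 1) (by omega)
      rw [hsrc_even, hdst_even, tl_even hi, hd_even hi, if_pos hsm] at k0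
      rw [hsrc_odd, hdst_odd, tl_even hi, hd_even hi, if_pos hsm] at k1
      rw [hsrc_even, hdst_even, tl_odd hi, hd_odd hi, if_pos hsm] at k2
      rw [hsrc_odd, hdst_odd, tl_odd hi, hd_odd hi, if_pos hsm] at k3
      tauto
    by_cases hc : c v = 0
    · refine ⟨c, h1, fun w hw => ⟨?_, ?_⟩⟩
      · beta_reduce
        split_ifs with e
        · intro _
          obtain rfl : w = v := by omega
          exact hc
        · exact (h2 w hw).1
      · beta_reduce
        rw [if_neg (by omega)]
        exact (h2 w hw).2
    · classical
      refine ⟨fun w => if vis (4 * w) = 1 ∨ vis (4 * w + 1) = 1 then c w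
        else if c w = 0 then 1 else 0, fun i hi hsm => ?_, fun w hw => ⟨?_, ?_⟩⟩
      · have h3 := h1 i hi hsm
        have h4 := hmem i hi hsm
        simp only [h4]
        split_ifs <;> simp_all
      · beta_reduce
        split_ifs with e h3 h4 h4
        · intro _
          obtain rfl : w = v := by omega
          omega
        · intro _
          obtain rfl : w = v := by omega
          exact absurd h4 hc
        · simp
        · exact (h2 w hw).1
        · tauto
        · tauto
      · beta_reduce
        rw [if_neg (by omega)]
        intro h3
        rw [if_pos (.inr h3)]
        exact (h2 w hw).2 h3

end Inst

lemma Tr.sameProg (hI : I.Valid) (hR : I.Room B) (hσ : Core I σ)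
    (hen : ∀ h < 2 * I.arcs, σ.arr aEn h = 0) :
    Tr B sameProg (60 * (I.m + 1)) σ fun τ => ∀ h < 2 * I.arcs,
      τ.arr aEn h = if h < 4 * I.m ∧ I.Same (h / 4) then 1 else 0 := by
  have hB := hR.lin
  refine (Tr.forP (T := 50) (fun k τ => ∀ h < 2 * I.arcs,
      τ.arr aEn h = if h < 4 * k ∧ I.Same (h / 4) then 1 else 0) rfl rfl hσ.m (by omega)
      (by simpa using hen) ?_).conseq (by omega) (fun _ h _ => h)
  rintro k τ hk hf hv h
  have hτ := hσ.of_frame hf rfl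
  have hu := hI.up_lt k hk
  have hw := hI.lo_lt k hk
  have hdu := hI.dep_le_D hu
  have hdw := hI.dep_le_D hw
  refine (Tr.wp_intro fun R hQ => ?_).conseq (by decide) (fun _ h _ => h)
  simp only [Prog.wp]
  simp [hv, hτ.dep, hτ.up, hτ.lo, show 1 < B by omega]
  refine ⟨by omega, fun h4 => ⟨by omega, by omega, by omega, by omega, hQ _ fun a ha => ?_⟩,
    fun h4 => hQ _ fun a ha => ?_⟩
  · simp only [Memory.arr_setVar, Memory.arr_setArr, if_true]
    by_cases hak : a / 4 = k
    · rw [hak, if_pos (⟨by omega, h4⟩ : a < 4 * (k + 1) ∧ I.Same k)]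
      split_ifs <;> omega
    · have h5 : a < 4 * (k + 1) ↔ a < 4 * k := by omega
      simp only [show a ≠ 4 * k + 3 by omega, show a ≠ 4 * k + 2 by omega,
        show a ≠ 4 * k + 1 by omega, show a ≠ 4 * k by omega, if_false, h5]
      exact h a ha
  · simp only [Memory.arr_setVar]
    rw [h a ha]
    by_cases hak : a / 4 = k
    · rw [hak, if_neg (fun h => h4 h.2), if_neg (fun h => h4 h.2)]
    · have h5 : a < 4 * (k + 1) ↔ a < 4 * k := by omega
      simp only [h5]

/-- The seeds ensure that each vertex is visited in at least one layer, and `Compatible` that it is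
visited in at most one. Whether the exit layer was visited is therefore a proper 2-colouring of the
bags. -/
lemma Tr.netProg (hI : I.Valid) (hR : I.Room B) (hσ : Core I σ)
    (hen : ∀ h < 2 * I.arcs, σ.arr aEn h = 0) (hfst : ∀ x < 4 * I.n, σ.arr aFst x = 0)
    (hvis : ∀ x < 4 * I.n, σ.arr aVis x = 0) :
    Tr B netProg (1500 * (I.n + I.m + 1)) σ fun τ =>
      Static I (τ.arr aSide) τ ∧ I.Sides (τ.arr aSide) := by
  have hB := hR.lin
  have harcs : I.arcs = 2 * I.m + I.n := rfl
  have h1 : Tr B constProg 20 σ fun τ => τ.var vArcs = I.arcs ∧ τ.var vHalf = 2 * I.arcs ∧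
      τ.var vNodes = 4 * I.n ∧ τ.var vD1 = I.D + 1 := by
    refine (Tr.wp_intro fun R hQ => ?_).conseq (by decide) (fun _ h _ => h)
    simp only [constProg, Prog.wp]
    simp [hσ.n, hσ.m, hσ.D]
    refine ⟨by omega, by omega, by omega, by omega, hQ _ ?_⟩
    simp [harcs]
  refine h1.seq (T₂ := 300 * (I.n + I.m + 1) + (30 * (2 * I.arcs + 1) + (60 * (I.m + 1) +
    (70 * (5 * I.n + 2 * I.arcs + 1) + (I.n * (20 + 8) + 6))))) ?_ (by omega)
  rintro τ₁ ⟨c1, c2, c3, c4⟩ hf₁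
  have hσ₁ := hσ.of_frame hf₁ rfl
  refine (Tr.arcsProg hI hR hσ₁).seq ?_
  rintro τ₂ ⟨h2, h2'⟩ hf₂
  have hσ₂ := hσ₁.of_frame hf₂ rfl
  have hsrc_lt : ∀ h < 2 * I.arcs, τ₂.arr aSrc h < 4 * I.n := fun h hh => by
    rw [(h2 h hh).1]
    exact hI.hsrc_lt hh
  have hdst_lt : ∀ h < 2 * I.arcs, τ₂.arr aDst h < 4 * I.n := fun h hh => by
    rw [(h2 h hh).2]
    exact hI.hdst_lt hh
  refine (Tr.linkProg (X := 4 * I.n) (H := 2 * I.arcs) (hs := τ₂.arr aSrc) (by omega)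
    (by rw [hf₂.var _ rfl, c2]) (fun _ _ => rfl) hsrc_lt
    (by rw [hf₂.arr _ rfl, hf₁.arr _ rfl]; exact hfst)).seq ?_
  intro τ₃ h3 hf₃
  have hσ₃ := hσ₂.of_frame hf₃ rfl
  refine (Tr.sameProg hI hR hσ₃
    (by rw [hf₃.arr _ rfl, hf₂.arr _ rfl, hf₁.arr _ rfl]; exact hen)).seq ?_
  intro τ₄ h4 hf₄
  have hσ₄ := hσ₃.of_frame hf₄ rfl
  have e1 : τ₄.arr aDst = τ₂.arr aDst := by rw [hf₄.arr _ rfl, hf₃.arr _ rfl]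
  have e2 : τ₄.arr aVis = σ.arr aVis := by
    rw [hf₄.arr _ rfl, hf₃.arr _ rfl, hf₂.arr _ rfl, hf₁.arr _ rfl]
  refine (Tr.bfs (n := I.n) (H := 2 * I.arcs) (J := I.Compatible) (by omega) (by omega)
    (by omega) (Inst.compatible_stable hI (fun h hh => (h2 h hh).1) (fun h hh => (h2 h hh).2)
      (fun h hh => ?_)) h3 hsrc_lt hdst_lt (fun h hh => ?_) hσ₄.n e1 (hf₄.arr _ rfl)
    (hf₄.arr _ rfl) rfl (by rw [e2]; exact hvis) ?_).seq ?_
  · rw [h4 h hh]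
    split_ifs with h <;> simp [h]
  · rw [h4 h hh]
    split_ifs <;> omega
  · obtain ⟨c, hc⟩ := hI.bip
    refine ⟨c, hc, fun v hv => ?_⟩
    rw [e2, hvis _ (by omega), hvis _ (by omega)]
    simp
  rintro τ₅ ⟨htree, -, hseed, hJ⟩ hf₅
  have hσ₅ := hσ₄.of_frame hf₅ rfl
  refine (Tr.forP (T := 20) (fun k τ => ∀ v < k, τ.arr aSide v = τ₅.arr aVis (4 * v + 1)) rfl rfl
    hσ₅.n (by omega) (by simp) ?_).conseq le_rfl ?_
  · intro k τ hk hf hv h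
    have hle := htree.le (4 * k + 1) (by omega)
    have e : τ.arr aVis = τ₅.arr aVis := hf.arr _ rfl
    refine (Tr.wp_intro fun R hQ => ?_).conseq (by decide) (fun _ h _ => h)
    simp only [Prog.wp]
    simp [hv, e]
    refine ⟨by omega, hQ _ fun v hv => ?_⟩
    by_cases hvk : v = k
    · simp [hvk]
    · simpa [hvk] using h v (by omega)
  · intro τ h6 hf₆
    have hσ₆ := hσ₅.of_frame hf₆ rfl
    have v1 : ∀ x, constProg.wVar x = true → τ.var x = τ₁.var x := by
      intro x hx
      simp only [constProg, Prog.wVar, Bool.or_eq_true, beq_iff_eq] at hx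
      rcases hx with rfl | rfl | rfl | rfl <;>
      rw [hf₆.var _ rfl, hf₅.var _ rfl, hf₄.var _ rfl, hf₃.var _ rfl, hf₂.var _ rfl]
    have a1 : τ.arr aSrc = τ₂.arr aSrc := by
      rw [hf₆.arr _ rfl, hf₅.arr _ rfl, hf₄.arr _ rfl, hf₃.arr _ rfl]
    have a2 : τ.arr aDst = τ₂.arr aDst := by
      rw [hf₆.arr _ rfl, hf₅.arr _ rfl, hf₄.arr _ rfl, hf₃.arr _ rfl]
    have a3 : τ.arr aFst = τ₃.arr aFst := by
      rw [hf₆.arr _ rfl, hf₅.arr _ rfl, hf₄.arr _ rfl]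
    have a4 : τ.arr aNxt = τ₃.arr aNxt := by
      rw [hf₆.arr _ rfl, hf₅.arr _ rfl, hf₄.arr _ rfl]
    have a5 : τ.arr aOwn = τ₂.arr aOwn := by
      rw [hf₆.arr _ rfl, hf₅.arr _ rfl, hf₄.arr _ rfl, hf₃.arr _ rfl]
    refine ⟨⟨hσ₆.n, hσ₆.m, hσ₆.D, by rw [v1 _ rfl, c2], by rw [v1 _ rfl, c3], by rw [v1 _ rfl, c4],
      by rw [v1 _ rfl, c1], hσ₆.dep, hσ₆.anc, hσ₆.rl, hσ₆.up, hσ₆.lo, rfl,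
      fun h hh => by rw [a1, (h2 h hh).1], fun h hh => by rw [a2, (h2 h hh).2],
      by rw [a1, a3, a4]; exact h3, fun a ha => by rw [a5, h2' a ha]⟩, ?_⟩
    obtain ⟨c, hc, hc'⟩ := hJ
    have key : ∀ v < I.n, τ.arr aSide v ≤ 1 ∧ (τ.arr aSide v = 0 ↔ c v = 0) := by
      intro v hv
      have q1 := htree.le (4 * v + 1) (by omega)
      have q2 := hseed v hv
      have q3 := hc' v hv
      rw [add_zero] at q2
      rw [h6 v hv]
      refine ⟨q1, fun h => q3.1 (by omega), fun h => ?_⟩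
      by_contra h'
      exact q3.2 (by omega) h
    refine ⟨fun v hv => (key v hv).1, fun i hi hs => ?_⟩
    have q1 := key _ (hI.up_lt i hi)
    have q2 := key _ (hI.lo_lt i hi)
    have q3 := hc i hi hs
    intro he
    rw [he] at q1
    tauto

end OddCycleTransversal

namespace OddCycleTransversal

open Finset

/-! ### Minimum colourings delete few vertices of each bag -/

namespace Inst

variable {I : Inst} {dig st s σ : ℕ → ℕ}

/-- As long as some leaf bag loses more than `D` vertices, delete its at most `D` ancestors instead
and 2-colour the bag; edges leave a leaf bag only upwards, so this is proper. The number of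
deletions drops strictly, so the process ends. -/
lemma exists_colouring_le (hI : I.Valid) (hle : ∀ v < I.n, σ v ≤ 2)
    (hok : ∀ e < I.m, Okc (σ (I.up e)) (σ (I.lo e))) :
    ∃ τ, I.Colouring τ ∧ #{v ∈ range I.n | τ v = 0} ≤ #{v ∈ range I.n | σ v = 0} := by
  classical
  obtain ⟨k, hk⟩ : ∃ k, #{v ∈ range I.n | σ v = 0} = k := ⟨_, rfl⟩
  induction k using Nat.strong_induction_on generalizing σ with
  | _ k ih =>
  by_cases hcap : ∀ r < I.n, I.rl r = I.dep r → I.rep r = r → I.dels r σ ≤ I.D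
  · exact ⟨σ, ⟨hle, hok, hcap⟩, le_rfl⟩
  push Not at hcap
  obtain ⟨r, hr, hrl, hrep, hd⟩ := hcap
  obtain ⟨c, hc⟩ := hI.bip
  let σ' : ℕ → ℕ := fun v => if I.rep v = r then (if c v = 0 then 1 else 2)
    else if ∃ i < I.dep r, v = I.anc r i then 0 else σ v
  have hout : ∀ v, I.rep v ≠ r → σ' v = 0 ∨ σ' v = σ v := by
    intro v hv
    simp only [σ', hv, if_false]
    split_ifs <;> simp
  -- Bag `r` gives back all its deletions, and the only new ones are among its `I.dep r` ancestors.
  have hcard : #{v ∈ range I.n | σ' v = 0} + I.dels r σ ≤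
      #{v ∈ range I.n | σ v = 0} + I.dep r := by
    have h1 : #{v ∈ range I.n | σ v = 0} = I.dels r σ +
        #{v ∈ range I.n | I.rep v ≠ r ∧ σ v = 0} := by
      rw [dels, ← card_union_of_disjoint]
      · congr 1
        ext v
        simp only [mem_filter, mem_union]
        tauto
      · rw [disjoint_filter]
        tauto
    have h2 : {v ∈ range I.n | σ' v = 0} ⊆ {v ∈ range I.n | I.rep v ≠ r ∧ σ v = 0} ∪
        (range (I.dep r)).image (I.anc r) := by
      intro v hv
      simp only [mem_filter, mem_union, mem_image, mem_range, σ'] at hv ⊢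
      obtain ⟨hv, h⟩ := hv
      split_ifs at h with h3 h5 h4
      · obtain ⟨i, hi, rfl⟩ := h4
        exact .inr ⟨i, hi, rfl⟩
      · exact .inl ⟨hv, h3, h⟩
    have h3 := (card_le_card h2).trans (card_union_le _ _)
    have h4 : #((range (I.dep r)).image (I.anc r)) ≤ I.dep r := by
      simpa using card_image_le (s := range (I.dep r)) (f := I.anc r)
    omega
  have hdr := hI.dep_le_D hr
  obtain ⟨τ, h1, h2⟩ := ih _ (by omega) (σ := σ') (fun v hv => by
      by_cases h : I.rep v = r
      · simp only [σ', h, if_true]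
        split_ifs <;> omega
      · have := hle v hv
        rcases hout v h with h | h <;> omega) (fun e he => by
      have hu := hI.up_lt e he
      have hw := hI.lo_lt e he
      by_cases hs : I.Same e
      · have h1 := hI.rep_same he hs
        by_cases h : I.rep (I.up e) = r
        · have h2 := hc e he hs
          simp only [σ', h, ← h1, if_true]
          right
          split_ifs <;> omega
        · have h2 := hok e he
          have h3 := hout _ h
          rw [h1] at h
          have h4 := hout _ h
          unfold Okc at *
          omega
      · have h : I.rep (I.up e) ≠ r := by
          intro h
          have h1 := hI.rl_rep _ hu
          have h2 := hI.dep_rep hu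
          have h3 := hI.rl_up he hs
          rw [h] at h1 h2
          omega
        by_cases h' : I.rep (I.lo e) = r
        · left
          have h1 := hI.anc_up he hs
          have h2 := hI.dep_rep hw
          have h3 := hI.dep_le e he
          have h4 : I.dep (I.up e) ≠ I.dep (I.lo e) := hs
          rw [h'] at h2
          simp only [σ', h, if_false]
          rw [if_pos]
          refine ⟨I.dep (I.up e), by omega, ?_⟩
          rw [← h', rep, hI.anc_anc _ hw _ le_rfl _ h3, h1]
        · have h2 := hok e he
          have h3 := hout _ h
          have h4 := hout _ h'
          unfold Okc at *
          omega) rfl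
  exact ⟨τ, h1, by omega⟩

lemma Full.minimum (hI : I.Valid) (h : I.Full 0 dig st s) (hle : ∀ v < I.n, σ v ≤ 2)
    (hok : ∀ e < I.m, Okc (σ (I.up e)) (σ (I.lo e))) :
    #{v ∈ range I.n | s v = 0} ≤ #{v ∈ range I.n | σ v = 0} := by
  obtain ⟨τ, h1, h2⟩ := exists_colouring_le hI hle hok
  exact (h.card_le hI h1).trans h2

end Inst

/-! ### The instance of an elimination forest -/

/-- The `j`-th node on the way from node `t` to the root; `par t - 1` is the parent of `t`. -/
def climb (par : ℕ → ℕ) (j t : ℕ) : ℕ := (fun t => par t - 1)^[j] t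

lemma climb_succ (par : ℕ → ℕ) (j t : ℕ) : climb par (j + 1) t = par (climb par j t) - 1 :=
  Function.iterate_succ_apply' _ _ _

lemma climb_add (par : ℕ → ℕ) (i j t : ℕ) : climb par i (climb par j t) = climb par (i + j) t :=
  (Function.iterate_add_apply _ _ _ _).symm

/-- An elimination forest in arrays: the ends of the edges, the node of each vertex, the parent and
the depth of each node. -/
structure ForestInput (n m N : ℕ) (eu ev bn par dN : ℕ → ℕ) : Prop where
  eu_lt : ∀ i < m, eu i < n
  ev_lt : ∀ i < m, ev i < n
  bn_lt : ∀ v < n, bn v < N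
  root : ∀ t < N, par t = 0 → dN t = 0
  step : ∀ t < N, par t ≠ 0 → par t - 1 < N ∧ dN t = dN (par t - 1) + 1
  ne : ∀ i < m, eu i ≠ ev i
  single : ∀ v < n, ∀ j, 0 < j → j ≤ dN (bn v) →
    ∃ w < n, bn w = climb par j (bn v) ∧ ∀ w' < n, bn w' = bn w → w' = w
  edge : ∀ i < m, (∃ j ≤ dN (bn (ev i)), climb par j (bn (ev i)) = bn (eu i)) ∨
    ∃ j ≤ dN (bn (eu i)), climb par j (bn (eu i)) = bn (ev i)
  bip : ∃ c : ℕ → ℕ, ∀ i < m, bn (eu i) = bn (ev i) → (c (eu i) = 0 ↔ c (ev i) ≠ 0)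

/-- The arrays of the instance are computed from those of the elimination forest; `vert t` is a
vertex in the bag of node `t`, and `inn v = 1` if there are vertices below `v`. -/
structure Built (I : Inst) (eu ev bn par dN vert inn : ℕ → ℕ) : Prop where
  vert_lt : ∀ v < I.n, vert (bn v) < I.n
  bn_vert : ∀ v < I.n, bn (vert (bn v)) = bn v
  dep : ∀ v < I.n, I.dep v = dN (bn v)
  dep_le : ∀ v < I.n, I.dep v ≤ I.D
  anc : ∀ v < I.n, ∀ j ≤ dN (bn v), I.ancA ((dN (bn v) - j) * I.n + v) = vert (climb par j (bn v))
  inn_le : ∀ v < I.n, inn v ≤ 1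
  inn_iff : ∀ w < I.n, inn w = 1 ↔
    ∃ v < I.n, ∃ j, 0 < j ∧ j ≤ dN (bn v) ∧ vert (climb par j (bn v)) = w
  rl : ∀ v < I.n, I.rl v = I.dep v + inn v
  up : ∀ i < I.m, I.up i = if I.dep (ev i) < I.dep (eu i) then ev i else eu i
  lo : ∀ i < I.m, I.lo i = if I.dep (ev i) < I.dep (eu i) then eu i else ev i

section built

variable {I : Inst} {n m N : ℕ} {eu ev bn par dN vert inn : ℕ → ℕ}

lemma ForestInput.climb_lt (h : ForestInput n m N eu ev bn par dN) {t : ℕ} (ht : t < N) {j : ℕ}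
    (hj : j ≤ dN t) : climb par j t < N ∧ dN (climb par j t) = dN t - j := by
  induction j with
  | zero => exact ⟨ht, rfl⟩
  | succ j ih =>
    obtain ⟨h1, h2⟩ := ih (by omega)
    rw [climb_succ]
    have h3 : par (climb par j t) ≠ 0 := fun h0 => by
      have := h.root _ h1 h0
      omega
    obtain ⟨h4, h5⟩ := h.step _ h1 h3
    exact ⟨h4, by omega⟩

lemma Built.bn_climb (hb : Built I eu ev bn par dN vert inn)
    (hF : ForestInput I.n I.m N eu ev bn par dN) {v : ℕ} (hv : v < I.n) {j : ℕ} (hj : j ≤ dN (bn v)) :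
    vert (climb par j (bn v)) < I.n ∧ bn (vert (climb par j (bn v))) = climb par j (bn v) := by
  rcases Nat.eq_zero_or_pos j with rfl | h0
  · exact ⟨hb.vert_lt v hv, hb.bn_vert v hv⟩
  · obtain ⟨w, hw, h1, -⟩ := hF.single v hv j h0 hj
    rw [← h1]
    exact ⟨hb.vert_lt w hw, hb.bn_vert w hw⟩

lemma Built.anc_eq (hb : Built I eu ev bn par dN vert inn) {v : ℕ} (hv : v < I.n) {i : ℕ} (hi : i ≤ I.dep v) :
    I.anc v i = vert (climb par (I.dep v - i) (bn v)) := by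
  have := hb.anc v hv (I.dep v - i) (by rw [hb.dep v hv]; omega)
  rw [← this, Inst.anc, ← hb.dep v hv]
  congr 3
  omega

lemma Built.rep_eq (hb : Built I eu ev bn par dN vert inn) {v : ℕ} (hv : v < I.n) : I.rep v = vert (bn v) := by
  rw [Inst.rep, hb.anc_eq hv le_rfl, Nat.sub_self]
  rfl

lemma Built.bn_anc (hb : Built I eu ev bn par dN vert inn)
    (hF : ForestInput I.n I.m N eu ev bn par dN) {v : ℕ} (hv : v < I.n) {i : ℕ} (hi : i ≤ I.dep v) :
    I.anc v i < I.n ∧ bn (I.anc v i) = climb par (I.dep v - i) (bn v) ∧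
      I.dep (I.anc v i) = i := by
  have hd := hb.dep v hv
  rw [hb.anc_eq hv hi]
  obtain ⟨h1, h2⟩ := hb.bn_climb hF hv (j := I.dep v - i) (by omega)
  refine ⟨h1, h2, ?_⟩
  rw [hb.dep _ h1, h2, (hF.climb_lt (hF.bn_lt v hv) (by omega)).2]
  omega

/-- The bag of a vertex with vertices below it has no other vertex. -/
lemma Built.eq_of_inn (hb : Built I eu ev bn par dN vert inn)
    (hF : ForestInput I.n I.m N eu ev bn par dN) {v w : ℕ} (hv : v < I.n) (hw : w < I.n) (hi : inn w = 1)
    (he : bn v = bn w) : v = w := by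
  obtain ⟨u, hu, j, h0, hj, rfl⟩ := (hb.inn_iff w hw).1 hi
  obtain ⟨w', hw', h1, h2⟩ := hF.single u hu j h0 hj
  obtain ⟨h3, h4⟩ := hb.bn_climb hF hu hj
  rw [h2 v hv (by rw [he, h4, h1]), h2 _ h3 (by rw [h4, h1])]

/-- Of the two ends of an edge, one node is an ancestor of the other, so comparing depths orients
the edge; equal depths leave only the case of a common bag. -/
lemma Built.edge (hb : Built I eu ev bn par dN vert inn)
    (hF : ForestInput I.n I.m N eu ev bn par dN) {i : ℕ} (hi : i < I.m) : I.up i < I.n ∧ I.lo i < I.n ∧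
    I.dep (I.up i) ≤ I.dep (I.lo i) ∧
    climb par (I.dep (I.lo i) - I.dep (I.up i)) (bn (I.lo i)) = bn (I.up i) := by
  have hu := hF.eu_lt i hi
  have hv := hF.ev_lt i hi
  have key : ∀ x y, x < I.n → y < I.n → ∀ j ≤ dN (bn y), climb par j (bn y) = bn x →
      j = I.dep y - I.dep x ∧ I.dep x ≤ I.dep y := by
    intro x y hx hy j hj he
    have h1 := (hF.climb_lt (hF.bn_lt y hy) hj).2
    rw [he, ← hb.dep x hx, ← hb.dep y hy] at h1
    rw [← hb.dep y hy] at hj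
    omega
  rw [hb.up i hi, hb.lo i hi]
  split_ifs with hlt
  · refine ⟨hv, hu, hlt.le, ?_⟩
    rcases hF.edge i hi with ⟨j, hj, he⟩ | ⟨j, hj, he⟩
    · have := key _ _ hu hv j hj he
      omega
    · rw [← (key _ _ hv hu j hj he).1, he]
  · refine ⟨hu, hv, not_lt.1 hlt, ?_⟩
    rcases hF.edge i hi with ⟨j, hj, he⟩ | ⟨j, hj, he⟩
    · rw [← (key _ _ hu hv j hj he).1, he]
    · obtain ⟨h1, h2⟩ := key _ _ hv hu j hj he
      have h3 : j = 0 := by omega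
      subst h3
      rw [show I.dep (ev i) - I.dep (eu i) = 0 by omega]
      exact he.symm

/-- A vertex counts as internal when some vertex lies below it, not when its node has children. A
node with children but no vertices below it thus becomes a leaf bag with one vertex, which is
bipartite anyway. -/
lemma Built.valid (hb : Built I eu ev bn par dN vert inn)
    (hF : ForestInput I.n I.m N eu ev bn par dN) : I.Valid where
  up_lt i hi := (hb.edge hF hi).1
  lo_lt i hi := (hb.edge hF hi).2.1
  ne i hi := by
    rw [hb.up i hi, hb.lo i hi]
    have := hF.ne i hi
    split_ifs
    · exact this.symm
    · exact this
  dep_le i hi := (hb.edge hF hi).2.2.1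
  rl_le v hv := by
    rw [hb.rl v hv]
    have h1 := hb.inn_le v hv
    have h2 := hb.dep_le v hv
    by_cases h : inn v = 1
    -- Some vertex `u` lies strictly below `v`, and its depth is at most `D`; this pays for the
    -- additional level of `v`.
    · obtain ⟨u, hu, j, h0, hj, he⟩ := (hb.inn_iff v hv).1 h
      have h3 := (hb.bn_climb hF hu hj).2
      have h4 := (hF.climb_lt (hF.bn_lt u hu) hj).2
      have h5 := hb.dep_le u hu
      rw [he] at h3
      rw [← h3, ← hb.dep v hv, ← hb.dep u hu] at h4
      rw [← hb.dep u hu] at hj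
      omega
    · omega
  rl_or v hv := by
    have h1 := hb.inn_le v hv
    have h2 := hb.rl v hv
    omega
  anc_lt v hv i hi := (hb.bn_anc hF hv hi).1
  dep_anc v hv i hi := (hb.bn_anc hF hv hi).2.2
  anc_anc v hv i hi j hj := by
    obtain ⟨h1, h2, h3⟩ := hb.bn_anc hF hv hi
    rw [hb.anc_eq h1 (by omega), h2, h3, climb_add, hb.anc_eq hv (by omega)]
    congr 2
    omega
  rep_self v hv h := by
    rw [hb.rl v hv] at h
    rw [hb.rep_eq hv]
    exact hb.eq_of_inn hF (hb.vert_lt v hv) hv (by omega) (hb.bn_vert v hv)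
  rl_anc v hv i hi := by
    obtain ⟨h1, h2, h3⟩ := hb.bn_anc hF hv hi.le
    rw [hb.rl _ h1, h3, (hb.inn_iff _ h1).2]
    refine ⟨v, hv, I.dep v - i, by omega, by rw [hb.dep v hv]; omega, ?_⟩
    rw [hb.anc_eq hv hi.le]
  rl_rep v hv := by
    have h1 := hb.vert_lt v hv
    have h2 := hb.bn_vert v hv
    have h3 := hb.inn_le v hv
    have h4 := hb.inn_le _ h1
    rw [hb.rep_eq hv, hb.rl v hv, hb.rl _ h1, hb.dep v hv, hb.dep _ h1, h2]
    by_cases h : inn v = 1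
    · rw [hb.eq_of_inn hF h1 hv h h2]
    · by_cases h' : inn (vert (bn v)) = 1
      · rw [← hb.eq_of_inn hF hv h1 h' h2.symm]
      · omega
  edge i hi := by
    obtain ⟨hu, hw, hd, he⟩ := hb.edge hF hi
    rw [hb.anc_eq hw hd, he, hb.rep_eq hu]
  bip := by
    obtain ⟨c, hc⟩ := hF.bip
    refine ⟨c, fun i hi hs => ?_⟩
    obtain ⟨hu, hw, hd, he⟩ := hb.edge hF hi
    have hs' : I.dep (I.up i) = I.dep (I.lo i) := hs
    rw [hs', Nat.sub_self] at he
    have he' : bn (I.lo i) = bn (I.up i) := he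
    rw [hb.up i hi, hb.lo i hi] at he' ⊢
    split_ifs at he' ⊢ with hlt
    · have := hc i hi he'
      tauto
    · exact hc i hi he'.symm

end built

end OddCycleTransversal

namespace OddCycleTransversal

open Finset

/-! ### Reading the elimination forest -/

notation "vT" => (44 : ℕ)
notation "vC" => (45 : ℕ)
notation "aEu" => (0 : ℕ)
notation "aEv" => (1 : ℕ)
notation "aBn" => (2 : ℕ)
notation "aParent" => (3 : ℕ)
notation "aVert" => (5 : ℕ)
notation "aInn" => (8 : ℕ)

def vertProg : Prog := forP vI vN (.store aVert (.read aBn (.var vI)) (.var vI))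

def depBody : Prog :=
  (.assign vT (.read aBn (.var vI)) ;; .assign vC 0) ;;
  .loop (.read aParent (.var vT))
    (.assign vT (.read aParent (.var vT) - 1) ;; .assign vC (.var vC + 1)) ;;
  (.store aDep (.var vI) (.var vC) ;;
   .ite (.lt (.var vD) (.var vC)) (.assign vD (.var vC)) .skip)

def depProg : Prog := .assign vD 0 ;; forP vI vN depBody

def ancBody : Prog :=
  (.assign vT (.read aBn (.var vI)) ;; .assign vC (.read aDep (.var vI)) ;;
   .store aAnc (.var vC * .var vN + .var vI) (.read aVert (.var vT))) ;;
  .loop (.read aParent (.var vT))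
    (.assign vT (.read aParent (.var vT) - 1) ;; .assign vC (.var vC - 1) ;;
     .store aAnc (.var vC * .var vN + .var vI) (.read aVert (.var vT)) ;;
     .store aInn (.read aVert (.var vT)) 1)

def ancProg : Prog := forP vI vN ancBody

def rlProg : Prog := forP vI vN
  (.store aRl (.var vI) (.read aDep (.var vI) + .read aInn (.var vI)))

def orientProg : Prog := forP vI vM
  (.ite (.lt (.read aDep (.read aEv (.var vI))) (.read aDep (.read aEu (.var vI))))
    (.store aUp (.var vI) (.read aEv (.var vI)) ;; .store aLo (.var vI) (.read aEu (.var vI)))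
    (.store aUp (.var vI) (.read aEu (.var vI)) ;; .store aLo (.var vI) (.read aEv (.var vI))))

def treeProg : Prog := vertProg ;; depProg ;; ancProg ;; rlProg ;; orientProg

/-- The memory holds the elimination forest, whose bags have depth at most `d`. -/
structure Loaded (n m N d B : ℕ) (eu ev bn par dN : ℕ → ℕ) (σ : Memory) : Prop where
  hn : σ.var vN = n
  hm : σ.var vM = m
  heu : σ.arr aEu = eu
  hev : σ.arr aEv = ev
  hbn : σ.arr aBn = bn
  hpar : σ.arr aParent = par
  input : ForestInput n m N eu ev bn par dN
  dN_le : ∀ v < n, dN (bn v) ≤ d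
  lin : 100 * (n + m + N + d + 2) < B
  idx : (d + 3) * n < B

variable {n m N d B : ℕ} {eu ev bn par dN vert : ℕ → ℕ} {σ : Memory}

lemma Loaded.of_frame {τ : Memory} {p : Prog} (h : Loaded n m N d B eu ev bn par dN σ)
    (hf : Frame p σ τ) (hp : p.keeps [vN, vM] [aEu, aEv, aBn, aParent] = true) :
    Loaded n m N d B eu ev bn par dN τ := by
  simp only [Prog.keeps, List.all_cons, List.all_nil, Bool.and_true, Bool.and_eq_true,
    Bool.not_eq_true'] at hp
  obtain ⟨⟨v0, v1⟩, a0, a1, a2, a3⟩ := hp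
  exact ⟨by rw [hf.var _ v0, h.hn], by rw [hf.var _ v1, h.hm], by rw [hf.arr _ a0, h.heu],
    by rw [hf.arr _ a1, h.hev], by rw [hf.arr _ a2, h.hbn], by rw [hf.arr _ a3, h.hpar], h.input,
    h.dN_le, h.lin, h.idx⟩

lemma ForestInput.par_le (h : ForestInput n m N eu ev bn par dN) {t : ℕ} (ht : t < N) :
    par t ≤ N := by
  by_cases h0 : par t = 0
  · omega
  · have := (h.step t ht h0).1
    omega

lemma ForestInput.par_eq_zero (h : ForestInput n m N eu ev bn par dN) {t : ℕ} (ht : t < N) :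
    par t = 0 ↔ dN t = 0 := by
  refine ⟨h.root t ht, fun h0 => ?_⟩
  by_contra hne
  have := (h.step t ht hne).2
  omega

lemma ForestInput.vert_lt (h : ForestInput n m N eu ev bn par dN)
    (hv : ∀ v < n, vert (bn v) < n) {v j : ℕ} (hvn : v < n) (hj : j ≤ dN (bn v)) :
    vert (climb par j (bn v)) < n := by
  rcases Nat.eq_zero_or_pos j with rfl | h0
  · exact hv v hvn
  · obtain ⟨w, hw, h1, -⟩ := h.single v hvn j h0 hj
    rw [← h1]
    exact hv w hw

/-- The last vertex written for a node becomes the representative of its bag; bags without vertices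
are never looked up. -/
lemma Tr.vertProg (h : Loaded n m N d B eu ev bn par dN σ) :
    Tr B vertProg (n * 20 + 6) σ fun τ => ∀ v < n,
      τ.arr aVert (bn v) < n ∧ bn (τ.arr aVert (bn v)) = bn v := by
  have hB := h.lin
  refine (Tr.forP (T := 12) (fun k τ => ∀ v < k,
      τ.arr aVert (bn v) < k ∧ bn (τ.arr aVert (bn v)) = bn v) rfl rfl h.hn (by omega) (by simp)
    ?_)
  intro k τ hk hf hv hinv
  have hτ := h.of_frame hf rfl
  have hbn := h.input.bn_lt k hk
  refine (Tr.wp_intro fun R hQ => ?_).conseq (by decide) (fun _ h _ => h)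
  simp only [Prog.wp]
  simp [hv, hτ.hbn]
  refine ⟨by omega, hQ _ fun v hv => ?_⟩
  by_cases hvk : bn v = bn k
  · simp [hvk]
  · have hne : v ≠ k := by
      rintro rfl
      exact hvk rfl
    have := hinv v (by omega)
    simp only [Memory.arr_setVar, Memory.arr_setArr, if_true, hvk, if_false]
    exact ⟨by omega, this.2⟩

lemma Tr.depBody (h : Loaded n m N d B eu ev bn par dN σ) {v : ℕ} (hv : v < n)
    (hi : σ.var vI = v) (hD : σ.var vD ≤ d) :
    Tr B depBody (d * 20 + 40) σ fun τ => τ.arr aDep v = dN (bn v) ∧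
      (∀ w, w ≠ v → τ.arr aDep w = σ.arr aDep w) ∧ dN (bn v) ≤ τ.var vD ∧
      σ.var vD ≤ τ.var vD ∧ τ.var vD ≤ d := by
  have hB := h.lin
  have hbn := h.input.bn_lt v hv
  have hdv := h.dN_le v hv
  have h1 : Tr B (.assign vT (.read aBn (.var vI)) ;; .assign vC 0) 6 σ
      fun τ => τ = (σ.setVar vT (bn v)).setVar vC 0 := by
    refine (Tr.of_wp ?_).conseq (by decide) (fun _ h _ => h)
    simp only [Prog.wp]
    simp [hi, h.hbn]
    omega
  refine h1.seq (T₂ := (dN (bn v) * (12 + 2 + 1) + 2 + 1) + 20) (fun τ₁ h₁ hf₁ => ?_) (by omega)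
  have hτ₁ := h.of_frame hf₁ rfl
  refine (Tr.loop (e := .read aParent (.var vT)) (k := dN (bn v)) (T := 12)
    (fun k τ => ∃ j, j + k = dN (bn v) ∧ τ.var vT = climb par j (bn v) ∧ τ.var vC = j)
    ⟨0, by omega, by simp [h₁, climb], by simp [h₁]⟩ ?_).seq ?_
  · rintro k τ ⟨j, hj, hT, hC⟩ hf
    have hτ := hτ₁.of_frame hf rfl
    obtain ⟨h2, h3⟩ := h.input.climb_lt hbn (j := j) (by omega)
    have h4 := h.input.par_le h2
    have h5 := h.input.par_eq_zero h2
    refine ⟨by simp [hτ.hpar, hT]; omega, fun he => ?_⟩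
    have he' : par (climb par j (bn v)) ≠ 0 := by simpa [hτ.hpar, hT] using he
    refine (Tr.wp_intro fun R hQ => ?_).conseq (by decide) (fun _ h _ => h)
    simp only [Prog.wp]
    simp [hτ.hpar, hT, hC]
    refine ⟨by omega, by omega, hQ _ ⟨k - 1, by omega, j + 1, by omega, ?_, ?_⟩⟩
    · simp [climb_succ]
    · simp
  · rintro τ ⟨⟨k, j, hj, hT, hC⟩, he⟩ hf
    have hτ := hτ₁.of_frame hf rfl
    obtain ⟨h2, h3⟩ := h.input.climb_lt hbn (j := j) (by omega)
    have he' : par (climb par j (bn v)) = 0 := by simpa [hτ.hpar, hT] using he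
    have h5 := h.input.root _ h2 he'
    have hjd : j = dN (bn v) := by omega
    have hi' : τ.var vI = v := by rw [hf.var _ rfl, hf₁.var _ rfl, hi]
    have hD' : τ.var vD = σ.var vD := by rw [hf.var _ rfl, hf₁.var _ rfl]
    have hdep : τ.arr aDep = σ.arr aDep := by rw [hf.arr _ rfl, hf₁.arr _ rfl]
    refine (Tr.wp_intro fun R hQ => ?_).conseq (by decide) (fun _ h _ => h)
    simp only [Prog.wp]
    simp [hC, hi', hD', hjd, show 1 < B by omega]
    refine ⟨by omega, by omega, fun h6 => ⟨by omega, hQ _ ?_⟩, fun h6 => hQ _ ?_⟩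
    · refine ⟨by simp, fun w hw => by simp [hw, hdep], by simp, by simp; omega, by simp; omega⟩
    · refine ⟨by simp, fun w hw => by simp [hw, hdep], by simp [hD']; omega, by simp [hD'],
        by simp [hD']; omega⟩

lemma Tr.depProg (h : Loaded n m N d B eu ev bn par dN σ) :
    Tr B depProg (n * (d * 20 + 50) + 10) σ fun τ =>
      (∀ v < n, τ.arr aDep v = dN (bn v) ∧ dN (bn v) ≤ τ.var vD) ∧ τ.var vD ≤ d := by
  have hB := h.lin
  have h1 : Tr B (.assign vD 0) 2 σ fun τ => τ = σ.setVar vD 0 := by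
    refine (Tr.of_wp (p := .assign vD 0) ?_).conseq (by decide) (fun _ h _ => h)
    simp only [Prog.wp]
    simp
    omega
  refine h1.seq (T₂ := n * ((d * 20 + 40) + 8) + 6) (fun τ₁ h₁ hf₁ => ?_) (by nlinarith)
  have hτ₁ := h.of_frame hf₁ rfl
  refine Tr.forP (fun k τ => (∀ v < k, τ.arr aDep v = dN (bn v) ∧ dN (bn v) ≤ τ.var vD) ∧
    τ.var vD ≤ d) rfl rfl hτ₁.hn (by omega) (by simp [h₁]) ?_
  rintro k τ hk hf hv ⟨h2, h3⟩
  refine (Tr.depBody (hτ₁.of_frame hf rfl) hk hv h3).conseq le_rfl ?_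
  rintro υ ⟨h4, h5, h6, h7, h8⟩ -
  refine ⟨fun v hv => ?_, by simpa using h8⟩
  by_cases hvk : v = k
  · simpa [hvk] using ⟨h4, h6⟩
  · have := h2 v (by omega)
    simp only [Memory.arr_setVar, Memory.var_setVar, show ¬ (4 : ℕ) = 10 by decide, if_false,
      h5 v hvk]
    exact ⟨this.1, by omega⟩

lemma Loaded.idx_lt (h : Loaded n m N d B eu ev bn par dN σ) {i v : ℕ} (hi : i ≤ d)
    (hv : v < n) : i * n + v < B := by
  have h1 := h.idx
  have h2 : i * n ≤ d * n := Nat.mul_le_mul_right _ hi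
  have h3 : (d + 3) * n = d * n + 3 * n := by ring
  omega

/-- The depth of `v` is already known, so the climb can fill in the ancestors at decreasing depths.
It marks every representative strictly above `v` as having a vertex below. -/
lemma Tr.ancBody (h : Loaded n m N d B eu ev bn par dN σ) (hvert : σ.arr aVert = vert)
    (hvl : ∀ v < n, vert (bn v) < n) {v : ℕ} (hv : v < n) (hi : σ.var vI = v)
    (hdep : σ.arr aDep v = dN (bn v)) (hinn : ∀ w < n, σ.arr aInn w ≤ 1) :
    Tr B ancBody (d * 40 + 40) σ fun τ =>
      (∀ j ≤ dN (bn v), τ.arr aAnc ((dN (bn v) - j) * n + v) = vert (climb par j (bn v))) ∧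
      (∀ w < n, w ≠ v → ∀ i, τ.arr aAnc (i * n + w) = σ.arr aAnc (i * n + w)) ∧
      ∀ w < n, τ.arr aInn w ≤ 1 ∧ (τ.arr aInn w = 1 ↔ σ.arr aInn w = 1 ∨
        ∃ j, 0 < j ∧ j ≤ dN (bn v) ∧ vert (climb par j (bn v)) = w) := by
  have hB := h.lin
  have hbn := h.input.bn_lt v hv
  have hdv := h.dN_le v hv
  have hix := h.idx_lt hdv hv
  have hvv := hvl v hv
  have h1 : Tr B (.assign vT (.read aBn (.var vI)) ;; .assign vC (.read aDep (.var vI)) ;;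
   .store aAnc (.var vC * .var vN + .var vI) (.read aVert (.var vT))) 20 σ
      fun τ => τ.var vT = bn v ∧ τ.var vC = dN (bn v) ∧
        τ.arr aAnc = (fun x => if x = dN (bn v) * n + v then vert (bn v) else σ.arr aAnc x) ∧
        τ.arr aInn = σ.arr aInn := by
    refine (Tr.of_wp ?_).conseq (by decide) (fun _ h _ => h)
    simp only [Prog.wp]
    simp [hi, h.hbn, hdep, h.hn, hvert]
    omega
  refine h1.seq (T₂ := dN (bn v) * (30 + 2 + 1) + 2 + 1) ?_ (by omega)
  rintro τ₁ ⟨hT₁, hC₁, hA₁, hI₁⟩ hf₁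
  have hτ₁ := h.of_frame hf₁ rfl
  refine (Tr.loop (e := .read aParent (.var vT)) (k := dN (bn v)) (T := 30)
    (fun k τ => ∃ j, j + k = dN (bn v) ∧ τ.var vT = climb par j (bn v) ∧
      τ.var vC = dN (bn v) - j ∧
      (∀ i ≤ j, τ.arr aAnc ((dN (bn v) - i) * n + v) = vert (climb par i (bn v))) ∧
      (∀ w < n, w ≠ v → ∀ i, τ.arr aAnc (i * n + w) = σ.arr aAnc (i * n + w)) ∧
      ∀ w < n, τ.arr aInn w ≤ 1 ∧ (τ.arr aInn w = 1 ↔ σ.arr aInn w = 1 ∨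
        ∃ i, 0 < i ∧ i ≤ j ∧ vert (climb par i (bn v)) = w))
    ⟨0, by omega, by simp [hT₁, climb], by simp [hC₁], ?_, ?_, ?_⟩ ?_).conseq le_rfl ?_
  · intro i hi0
    obtain rfl : i = 0 := by omega
    simp [hA₁, climb]
  · intro w hw hwv i
    rw [hA₁]
    simp only [Inst.idx_inj hw hv, hwv, and_false, if_false]
  · intro w hw
    rw [hI₁]
    refine ⟨hinn w hw, ?_⟩
    constructor
    · exact fun h => .inl h
    · rintro (h | ⟨i, h0, h1, -⟩)
      · exact h
      · omega
  · rintro k τ ⟨j, hj, hT, hC, h6, h7, h8⟩ hf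
    have hτ := hτ₁.of_frame hf rfl
    have hi' : τ.var vI = v := by rw [hf.var _ rfl, hf₁.var _ rfl, hi]
    have hvert' : τ.arr aVert = vert := by rw [hf.arr _ rfl, hf₁.arr _ rfl, hvert]
    obtain ⟨h2, h3⟩ := h.input.climb_lt hbn (j := j) (by omega)
    have h4 := h.input.par_le h2
    have h5 := h.input.par_eq_zero h2
    refine ⟨by simp [hτ.hpar, hT]; omega, fun he => ?_⟩
    have he' : par (climb par j (bn v)) ≠ 0 := by simpa [hτ.hpar, hT] using he
    have hjd : j + 1 ≤ dN (bn v) := by omega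
    have hcl := h.input.climb_lt hbn hjd
    have hvt := h.input.vert_lt hvl hv hjd
    have hix' := h.idx_lt (i := dN (bn v) - j - 1) (by omega) hv
    rw [climb_succ] at hvt hcl
    have e1 : dN (bn v) - (j + 1) = dN (bn v) - j - 1 := by omega
    refine (Tr.wp_intro fun R hQ => ?_).conseq (by decide) (fun _ h _ => h)
    simp only [Prog.wp]
    simp [hτ.hpar, hT, hC, hτ.hn, hi', hvert']
    refine ⟨by omega, by omega, by omega, by omega, hQ _ ⟨k - 1, by omega, j + 1, by omega, ?_, ?_,
      fun i hi => ?_, fun w hw hwv i => ?_, fun w hw => ?_⟩⟩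
    · simp [climb_succ]
    · simp [e1]
    · simp only [Memory.arr_setArr, Memory.arr_setVar]
      simp only [show ¬ (7 : ℕ) = 8 by decide, if_false, if_true, Inst.idx_inj hv hv, and_true]
      by_cases hij : i = j + 1
      · rw [if_pos (by omega), hij, climb_succ]
      · rw [if_neg (by omega)]
        exact h6 i (by omega)
    · simp only [Memory.arr_setArr, Memory.arr_setVar]
      simp only [show ¬ (7 : ℕ) = 8 by decide, if_false, if_true, Inst.idx_inj hw hv, hwv,
        and_false]
      exact h7 w hw hwv i
    · simp only [Memory.arr_setArr, Memory.arr_setVar]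
      simp only [show ¬ (8 : ℕ) = 7 by decide, if_false, if_true]
      obtain ⟨q1, q2⟩ := h8 w hw
      by_cases hwt : w = vert (par (climb par j (bn v)) - 1)
      · rw [if_pos hwt]
        exact ⟨le_rfl, fun _ => .inr ⟨j + 1, by omega, le_rfl, by rw [climb_succ, hwt]⟩,
          fun _ => rfl⟩
      · rw [if_neg hwt]
        refine ⟨q1, q2.trans (or_congr_right ⟨?_, ?_⟩)⟩
        · rintro ⟨i, h0, hi, he⟩
          exact ⟨i, h0, by omega, he⟩
        · rintro ⟨i, h0, hi, he⟩
          refine ⟨i, h0, ?_, he⟩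
          by_contra hc
          obtain rfl : i = j + 1 := by omega
          rw [climb_succ] at he
          exact hwt he.symm
  · rintro τ ⟨⟨k, j, hj, hT, hC, h6, h7, h8⟩, he⟩ hf
    have hτ := hτ₁.of_frame hf rfl
    obtain ⟨h2, h3⟩ := h.input.climb_lt hbn (j := j) (by omega)
    have he' : par (climb par j (bn v)) = 0 := by simpa [hτ.hpar, hT] using he
    have h5 := h.input.root _ h2 he'
    obtain rfl : j = dN (bn v) := by omega
    exact ⟨h6, h7, h8⟩

lemma Tr.ancProg (h : Loaded n m N d B eu ev bn par dN σ) (hvert : σ.arr aVert = vert)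
    (hvl : ∀ v < n, vert (bn v) < n) (hdep : ∀ v < n, σ.arr aDep v = dN (bn v))
    (hinn : ∀ w < n, σ.arr aInn w = 0) :
    Tr B ancProg (n * (d * 40 + 50) + 10) σ fun τ =>
      (∀ v < n, ∀ j ≤ dN (bn v),
        τ.arr aAnc ((dN (bn v) - j) * n + v) = vert (climb par j (bn v))) ∧
      ∀ w < n, τ.arr aInn w ≤ 1 ∧ (τ.arr aInn w = 1 ↔
        ∃ v < n, ∃ j, 0 < j ∧ j ≤ dN (bn v) ∧ vert (climb par j (bn v)) = w) := by
  have hB := h.lin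
  refine (Tr.forP (T := d * 40 + 40) (fun k τ => (∀ v < k, ∀ j ≤ dN (bn v),
        τ.arr aAnc ((dN (bn v) - j) * n + v) = vert (climb par j (bn v))) ∧
      ∀ w < n, τ.arr aInn w ≤ 1 ∧ (τ.arr aInn w = 1 ↔
        ∃ v < k, ∃ j, 0 < j ∧ j ≤ dN (bn v) ∧ vert (climb par j (bn v)) = w)) rfl rfl h.hn
    (by omega) ⟨by simp, fun w hw => by simp [hinn w hw]⟩ ?_).conseq (by nlinarith)
    (fun _ h _ => h)
  rintro k τ hk hf hv ⟨h1, h2⟩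
  have hτ := h.of_frame hf rfl
  refine (Tr.ancBody hτ (by rw [hf.arr _ rfl, hvert]) hvl hk hv
    (by rw [hf.arr _ rfl]; exact hdep k hk) (fun w hw => (h2 w hw).1)).conseq le_rfl ?_
  rintro υ ⟨h3, h4, h5⟩ -
  simp only [Memory.arr_setVar]
  refine ⟨fun v hv j hj => ?_, fun w hw => ⟨(h5 w hw).1, ?_⟩⟩
  · by_cases hvk : v = k
    · subst hvk
      exact h3 j hj
    · rw [h4 v (by omega) hvk]
      exact h1 v (by omega) j hj
  · rw [(h5 w hw).2, (h2 w hw).2]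
    constructor
    · rintro (⟨v, hv, h⟩ | h)
      · exact ⟨v, by omega, h⟩
      · exact ⟨k, by omega, h⟩
    · rintro ⟨v, hv, h⟩
      rcases Nat.lt_succ_iff_lt_or_eq.1 hv with h' | h'
      · exact .inl ⟨v, h', h⟩
      · subst h'
        exact .inr h

lemma Tr.rlProg (h : Loaded n m N d B eu ev bn par dN σ)
    (hdep : ∀ v < n, σ.arr aDep v ≤ d) (hinn : ∀ w < n, σ.arr aInn w ≤ 1) :
    Tr B rlProg (n * 30 + 10) σ fun τ => ∀ v < n, τ.arr aRl v = σ.arr aDep v + σ.arr aInn v := by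
  have hB := h.lin
  refine (Tr.forP (T := 20) (fun k τ => ∀ v < k, τ.arr aRl v = σ.arr aDep v + σ.arr aInn v)
    rfl rfl h.hn (by omega) (by simp) ?_).conseq (by omega) (fun _ h _ => h)
  rintro k τ hk hf hv h1
  have e1 : τ.arr aDep = σ.arr aDep := hf.arr _ rfl
  have e2 : τ.arr aInn = σ.arr aInn := hf.arr _ rfl
  have h2 := hdep k hk
  have h3 := hinn k hk
  refine (Tr.wp_intro fun R hQ => ?_).conseq (by decide) (fun _ h _ => h)
  simp only [Prog.wp]
  simp [hv, e1, e2]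
  refine ⟨by omega, hQ _ fun v hv => ?_⟩
  by_cases hvk : v = k
  · simp [hvk]
  · simpa [hvk] using h1 v (by omega)

lemma Tr.orientProg (h : Loaded n m N d B eu ev bn par dN σ)
    (hdep : ∀ v < n, σ.arr aDep v ≤ d) :
    Tr B orientProg (m * 40 + 10) σ fun τ => ∀ i < m,
      τ.arr aUp i = (if σ.arr aDep (ev i) < σ.arr aDep (eu i) then ev i else eu i) ∧
      τ.arr aLo i = (if σ.arr aDep (ev i) < σ.arr aDep (eu i) then eu i else ev i) := by
  have hB := h.lin
  refine (Tr.forP (T := 30) (fun k τ => ∀ i < k,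
      τ.arr aUp i = (if σ.arr aDep (ev i) < σ.arr aDep (eu i) then ev i else eu i) ∧
      τ.arr aLo i = (if σ.arr aDep (ev i) < σ.arr aDep (eu i) then eu i else ev i))
    rfl rfl h.hm (by omega) (by simp) ?_).conseq (by omega) (fun _ h _ => h)
  rintro k τ hk hf hv h1
  have hτ := h.of_frame hf rfl
  have e1 : τ.arr aDep = σ.arr aDep := hf.arr _ rfl
  have hu := h.input.eu_lt k hk
  have hw := h.input.ev_lt k hk
  have h2 := hdep _ hu
  have h3 := hdep _ hw
  refine (Tr.wp_intro fun R hQ => ?_).conseq (by decide) (fun _ h _ => h)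
  simp only [Prog.wp]
  simp [hv, e1, hτ.heu, hτ.hev, show 1 < B by omega]
  refine ⟨by omega, fun h4 => ⟨by omega, by omega, hQ _ fun i hi => ?_⟩,
    fun h4 => ⟨by omega, by omega, hQ _ fun i hi => ?_⟩⟩
  · by_cases hik : i = k
    · simp [hik, h4]
    · simpa [hik] using h1 i (by omega)
  · by_cases hik : i = k
    · simp [hik, not_lt.2 h4]
    · simpa [hik] using h1 i (by omega)

/-- `D` is the largest depth of a node whose bag contains a vertex, so it may be smaller than the
depth `d` of the forest; only the inequality is needed for the time bound. -/
lemma Tr.treeProg (h : Loaded n m N d B eu ev bn par dN σ) (hinn : ∀ w < n, σ.arr aInn w = 0) :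
    Tr B treeProg (200 * ((d + 1) * (n + m + 1))) σ fun τ => ∃ I : Inst, I.n = n ∧ I.m = m ∧
      I.D ≤ d ∧ Core I τ ∧ Built I eu ev bn par dN (τ.arr aVert) (τ.arr aInn) := by
  have hB := h.lin
  refine (Tr.vertProg h).seq (T₂ := (n * (d * 20 + 50) + 10) + ((n * (d * 40 + 50) + 10) +
    ((n * 30 + 10) + (m * 40 + 10)))) (fun τ₁ h₁ hf₁ => ?_) ?_
  swap
  · have e1 : (d + 1) * (n + m + 1) = d * n + d * m + d + n + m + 1 := by ring
    have e2 : n * (d * 20 + 50) = 20 * (d * n) + 50 * n := by ring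
    have e3 : n * (d * 40 + 50) = 40 * (d * n) + 50 * n := by ring
    omega
  have hτ₁ := h.of_frame hf₁ rfl
  refine (Tr.depProg hτ₁).seq ?_
  rintro τ₂ ⟨h₂, hD⟩ hf₂
  have hτ₂ := hτ₁.of_frame hf₂ rfl
  have hvert₂ : τ₂.arr aVert = τ₁.arr aVert := hf₂.arr _ rfl
  refine (Tr.ancProg hτ₂ hvert₂ (fun v hv => (h₁ v hv).1) (fun v hv => (h₂ v hv).1)
    (by rw [hf₂.arr _ rfl, hf₁.arr _ rfl]; exact hinn)).seq ?_
  rintro τ₃ ⟨h₃, h₃'⟩ hf₃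
  have hτ₃ := hτ₂.of_frame hf₃ rfl
  have hdep₃ : τ₃.arr aDep = τ₂.arr aDep := hf₃.arr _ rfl
  have hdep_le : ∀ v < n, τ₂.arr aDep v ≤ d := fun v hv => by
    rw [(h₂ v hv).1]
    exact h.dN_le v hv
  refine (Tr.rlProg hτ₃ (by rw [hdep₃]; exact hdep_le) (fun w hw => (h₃' w hw).1)).seq ?_
  intro τ₄ h₄ hf₄
  have hτ₄ := hτ₃.of_frame hf₄ rfl
  have hdep₄ : τ₄.arr aDep = τ₂.arr aDep := by rw [hf₄.arr _ rfl, hdep₃]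
  refine (Tr.orientProg hτ₄ (by rw [hdep₄]; exact hdep_le)).conseq le_rfl ?_
  intro τ h₅ hf₅
  have hτ := hτ₄.of_frame hf₅ rfl
  have hdep : τ.arr aDep = τ₂.arr aDep := by rw [hf₅.arr _ rfl, hdep₄]
  have hvert : τ.arr aVert = τ₁.arr aVert := by
    rw [hf₅.arr _ rfl, hf₄.arr _ rfl, hf₃.arr _ rfl, hvert₂]
  have hinn : τ.arr aInn = τ₃.arr aInn := by rw [hf₅.arr _ rfl, hf₄.arr _ rfl]
  have hanc : τ.arr aAnc = τ₃.arr aAnc := by rw [hf₅.arr _ rfl, hf₄.arr _ rfl]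
  have hrl : τ.arr aRl = τ₄.arr aRl := hf₅.arr _ rfl
  have hvD : τ.var vD = τ₂.var vD := by rw [hf₅.var _ rfl, hf₄.var _ rfl, hf₃.var _ rfl]
  rw [hdep₄] at h₅
  rw [hdep₃] at h₄
  refine ⟨⟨n, m, τ.var vD, τ.arr aUp, τ.arr aLo, τ.arr aDep, τ.arr aRl, τ.arr aAnc⟩, rfl, rfl,
    by rw [hvD]; exact hD, ⟨hτ.hn, hτ.hm, rfl, rfl, rfl, rfl, rfl, rfl⟩, ?_⟩
  simp only [hdep, hvert, hinn, hanc, hrl, hvD]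
  exact ⟨fun v hv => (h₁ v hv).1, fun v hv => (h₁ v hv).2, fun v hv => (h₂ v hv).1,
    fun v hv => by simpa only [(h₂ v hv).1] using (h₂ v hv).2, h₃, fun v hv => (h₃' v hv).1,
    fun v hv => (h₃' v hv).2, h₄, fun i hi => (h₅ i hi).1, fun i hi => (h₅ i hi).2⟩

end OddCycleTransversal

namespace OddCycleTransversal

open Finset

/-! ### Rooted forests on an initial segment of the natural numbers -/

namespace RootedForest

variable {ν : Type} (F : RootedForest ν) {s t : ν}

lemma not_properAncestor_self (t : ν) : ¬ F.ProperAncestor t t := fun h =>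
  F.wf.transGen.asymmetric _ _ h h

lemma nodeDepth_root (h : F.parent t = none) : F.nodeDepth t = 0 := by
  have : {s | F.ProperAncestor s t} = ∅ := by
    ext a
    simp [ProperAncestor, Relation.TransGen.tail'_iff, h]
  rw [nodeDepth, this, Set.ncard_empty]

lemma nodeDepth_child [Finite ν] (h : F.parent t = some s) :
    F.nodeDepth t = F.nodeDepth s + 1 := by
  have : {a | F.ProperAncestor a t} = insert s {a | F.ProperAncestor a s} := by
    ext a
    simp only [ProperAncestor, Set.mem_ofPred_eq, Set.mem_insert_iff]
    rw [Relation.TransGen.tail'_iff]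
    simp only [h, Option.some.injEq, exists_eq_right']
    rw [Relation.reflTransGen_iff_eq_or_transGen, eq_comm]
  exact (congrArg Set.ncard this).trans
    (Set.ncard_insert_of_notMem (F.not_properAncestor_self s) (Set.toFinite _))

lemma nodeDepth_lt [Fintype ν] (t : ν) : F.nodeDepth t < Fintype.card ν := by
  rw [← Nat.card_eq_fintype_card, ← Set.ncard_univ]
  exact Set.ncard_lt_ncard (Set.ssubset_univ_iff.2 fun h =>
    F.not_properAncestor_self t (h ▸ Set.mem_univ t : t ∈ {s | F.ProperAncestor s t}))

lemma nodeDepth_le_of_isLeaf [Fintype ν] (h : F.IsLeaf t) : F.nodeDepth t ≤ F.depth := by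
  classical
  exact le_sup (f := F.nodeDepth) (mem_filter.2 ⟨mem_univ _, h⟩)

/-- From a node that is not a leaf one can step to a child, which is deeper. Depths are bounded by
the number of nodes, so this reaches a leaf at least as deep. -/
lemma nodeDepth_le_depth [Fintype ν] (t : ν) : F.nodeDepth t ≤ F.depth := by
  obtain ⟨k, hk⟩ := Nat.exists_eq_add_of_lt (F.nodeDepth_lt t)
  induction k generalizing t with
  | zero =>
    refine F.nodeDepth_le_of_isLeaf fun s hs => ?_
    have h1 := F.nodeDepth_child hs
    have h2 := F.nodeDepth_lt s
    omega
  | succ k ih =>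
    by_cases hl : F.IsLeaf t
    · exact F.nodeDepth_le_of_isLeaf hl
    · simp only [IsLeaf, not_forall, not_not] at hl
      obtain ⟨s, hs⟩ := hl
      have h1 := F.nodeDepth_child hs
      have := ih s (by omega)
      omega

lemma depth_le [Fintype ν] : F.depth ≤ Fintype.card ν :=
  Finset.sup_le fun t _ => (F.nodeDepth_lt t).le

/-- The array of the parents, as in the input. -/
def parents {N : ℕ} (F : RootedForest (Fin N)) : ℕ → ℕ :=
  cells fun t => (F.parent t).elim 0 fun j => (j : ℕ) + 1

end RootedForest

lemma cells_val {k : ℕ} (f : Fin k → ℕ) (i : Fin k) : cells f i = f i := by simp [cells]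

lemma cells_mk {k : ℕ} (f : Fin k → ℕ) {i : ℕ} (h : i < k) : cells f i = f ⟨i, h⟩ :=
  cells_val f ⟨i, h⟩

namespace RootedForest

variable {N : ℕ} (F : RootedForest (Fin N)) {s t : Fin N}

lemma parents_of_some (h : F.parent t = some s) : F.parents t = s + 1 := by
  simp [parents, cells_val, h]

lemma parents_of_none (h : F.parent t = none) : F.parents t = 0 := by
  simp [parents, cells_val, h]

lemma exists_climb (h : F.Ancestor s t) : ∃ j ≤ F.nodeDepth t, climb F.parents j t = s := by
  induction h with
  | refl => exact ⟨0, by omega, rfl⟩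
  | @tail u w _ hw ih =>
    obtain ⟨j, hj, h⟩ := ih
    refine ⟨j + 1, by rw [F.nodeDepth_child hw]; omega, ?_⟩
    rw [← climb_add, climb_succ]
    simpa [climb, F.parents_of_some hw] using h

/-- Every node reached by at least one step has a child and is internal, so its bag is a single
vertex. -/
lemma exists_eq_climb (t : Fin N) {j : ℕ} (hj : j ≤ F.nodeDepth t) :
    ∃ s : Fin N, (s : ℕ) = climb F.parents j t ∧ (0 < j → ¬ F.IsLeaf s) ∧
      F.nodeDepth s + j = F.nodeDepth t := by
  induction j with
  | zero => exact ⟨t, rfl, fun h => absurd h (lt_irrefl _), rfl⟩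
  | succ j ih =>
    obtain ⟨s, h1, -, h2⟩ := ih (by omega)
    cases hp : F.parent s with
    | none =>
      have := F.nodeDepth_root hp
      omega
    | some u =>
      have h3 := F.nodeDepth_child hp
      refine ⟨u, ?_, fun _ hl => hl s hp, by omega⟩
      rw [climb_succ, ← h1, F.parents_of_some hp, Nat.add_sub_cancel]

end RootedForest

/-! ### Two-colourings -/

section Colour

variable {V : Type} {G : SimpleGraph V}

lemma exists_colour {s : Set V} (h : (G.induce s).IsBipartite) :
    ∃ f : V → ℕ, (∀ v, f v ≤ 1) ∧ ∀ u ∈ s, ∀ w ∈ s, G.Adj u w → f u ≠ f w := by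
  classical
  obtain ⟨C⟩ := h
  refine ⟨fun v => if h : v ∈ s then (C ⟨v, h⟩ : Fin 2).val else 0, fun v => ?_,
    fun u hu w hw ha => ?_⟩
  · dsimp only
    split_ifs <;> omega
  · simp only [hu, hw, dif_pos]
    intro he
    exact C.valid (v := ⟨u, hu⟩) (w := ⟨w, hw⟩) ha (Fin.ext he)

lemma isBipartite_of_colour {s : Set V} {f : V → ℕ} (hf : ∀ v ∈ s, f v ≤ 1)
    (h : ∀ u ∈ s, ∀ w ∈ s, G.Adj u w → f u ≠ f w) : (G.induce s).IsBipartite :=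
  ⟨SimpleGraph.Coloring.mk (fun v => (⟨f v, Nat.lt_succ_of_le (hf v v.2)⟩ : Fin 2))
    fun {u w} ha he => h u u.2 w w.2 ha (by simpa using he)⟩

end Colour

lemma IsEdgeList.adj {n m : ℕ} {G : SimpleGraph (Fin n)} {e : Fin m → Fin n × Fin n}
    (he : IsEdgeList G e) (i : Fin m) : G.Adj (e i).1 (e i).2 := by
  rw [← SimpleGraph.mem_edgeSet, ← he.2]
  exact ⟨i, rfl⟩

lemma IsEdgeList.exists_of_adj {n m : ℕ} {G : SimpleGraph (Fin n)} {e : Fin m → Fin n × Fin n}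
    (he : IsEdgeList G e) {u w : Fin n} (h : G.Adj u w) : ∃ i, s((e i).1, (e i).2) = s(u, w) := by
  rw [← SimpleGraph.mem_edgeSet, ← he.2] at h
  exact h

section Input

variable {n m N : ℕ} {G : SimpleGraph (Fin n)} {F : RootedForest (Fin N)}
  {χ : Fin N → Set (Fin n)} {e : Fin m → Fin n × Fin n} {b : Fin n → Fin N}

lemma IsEliminationForest.node_eq (hF : IsEliminationForest Bip G F χ) (hb : ∀ v, v ∈ χ (b v))
    {v : Fin n} {t : Fin N} (h : v ∈ χ t) : b v = t :=
  (hF.partition v).unique (hb v) h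

lemma IsEliminationForest.bag_isBipartite (hF : IsEliminationForest Bip G F χ) (t : Fin N) :
    (G.induce (χ t)).IsBipartite := by
  by_cases hl : F.IsLeaf t
  · exact hF.base t hl
  · obtain ⟨a, ha⟩ := Set.ncard_eq_one.1 (hF.internal t hl)
    refine isBipartite_of_colour (f := fun _ => 0) (fun _ _ => by omega) fun u hu w hw h => ?_
    rw [ha, Set.mem_singleton_iff] at hu hw
    exact absurd (hu.trans hw.symm) h.ne

lemma IsEliminationForest.input (hF : IsEliminationForest Bip G F χ) (he : IsEdgeList G e)
    (hb : ∀ v, v ∈ χ (b v)) :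
    ForestInput n m N (cells fun i => ((e i).1 : ℕ)) (cells fun i => ((e i).2 : ℕ))
      (cells fun v => (b v : ℕ)) F.parents (cells F.nodeDepth) where
  eu_lt i hi := by
    rw [cells_mk _ hi]
    exact (e ⟨i, hi⟩).1.2
  ev_lt i hi := by
    rw [cells_mk _ hi]
    exact (e ⟨i, hi⟩).2.2
  bn_lt v hv := by
    rw [cells_mk _ hv]
    exact (b ⟨v, hv⟩).2
  root t ht h := by
    rw [cells_mk _ ht]
    cases hp : F.parent ⟨t, ht⟩ with
    | none => exact F.nodeDepth_root hp
    | some u =>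
      have := F.parents_of_some hp
      dsimp only at this
      omega
  step t ht h := by
    rw [cells_mk _ ht]
    cases hp : F.parent ⟨t, ht⟩ with
    | none => exact absurd (F.parents_of_none hp) h
    | some u =>
      have h1 := F.parents_of_some hp
      dsimp only at h1
      rw [h1, Nat.add_sub_cancel, cells_val]
      exact ⟨u.2, F.nodeDepth_child hp⟩
  ne i hi h := by
    rw [cells_mk _ hi, cells_mk _ hi] at h
    exact (he.adj ⟨i, hi⟩).ne (Fin.ext h)
  single v hv j h0 hj := by
    rw [cells_mk _ hv, cells_val] at hj
    obtain ⟨s, h1, h2, -⟩ := F.exists_eq_climb _ hj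
    obtain ⟨a, ha⟩ := Set.ncard_eq_one.1 (hF.internal s (h2 h0))
    have hba : b a = s := hF.node_eq hb (by rw [ha]; rfl)
    refine ⟨a, a.2, by rw [cells_val, cells_mk _ hv, hba, h1], fun w hw h => ?_⟩
    rw [cells_mk _ hw, cells_val, hba] at h
    have h3 := hb ⟨w, hw⟩
    rw [Fin.ext h, ha, Set.mem_singleton_iff] at h3
    rw [← h3]
  edge i hi := by
    simp only [cells_mk _ hi, cells_val]
    rcases hF.edge _ _ _ _ (he.adj ⟨i, hi⟩) (hb _) (hb _) with h | h
    · exact .inl (F.exists_climb h)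
    · exact .inr (F.exists_climb h)
  bip := by
    -- The 2-colourings of the bags are glued by colouring each vertex as in its own bag; only edges
    -- inside a bag matter.
    choose f hf1 hf using fun t => exists_colour (hF.bag_isBipartite t)
    refine ⟨cells fun v => f (b v) v, fun i hi h => ?_⟩
    simp only [cells_mk _ hi, cells_val] at h ⊢
    have h1 := Fin.ext h
    have h2 := hf (b (e ⟨i, hi⟩).2) _ (h1 ▸ hb _) _ (hb _) (he.adj ⟨i, hi⟩)
    rw [h1]
    have h3 := hf1 (b (e ⟨i, hi⟩).2) (e ⟨i, hi⟩).1
    have h4 := hf1 (b (e ⟨i, hi⟩).2) (e ⟨i, hi⟩).2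
    omega

end Input

/-! ### Colourings and odd cycle transversals -/

section Transversal

open Inst

variable {n m : ℕ} {G : SimpleGraph (Fin n)} {e : Fin m → Fin n × Fin n}

/-- The vertices of colour `0`. -/
def zeros (n : ℕ) (s : ℕ → ℕ) : Finset (Fin n) := {v : Fin n | s v = 0}

lemma map_zeros (n : ℕ) (s : ℕ → ℕ) :
    (zeros n s).map Fin.valEmbedding = {v ∈ range n | s v = 0} := by
  ext v
  simp only [zeros, mem_map, mem_filter, mem_univ, true_and, Fin.valEmbedding_apply, mem_range]
  constructor
  · rintro ⟨w, hw, rfl⟩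
    exact ⟨w.2, hw⟩
  · rintro ⟨hv, h⟩
    exact ⟨⟨v, hv⟩, h, rfl⟩

lemma isOCT_zeros (he : IsEdgeList G e) {s : ℕ → ℕ} (hle : ∀ v < n, s v ≤ 2)
    (hok : ∀ i : Fin m, Okc (s (e i).1) (s (e i).2)) : IsOCT G (zeros n s) := by
  -- Outside the zero set the colours are 1 and 2, so subtracting 1 loses nothing.
  refine isBipartite_of_colour (f := fun v => s v - 1) (fun v _ => ?_) fun u hu w hw ha => ?_
  · have := hle v v.2
    omega
  · obtain ⟨i, hi⟩ := he.exists_of_adj ha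
    have h := hok i
    simp only [zeros, coe_filter, mem_univ, true_and, Set.mem_compl_iff, Set.mem_ofPred_eq] at hu hw
    unfold Okc at h
    rcases Sym2.eq_iff.1 hi with ⟨h1, h2⟩ | ⟨h1, h2⟩ <;> rw [h1, h2] at h <;> omega

lemma IsOCT.exists_colour (he : IsEdgeList G e) {Y : Finset (Fin n)} (hY : IsOCT G Y) :
    ∃ s : ℕ → ℕ, (∀ v, s v ≤ 2) ∧ (∀ i : Fin m, Okc (s (e i).1) (s (e i).2)) ∧
      zeros n s = Y := by
  obtain ⟨f, hf1, hf⟩ := OddCycleTransversal.exists_colour hY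
  refine ⟨cells fun v => if v ∈ Y then 0 else f v + 1, fun v => ?_, fun i => ?_, ?_⟩
  · by_cases hv : v < n
    · have := hf1 ⟨v, hv⟩
      rw [cells_mk _ hv]
      split_ifs <;> omega
    · simp [cells, hv]
  · simp only [cells_val, Okc]
    split_ifs with h1 h2 h2
    · exact .inl rfl
    · exact .inl rfl
    · exact .inr (by omega)
    · have := hf _ (by simpa using h1) _ (by simpa using h2) (he.adj i)
      right
      omega
  · ext v
    simp only [zeros, mem_filter, mem_univ, true_and, cells_val]
    split_ifs with h <;> simp [h]

end Transversal

end OddCycleTransversal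

namespace OddCycleTransversal

open Finset

/-! ### The algorithm -/

def octProg : Prog := treeProg ;; netProg ;; searchProg ;; outProg

/-! ### Total running time, word size and the final assembly -/

section Assembly

variable {n m N d B : ℕ} {eu ev bn par dN : ℕ → ℕ} {σ : Memory}

lemma Built.okc_iff {I : Inst} {vert inn s : ℕ → ℕ} (hb : Built I eu ev bn par dN vert inn) {i : ℕ}
    (hi : i < I.m) : Inst.Okc (s (I.up i)) (s (I.lo i)) ↔ Inst.Okc (s (eu i)) (s (ev i)) := by
  rw [hb.up i hi, hb.lo i hi]
  split_ifs
  · exact ⟨Inst.Okc.symm, Inst.Okc.symm⟩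
  · rfl

lemma Tr.octProg (h : Loaded n m N d B eu ev bn par dN σ)
    (h0 : ∀ a ∈ [aEn, aFst, aVis, aDig, aSol, aInn], ∀ x, σ.arr a x = 0) :
    Tr B octProg (3 ^ d * (4000 * ((d + 1) * (n + m + 1))) + 2000 * ((d + 1) * (n + m + 1))) σ
      fun τ => ∃ s : ℕ → ℕ, (∀ v < n, s v ≤ 2) ∧ (∀ i < m, Inst.Okc (s (eu i)) (s (ev i))) ∧
        (∀ s' : ℕ → ℕ, (∀ v < n, s' v ≤ 2) → (∀ i < m, Inst.Okc (s' (eu i)) (s' (ev i))) →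
          #{v ∈ range n | s v = 0} ≤ #{v ∈ range n | s' v = 0}) ∧
        τ.var vCnt = #{v ∈ range n | s v = 0} ∧
        (range #{v ∈ range n | s v = 0}).image (τ.arr aOut) = {v ∈ range n | s v = 0} := by
  simp only [List.forall_mem_cons, List.not_mem_nil, false_imp_iff, implies_true, and_true] at h0
  obtain ⟨hen, hfst, hvis, hdig, hsol, hinn⟩ := h0
  refine (Tr.treeProg h fun w _ => hinn w).seq (T₂ := 1500 * (n + m + 1) +
    ((3 ^ d * (3000 * ((d + 1) * (n + m + 1))) + 6) + (n * 30 + 10))) ?_ ?_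
  swap
  · have e1 : (d + 1) * (n + m + 1) = d * n + d * m + d + n + m + 1 := by ring
    have e2 : 3 ^ d * (4000 * ((d + 1) * (n + m + 1))) = 3 ^ d * (3000 * ((d + 1) * (n + m + 1))) +
      3 ^ d * (1000 * ((d + 1) * (n + m + 1))) := by ring
    have e3 : 1 * (1000 * ((d + 1) * (n + m + 1))) ≤ 3 ^ d * (1000 * ((d + 1) * (n + m + 1))) :=
      Nat.mul_le_mul_right _ (Nat.one_le_pow d 3 (by norm_num))
    omega
  rintro τ₁ ⟨I, rfl, rfl, hD, hcore, hb⟩ hf₁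
  have hI := hb.valid h.input
  have hR : I.Room B := by
    refine ⟨?_, ?_⟩
    · have := h.lin
      omega
    · exact (Nat.mul_le_mul_right _ (by omega)).trans_lt h.idx
  refine (Tr.netProg hI hR hcore (fun x _ => by rw [hf₁.arr _ rfl, hen])
    (fun x _ => by rw [hf₁.arr _ rfl, hfst]) (fun x _ => by rw [hf₁.arr _ rfl, hvis])).seq ?_
  rintro τ₂ ⟨hst, hs⟩ hf₂
  have hsearch : Searching I (τ₂.arr aSide) τ₂ := by
    have h1 : ∀ i, τ₂.arr aDig i = 0 := fun i => by rw [hf₂.arr _ rfl, hf₁.arr _ rfl, hdig]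
    refine ⟨hst, fun i _ => by simp [h1], fun v _ i => ?_, fun i _ st _ => ?_⟩
    · rw [Inst.row, hf₂.arr _ rfl, hf₁.arr _ rfl, hsol]
      omega
    · rw [h1]
      exact Inst.Part.zero
  refine ((Tr.searchProg hI hR hsearch hs).conseq
    (T := 3 ^ d * (3000 * ((d + 1) * (I.n + I.m + 1))) + 6) ?_ fun _ h _ => h).seq ?_
  · gcongr
    norm_num
  rintro τ₃ ⟨dig, st, hfull⟩ hf₃
  have hle : ∀ v < I.n, I.row τ₃ 0 v ≤ 2 := fun v hv => hfull.sound.le v hv (Nat.zero_le _)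
  refine (Tr.outProg hR (hst.of_frame hf₃ rfl) hle).conseq le_rfl fun τ hτ _ => ?_
  exact ⟨I.row τ₃ 0, hle, fun i hi => (hb.okc_iff hi).1 (hfull.okc hi),
    fun s' h1 h2 => hfull.minimum hI h1 fun i hi => (hb.okc_iff hi).2 (h2 i hi), hτ⟩

/-- The algorithm needs only a linear factor in `d`; the square is slack. The constant is `4000 +
2000`, times 4 for replacing `d + 1` and `n + m + 1` by twice the respective maxima. -/
lemma time_le (n m d : ℕ) : 3 ^ d * (4000 * ((d + 1) * (n + m + 1))) +
    2000 * ((d + 1) * (n + m + 1)) ≤ 24000 * (3 ^ d * (max d 1) ^ 2 * max (n + m) 1) := by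
  have h1 : (d + 1) * (n + m + 1) ≤ (2 * max d 1) * (2 * max (n + m) 1) :=
    Nat.mul_le_mul (by omega) (by omega)
  have h2 : max d 1 ≤ max d 1 ^ 2 := Nat.le_self_pow (by norm_num) _
  have h3 : max d 1 * max (n + m) 1 ≤ max d 1 ^ 2 * max (n + m) 1 := Nat.mul_le_mul_right _ h2
  have h4 : (d + 1) * (n + m + 1) ≤ 4 * (max d 1 ^ 2 * max (n + m) 1) := by
    refine h1.trans ?_
    calc _ = 4 * (max d 1 * max (n + m) 1) := by ring
      _ ≤ _ := Nat.mul_le_mul_left _ h3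
  have h5 := Nat.mul_le_mul_left (3 ^ d) h4
  have h6 := Nat.mul_le_mul_right ((d + 1) * (n + m + 1)) (Nat.one_le_pow d 3 (by norm_num))
  calc _ = 4000 * (3 ^ d * ((d + 1) * (n + m + 1))) + 2000 * (1 * ((d + 1) * (n + m + 1))) := by ring
    _ ≤ 6000 * (3 ^ d * ((d + 1) * (n + m + 1))) := by omega
    _ ≤ 6000 * (3 ^ d * (4 * (max d 1 ^ 2 * max (n + m) 1))) := Nat.mul_le_mul_left _ h5
    _ = _ := by ring

/-- Two powers of the input size dominate the table and the linear terms; the other ten, with base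
at least 2, contribute a factor `2 ^ 10` that absorbs the constant 100. -/
lemma room (n m N : ℕ) (hd : d ≤ N) :
    100 * (n + m + N + d + 2) < (n + m + N + 2) ^ 12 ∧ (d + 3) * n < (n + m + N + 2) ^ 12 := by
  obtain ⟨M, hM⟩ : ∃ M, M = n + m + N + 2 := ⟨_, rfl⟩
  rw [← hM]
  have h2 : 2 ^ 10 ≤ M ^ 10 := Nat.pow_le_pow_left (by omega) _
  have h3 : 2 ^ 10 * (M * M) ≤ M ^ 12 :=
    (Nat.mul_le_mul_right _ h2).trans (by rw [show M ^ 12 = M ^ 10 * (M * M) by ring])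
  have h4 : 2 * M ≤ M * M := Nat.mul_le_mul_right _ (by omega)
  have h5 : (d + 3) * n ≤ (2 * M) * M := Nat.mul_le_mul (by omega) (by omega)
  have h6 : 2 * M * M = 2 * (M * M) := by ring
  generalize M ^ 12 = P at *
  constructor <;> omega

lemma IsEliminationForest.loaded {G : SimpleGraph (Fin n)} {F : RootedForest (Fin N)}
    {χ : Fin N → Set (Fin n)} {e : Fin m → Fin n × Fin n} {b : Fin n → Fin N}
    (hF : IsEliminationForest Bip G F χ) (he : IsEdgeList G e) (hb : ∀ v, v ∈ χ (b v)) :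
    Loaded n m N F.depth ((n + m + N + 2) ^ 12) (cells fun i => ((e i).1 : ℕ))
      (cells fun i => ((e i).2 : ℕ)) (cells fun v => (b v : ℕ)) F.parents (cells F.nodeDepth)
      (inputMemory e b F) where
  hn := rfl
  hm := rfl
  heu := rfl
  hev := rfl
  hbn := rfl
  hpar := rfl
  input := hF.input he hb
  dN_le v hv := by
    rw [cells_mk _ hv, cells_val]
    exact F.nodeDepth_le_depth _
  lin := (room n m N (by simpa using F.depth_le)).1
  idx := (room n m N (by simpa using F.depth_le)).2

end Assembly

end OddCycleTransversal

open OddCycleTransversal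

theorem mainTheorem6 :
    ∃ (P : Prog) (C c : ℕ),
      ∀ (n m N : ℕ) (G : SimpleGraph (Fin n)) (F : RootedForest (Fin N))
        (χ : Fin N → Set (Fin n)) (e : Fin m → Fin n × Fin n) (b : Fin n → Fin N),
        IsEliminationForest Bip G F χ → IsEdgeList G e → (∀ v, v ∈ χ (b v)) →
        ∃ (t : ℕ) (τ : Memory) (X : Finset (Fin n)),
          Run ((n + m + N + 2) ^ c) ((n + m + N + 2) ^ c) P (inputMemory e b F) t τ ∧
          t ≤ C * (3 ^ F.depth * (max F.depth 1) ^ 2 * max (n + m) 1) ∧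
          Outputs τ X ∧ IsMinimumOCT G X := by
  refine ⟨octProg, 24000, 12, fun n m N G F χ e b hF he hb => ?_⟩
  obtain ⟨t, τ, hrun, ht, s, hle, hok, hmin, hcnt, hout⟩ :=
    -- The arrays that the algorithm expects to be zero are not among the input arrays.
    Tr.octProg (hF.loaded he hb) (by simp [inputMemory])
  have hcard : ∀ s, (zeros n s).card = ((Finset.range n).filter fun v => s v = 0).card :=
    fun s => by rw [← map_zeros, Finset.card_map]
  refine ⟨t, τ, zeros n s, hrun, ht.trans (time_le n m F.depth),
    ⟨by rw [hcnt, hcard], by rw [hcard, hout, map_zeros]⟩,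
    isOCT_zeros he hle fun i => ?_, fun Y hY => ?_⟩
  · simpa only [cells_val] using hok i i.2
  · obtain ⟨s', h1, h2, rfl⟩ := hY.exists_colour he
    rw [hcard, hcard]
    refine hmin s' (fun v _ => h1 v) fun i hi => ?_
    rw [cells_mk _ hi, cells_mk _ hi]
    exact h2 ⟨i, hi⟩
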